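/- Let $B_{j}$ be the Bernoulli numbers and define rational numbers $s_k$ ($k\ge 0$) by the formal power series identity $$\sum_{k\ge 0}s_kX^k=\exp\Big(-\sum_{r\ge 1}\frac{B_{2r}}{2r(2r-1)}X^{2r-1}\Big).$$ For $m\in\mathbb Z$ let $(2m-1)!!$ be determined by $(-1)!!=1$ and $(2m+1)!!=(2m+1)\,(2m-1)!!$, and for $n\in\mathbb Z$ put $$\eta_n(v)=\frac1v\sum_{k\ge 0}s_k\frac{(2(n-k)-1)!!}{v^{2(n-k)}} .$$ Let $\hat\xi_{-1}(t)=\frac{t-1}{t}$, $\hat\xi_0(t)=t-1$ and $\hat\xi_{n+1}(t)=t^2(t-1)\frac{d}{dt}\hat\xi_n(t)$ for $n\ge 0$. Near $t=\infty$ let $w(t)=-\frac1t-\log\left(1-\frac1t\right)$, let $v(t)=t^{-1}+O(t^{-2})$ be the analytic solution of $\frac12v(t)^2=w(t)$, given by $v(t)=t^{-1}\sqrt{2t^2w(t)}$ with the principal square root, and let $s(t)=-t+\frac23+\cdots$ be the nontrivial deck transformation of $w$, i.e. the unique germ of a map at $t=\infty$ with $s(t)\to\infty$ as $t\to\infty$,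 $s(t)\ne t$ and $w(s(t))=w(t)$. For every $n\ge -1$ the series $\eta_n(v)$ converges absolutely for all sufficiently small $v\neq 0$, and the following hold. (1) For every integer $n\ge 0$ the function $s\mapsto e^{-s}\frac{s^{s+n}}{\Gamma(s+1)}e^{-sw}$ is integrable on $(0,\infty)$ whenever $\operatorname{Re} w>0$, and there are a constant $c$ and a function $h$, holomorphic near $0$ with $h(0)=0$, such that for all sufficiently small $w$ with $\operatorname{Re}w>0$ $$\int_0^\infty e^{-s}\frac{s^{s+n}}{\Gamma(s+1)}e^{-sw}\,ds=\eta_n(v)+c+h(w),\qquad v=\sqrt{2w}\ \text{(principal square root)}.$$ This branch is that of $v(t)$: for all sufficiently large $t$ one has $\frac12v(t)^2=w(t)$, and $v(t)=\sqrt{2w(t)}$ if in addition $\operatorname{Re}t>0$ and $\operatorname{Re}w(t)>0$. (2) For every integer $n\ge -1$ and all sufficiently large $t\in\mathbb C$, with $v=v(t)$, $$\eta_n(v)=\tfrac12\big(\eta_n(v)-\eta_n(-v)\big)=\tfrac12\big(\hat\xi_n(t)-\hat\xi_n(s(t))\big);$$ in particular $\eta_{-1}(v)=\frac12\big(\hat\xi_{-1}(t)-\hat\xi_{-1}(s(t))\big)=\frac12\,\frac{t-s(t)}{t\,s(t)}$.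 (3) For every integer $n\ge -1$ there is a function $F_n$, holomorphic near $0$, such that for all sufficiently large $t\in\mathbb C$, with $v=v(t)$ and $w=w(t)$, $$\eta_n(v)=\hat\xi_n(t)+F_n(w),\qquad \eta_n(-v)=\hat\xi_n(s(t))+F_n(w).$$ -/

import Mathlib

open Filter Topology Bornology MeasureTheory
open scoped Nat

noncomputable section

/-! ### Coefficients of the Stirling series -/

/-- The formal power series `-∑_{r ≥ 1} B_{2r} / (2r (2r-1)) X^{2r-1}` (here `m = 2r - 1`), where
`X` stands for `N⁻¹`. -/
def stirlingExponent : PowerSeries ℚ :=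
  PowerSeries.mk fun m => if Odd m then -(bernoulli (m + 1) / (((m : ℚ) + 1) * m)) else 0

theorem hasSubst_stirlingExponent : PowerSeries.HasSubst stirlingExponent := by
  apply PowerSeries.HasSubst.of_constantCoeff_zero'
  simp [stirlingExponent, ← PowerSeries.coeff_zero_eq_constantCoeff_apply]

/-- The coefficient `s_k`: `∑ s_k X^k = exp (-∑_{r ≥ 1} B_{2r} / (2r (2r-1)) X^{2r-1})`. -/
def stirlingCoeff (k : ℕ) : ℚ :=
  PowerSeries.coeff k ((PowerSeries.exp ℚ).subst stirlingExponent)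

/-! ### The Laurent series `η_n` -/

/-- The double factorial `(2m - 1)!!` for every integer `m`; it is `(-1)^j / (2j - 1)!!` at
`m = -j < 0`, so that `(2m + 1)!! = (2m + 1) (2m - 1)!!` and `(-1)!! = 1`. -/
def oddDoubleFactorial : ℤ → ℚ
  | Int.ofNat m => ((2 * m - 1)‼ : ℕ)
  | Int.negSucc j => (-1) ^ (j + 1) / ((2 * j + 1)‼ : ℕ)

theorem oddDoubleFactorial_zero : oddDoubleFactorial 0 = 1 := by
  change (((2 * 0 - 1)‼ : ℕ) : ℚ) = 1
  simp

theorem oddDoubleFactorial_succ (m : ℤ) :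
    oddDoubleFactorial (m + 1) = (2 * m + 1) * oddDoubleFactorial m := by
  rcases m with m | j
  · change (((2 * (m + 1) - 1)‼ : ℕ) : ℚ) = (2 * ((m : ℤ) : ℚ) + 1) * (((2 * m - 1)‼ : ℕ) : ℚ)
    have h : 2 * (m + 1) - 1 = 2 * m + 1 := by omega
    rw [h, Nat.doubleFactorial_add_one]
    push_cast
    ring
  · rcases j with _ | j
    · change (((2 * 0 - 1)‼ : ℕ) : ℚ) = (2 * ((Int.negSucc 0 : ℤ) : ℚ) + 1) *
        ((-1) ^ (0 + 1) / ((2 * 0 + 1)‼ : ℕ))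
      norm_num [Nat.doubleFactorial]
    · change ((-1) ^ (j + 1) / ((2 * j + 1)‼ : ℕ) : ℚ) =
        (2 * ((Int.negSucc (j + 1) : ℤ) : ℚ) + 1) * ((-1) ^ (j + 1 + 1) / ((2 * (j + 1) + 1)‼ : ℕ))
      have h : 2 * (j + 1) + 1 = (2 * j + 1) + 2 := by ring
      rw [h, Nat.doubleFactorial_add_two]
      have h0 : (((2 * j + 1)‼ : ℕ) : ℚ) ≠ 0 := by
        exact_mod_cast (Nat.doubleFactorial_pos _).ne'
      have h1 : (2 * (j : ℚ) + 1 + 2) ≠ 0 := by positivity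
      rw [Int.cast_negSucc]
      push_cast
      field_simp
      ring

/-- The `k`-th term `s_k (2(n-k)-1)!! v^{-2(n-k)-1}` of the Laurent series `η_n`. -/
def etaTerm (n : ℤ) (v : ℂ) (k : ℕ) : ℂ :=
  v⁻¹ * ((stirlingCoeff k : ℂ) * (oddDoubleFactorial (n - k) : ℂ) / v ^ (2 * (n - k)))

/-- `η_n(v) = v⁻¹ ∑_{k ≥ 0} s_k (2(n-k)-1)!! / v^{2(n-k)}`. -/
def eta (n : ℤ) (v : ℂ) : ℂ := ∑' k : ℕ, etaTerm n v k

/-! ### The functions `ξ̂_n` -/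

/-- The polynomials `ξ̂_n`, `n ≥ 0`: `ξ̂_0 = t - 1` and `ξ̂_{n+1} = t² (t - 1) dξ̂_n/dt`. -/
def xiPoly : ℕ → Polynomial ℂ
  | 0 => Polynomial.X - 1
  | n + 1 => Polynomial.X ^ 2 * (Polynomial.X - 1) * Polynomial.derivative (xiPoly n)

/-- `ξ̂_n(t)` for integers `n ≥ -1`, with `ξ̂_{-1}(t) = (t - 1)/t`. It is only used for `n ≥ -1`
(the value for `n ≤ -2` is a placeholder). -/
def xiHat : ℤ → ℂ → ℂ
  | Int.ofNat n, t => (xiPoly n).eval t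
  | Int.negSucc _, t => (t - 1) / t

/-! ### Coordinates on the Lambert curve near `t = ∞` -/

/-- `w(t) = -1/t - log (1 - 1/t)`. -/
def wCoord (t : ℂ) : ℂ := -1 / t - Complex.log (1 - 1 / t)

/-- The solution `v(t) = t⁻¹ + O(t⁻²)` of `v² / 2 = w(t)` near `t = ∞`. Note that
`2 t² w(t) → 1` as `t → ∞`, so the principal square root is the analytic one there. -/
def vCoord (t : ℂ) : ℂ := t⁻¹ * (2 * t ^ 2 * wCoord t) ^ (1 / 2 : ℂ)

/-- `s` is the nontrivial deck transformation of the `w`-projection, near `t = ∞`. -/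
def IsDeckTransformation (s : ℂ → ℂ) : Prop :=
  Tendsto s (cobounded ℂ) (cobounded ℂ) ∧
    ∀ᶠ t in cobounded ℂ, s t ≠ t ∧ wCoord (s t) = wCoord t

theorem exists_local_coord : ∃ (V : ℂ → ℂ) (a : ℂ), a ≠ 0 ∧ V 0 = 0 ∧ HasStrictDerivAt V a 0 ∧
    ∀ᶠ u in 𝓝 (0 : ℂ), V u ^ 2 = wCoord u⁻¹ := by
  set W : ℂ → ℂ := fun u => wCoord u⁻¹ with hWdef
  have hW : W = fun u => -u - Complex.log (1 - u) := by
    funext u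
    simp [hWdef, wCoord]
  have hslit : ∀ᶠ u in 𝓝 (0 : ℂ), 1 - u ∈ Complex.slitPlane := by
    have hc : ContinuousAt (fun u : ℂ => 1 - u) 0 := by fun_prop
    exact hc.eventually (Complex.isOpen_slitPlane.mem_nhds (by simp))
  have hWan : AnalyticAt ℂ W 0 := by
    rw [hW]
    exact analyticAt_id.neg.sub ((analyticAt_const.sub analyticAt_id).clog (by simp))
  have hderiv : deriv W =ᶠ[𝓝 0] fun u => -1 + (1 - u)⁻¹ := by
    filter_upwards [hslit] with u hu
    have h1 : HasDerivAt (fun u : ℂ => 1 - u) (-1) u := by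
      simpa using (hasDerivAt_id u).const_sub 1
    have h2 := (hasDerivAt_id u).neg.sub (h1.clog hu)
    have h3 : HasDerivAt W (-1 + (1 - u)⁻¹) u := by
      rw [hW]
      refine h2.congr_deriv ?_
      simp [neg_div]
    exact h3.deriv
  have hd2 : HasDerivAt (deriv W) 1 0 := by
    have h1 : HasDerivAt (fun u : ℂ => 1 - u) (-1) 0 := by
      simpa using (hasDerivAt_id (0 : ℂ)).const_sub 1
    have h2 := (h1.inv (by simp)).const_add (-1)
    refine HasDerivAt.congr_of_eventuallyEq (h2.congr_deriv ?_) hderiv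
    simp
  have hW0 : W 0 = 0 := by simp [hW]
  have hord1 : analyticOrderAt (deriv W) 0 = 1 := by
    refine AnalyticAt.analyticOrderAt_eq_one_of_zero_deriv_ne_zero hWan.deriv ?_ ?_
    · rw [hderiv.self_of_nhds]; simp
    · rw [hd2.deriv]; exact one_ne_zero
  have hord : analyticOrderAt W 0 = (2 : ℕ) := by
    have h := hWan.analyticOrderAt_deriv_add_one
    simp only [hW0, sub_zero] at h
    rw [← h, hord1]
    norm_num
  obtain ⟨g, hg, hg0, hWg⟩ := (hWan.analyticOrderAt_eq_natCast).1 hord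
  obtain ⟨a, ha'⟩ := IsAlgClosed.exists_pow_nat_eq (g 0) (n := 2) (by norm_num)
  have ha : g 0 = a ^ 2 := ha'.symm
  have ha0 : a ≠ 0 := by
    rintro rfl
    simp [ha] at hg0
  set q : ℂ → ℂ := fun u => a * (g u / g 0) ^ (1 / 2 : ℂ) with hq
  have hqan : AnalyticAt ℂ q 0 := by
    refine analyticAt_const.mul ((hg.div analyticAt_const hg0).cpow analyticAt_const ?_)
    simp [hg0]
  have hq0 : q 0 = a := by simp [hq, hg0]
  have hq2 : ∀ u, q u ^ 2 = g u := by
    intro u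
    simp only [hq]
    rw [mul_pow, ← Complex.cpow_nat_mul, ← ha]
    field_simp
    simp
    field_simp
  refine ⟨fun u => u * q u, a, ha0, by simp, ?_, ?_⟩
  · have h := (hasStrictDerivAt_id (0 : ℂ)).mul hqan.hasStrictDerivAt
    refine h.congr_deriv ?_
    simp [hq0]
  · filter_upwards [hWg] with u hu
    rw [mul_pow, hq2]
    simpa using hu.symm

theorem exists_isDeckTransformation : ∃ s, IsDeckTransformation s := by
  obtain ⟨V, a, ha, hV0, hVd, hV2⟩ := exists_local_coord
  set I := hVd.localInverse V a 0 ha with hI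
  have hId : HasStrictDerivAt I a⁻¹ 0 := by
    have h := hVd.to_localInverse ha
    rwa [hV0] at h
  have hI0 : I 0 = 0 := by
    have h := (hVd.eventually_left_inverse ha).self_of_nhds
    rwa [hV0] at h
  have hVI : ∀ᶠ x in 𝓝 (0 : ℂ), V (I x) = x := by
    have h := hVd.eventually_right_inverse ha
    rwa [hV0] at h
  have hneg : Tendsto (fun u => -V u) (𝓝 0) (𝓝 0) := by
    have h := hVd.hasDerivAt.continuousAt.tendsto.neg
    simpa [hV0] using h
  have hS : Tendsto (fun u => I (-V u)) (𝓝 0) (𝓝 0) := by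
    have h := hId.hasDerivAt.continuousAt.tendsto.comp hneg
    simpa [hI0, Function.comp_def] using h
  have hVne : ∀ᶠ u in 𝓝[≠] (0 : ℂ), V u ≠ 0 := hVd.hasDerivAt.eventually_ne ha
  have hkey : ∀ᶠ u in 𝓝[≠] (0 : ℂ), I (-V u) ≠ 0 ∧ I (-V u) ≠ u ∧
      wCoord (I (-V u))⁻¹ = wCoord u⁻¹ := by
    filter_upwards [hVne, nhdsWithin_le_nhds (hneg.eventually hVI),
      nhdsWithin_le_nhds hV2, nhdsWithin_le_nhds (hS.eventually hV2)] with u h1 h2 h3 h4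
    refine ⟨fun h => ?_, fun h => ?_, ?_⟩
    · rw [h, hV0] at h2
      exact h1 (by simpa using h2.symm)
    · rw [h] at h2
      exact h1 (self_eq_neg.1 h2)
    · rw [← h3, ← h4, h2, neg_sq]
  refine ⟨fun t => (I (-V t⁻¹))⁻¹, ?_, ?_⟩
  · refine tendsto_inv₀_nhdsNE_zero.comp (tendsto_nhdsWithin_iff.2 ⟨?_, ?_⟩)
    · exact hS.comp tendsto_inv₀_cobounded
    · filter_upwards [tendsto_inv₀_cobounded'.eventually hkey] with t ht using ht.1
  · filter_upwards [tendsto_inv₀_cobounded'.eventually hkey] with t ht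
    refine ⟨fun h => ht.2.1 ?_, ?_⟩
    · have h' := congrArg (fun x : ℂ => x⁻¹) h
      simpa using h'
    · simpa using ht.2.2

/-- The deck transformation is unique as a germ at `t = ∞`. -/
theorem IsDeckTransformation.eventuallyEq {s s' : ℂ → ℂ} (hs : IsDeckTransformation s)
    (hs' : IsDeckTransformation s') : s =ᶠ[cobounded ℂ] s' := by
  obtain ⟨V, a, ha, hV0, hVd, hV2⟩ := exists_local_coord
  have hleft := hVd.eventually_left_inverse ha
  have hi : Tendsto (fun t : ℂ => t⁻¹) (cobounded ℂ) (𝓝 0) := tendsto_inv₀_cobounded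
  have key : ∀ r : ℂ → ℂ, IsDeckTransformation r →
      ∀ᶠ t in cobounded ℂ, V (r t)⁻¹ = -V t⁻¹ := by
    intro r hr
    filter_upwards [hr.2, hi.eventually hV2, (hi.comp hr.1).eventually hV2,
      hi.eventually hleft, (hi.comp hr.1).eventually hleft] with t h1 h2 h3 h4 h5
    simp only [Function.comp_apply, inv_inv] at h2 h3 h5
    have h6 : V (r t)⁻¹ ^ 2 = V t⁻¹ ^ 2 := by rw [h2, h3, h1.2]
    rcases sq_eq_sq_iff_eq_or_eq_neg.1 h6 with h | h
    · rw [h, h4] at h5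
      exact absurd (inv_injective h5).symm h1.1
    · exact h
  filter_upwards [key s hs, key s' hs', (hi.comp hs.1).eventually hleft,
    (hi.comp hs'.1).eventually hleft] with t h1 h2 h3 h4
  simp only [Function.comp_apply] at h3 h4
  rw [h1] at h3
  rw [h2] at h4
  exact inv_injective (h3.symm.trans h4)

/-- The involution `s(t) = -t + 2/3 + ⋯`, the deck transformation near `t = ∞`. -/
def deckInvolution : ℂ → ℂ := Classical.choose exists_isDeckTransformation

theorem isDeckTransformation_deckInvolution : IsDeckTransformation deckInvolution :=
  Classical.choose_spec exists_isDeckTransformation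

/-! ### The Laplace integrand -/

/-- `e^{-s} s^{s+n} / Γ(s+1) e^{-sw}` for real `s > 0`. -/
def laplaceIntegrand (n : ℕ) (w : ℂ) (s : ℝ) : ℂ :=
  ((Real.exp (-s) * s ^ (s + (n : ℝ)) / Real.Gamma (s + 1) : ℝ) : ℂ) * Complex.exp (-(s : ℂ) * w)

end

noncomputable section

/-! ### The local coordinate near `t = ∞` -/

/-! Put u = 1/t. Since w = u²/2 + ⋯, the function v is a local coordinate at t = ∞: u = I(v) with I
analytic, and the deck transformation is v ↦ -v. From dw = u/(1-u) du, the operator t²(t-1) d/dt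
equals -d/dw = -v⁻¹ d/dv, which preserves parity in v. Hence, starting from ξ̂_{-1} = 1 - I(v),
every ξ̂_n splits into a part odd in v and an even part, which is a holomorphic function of w. The
operator sends (2m-1)!! v^{-2m-1} to (2m+1)!! v^{-2m-3}, so the odd part of ξ̂_n is ∑ α_k
(2(n-k)-1)!! v^{-2(n-k)-1} with one sequence α_k for all n
(`IsLocalCoord.exists_isLaurentSplitting`). Once α_k = s_k is known, this odd part is η_n, and
convergence, (2) and (3) follow by parity.

The equality α_k = s_k comes from evaluating the Laplace transform in two ways.

Exactly: Fourier inversion writes e^{-s} s^s / Γ(s+1) as (1/2π) ∫ (1+iy)⁻¹ e^{-sψ(y)} dy with ψ(y) =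
log(1+iy) - iy. Up to an additive constant, the transform for n = 0 is then (1/2π) ∫ (1+iy)⁻¹ /
(w+ψ(y)) dy. On the imaginary u-axis ψ is -w, and moving the contour near the saddle y = 0 into Re u
> 0 crosses exactly one pole, u = I(√(2w)), which contributes u⁻¹ = t; everything else is
holomorphic at w = 0. Applying -d/dw raises n by one on both sides, so the n-th transform is the odd
part of ξ̂_n plus a holomorphic function (`IsLaurentSplitting.exists_laplaceTransform_eq`). With α_k
= s_k this is (1).

Asymptotically: Stirling's series (`exists_stirlingRatio_sub_le`) and the values Γ(m+1/2) give the
terms k ≤ n of η_n(v) up to a bounded error (`exists_laplaceTransform_sub_le`). Comparing the two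
polar parts gives α_n = s_n (`IsLaurentSplitting.coeff_eq_stirlingCoeff`). Stirling's series itself
follows from the difference equation of log Γ, which the exponent satisfies formally by the
Bernoulli recursion. -/

theorem wCoord_inv (u : ℂ) : wCoord u⁻¹ = -u - Complex.log (1 - u) := by
  simp [wCoord]

theorem eventually_one_sub_mem_slitPlane : ∀ᶠ u in 𝓝 (0 : ℂ), 1 - u ∈ Complex.slitPlane := by
  have hc : ContinuousAt (fun u : ℂ => 1 - u) 0 := by fun_prop
  exact hc.eventually (Complex.isOpen_slitPlane.mem_nhds (by simp))

theorem hasDerivAt_wCoord_inv {u : ℂ} (hu : 1 - u ∈ Complex.slitPlane) :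
    HasDerivAt (fun u : ℂ => wCoord u⁻¹) (u / (1 - u)) u := by
  have h0 : 1 - u ≠ 0 := Complex.slitPlane_ne_zero hu
  have h1 : HasDerivAt (fun u : ℂ => 1 - u) (-1) u := by
    simpa using (hasDerivAt_id u).const_sub 1
  have h2 := (hasDerivAt_id u).neg.sub (h1.clog hu)
  have h3 : (fun u : ℂ => wCoord u⁻¹) = (-id - fun u : ℂ => Complex.log (1 - u)) := by
    funext x; simp [wCoord_inv]
  rw [h3]
  refine h2.congr_deriv ?_
  field_simp
  ring

/-- There is an analytic `g` with `w = u² g(u)`, `u = t⁻¹`, and `g(0) = 1/2`. -/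
theorem exists_wCoord_eq_sq_mul : ∃ g : ℂ → ℂ, AnalyticAt ℂ g 0 ∧ g 0 = 1 / 2 ∧
    ∀ u, wCoord u⁻¹ = u ^ 2 * g u := by
  set W : ℂ → ℂ := fun u => wCoord u⁻¹ with hWdef
  have hW0 : W 0 = 0 := by simp [hWdef, wCoord]
  have hWan : AnalyticAt ℂ W 0 := by
    have : W = fun u => -u - Complex.log (1 - u) := by
      funext u
      exact wCoord_inv u
    rw [this]
    exact analyticAt_id.neg.sub ((analyticAt_const.sub analyticAt_id).clog (by simp))
  have hd0 : deriv W 0 = 0 := by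
    have := (hasDerivAt_wCoord_inv (u := 0) (by simp)).deriv
    simpa using this
  obtain ⟨p, hp⟩ := hWan
  have h1 := hp.has_fpower_series_dslope_fslope.has_fpower_series_dslope_fslope
  set g := dslope (dslope W 0) 0 with hg
  have hgan : AnalyticAt ℂ g 0 := h1.analyticAt
  have hmul : ∀ u, W u = u ^ 2 * g u := by
    intro u
    have e1 := sub_smul_dslope W 0 u
    have e2 := sub_smul_dslope (dslope W 0) 0 u
    rw [dslope_same, hd0] at e2
    simp only [sub_zero, smul_eq_mul, hW0] at e1 e2
    rw [← e1, ← e2]; ring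
  refine ⟨g, hgan, ?_, hmul⟩
  -- The value g(0) = 1/2 is read off from (u² g)' = u/(1-u), divided by u, in the limit u → 0.
  have hder : ∀ᶠ u in 𝓝[≠] (0 : ℂ), 2 * g u + u * deriv g u = 1 / (1 - u) := by
    filter_upwards [nhdsWithin_le_nhds eventually_one_sub_mem_slitPlane,
      nhdsWithin_le_nhds hgan.eventually_analyticAt, self_mem_nhdsWithin] with u h1 h2 h3
    have e1 := hasDerivAt_wCoord_inv h1
    have e2 := ((hasDerivAt_id u).pow 2).mul h2.differentiableAt.hasDerivAt
    have e3 : (fun u : ℂ => wCoord u⁻¹) = (id ^ 2 * g) := by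
      funext x
      simpa using hmul x
    rw [e3] at e1
    have e4 := e1.unique e2
    have h0 : 1 - u ≠ 0 := Complex.slitPlane_ne_zero h1
    have h3' : u ≠ 0 := h3
    simp at e4
    apply mul_left_cancel₀ h3'
    have : u * (1 / (1 - u)) = u / (1 - u) := by ring
    rw [this, e4]
    ring
  have hl : Tendsto (fun u => 2 * g u + u * deriv g u) (𝓝[≠] (0 : ℂ)) (𝓝 (2 * g 0)) := by
    have hc : ContinuousAt (fun u => 2 * g u + u * deriv g u) 0 :=
      (continuousAt_const.mul hgan.continuousAt).add
        (continuousAt_id.mul hgan.deriv.continuousAt)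
    have := hc.tendsto.mono_left (nhdsWithin_le_nhds (s := {0}ᶜ))
    simpa using this
  have hr : Tendsto (fun u : ℂ => 1 / (1 - u)) (𝓝[≠] (0 : ℂ)) (𝓝 1) := by
    have hc : ContinuousAt (fun u : ℂ => 1 / (1 - u)) 0 :=
      continuousAt_const.div (by fun_prop) (by simp)
    have := hc.tendsto.mono_left (nhdsWithin_le_nhds (s := {0}ᶜ))
    simpa using this
  have := tendsto_nhds_unique (hl.congr' hder) hr
  linear_combination this / 2

/-- `V` is the coordinate `v` as a function of `u = t⁻¹` near `0`, and `I` is its inverse. -/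
structure IsLocalCoord (V I : ℂ → ℂ) : Prop where
  analyticAt : AnalyticAt ℂ V 0
  analyticAt_inv : AnalyticAt ℂ I 0
  map_zero : V 0 = 0
  inv_zero : I 0 = 0
  hasDerivAt : HasDerivAt V 1 0
  hasDerivAt_inv : HasDerivAt I 1 0
  sq_eq : ∀ᶠ u in 𝓝 0, V u ^ 2 = 2 * wCoord u⁻¹
  left_inv : ∀ᶠ u in 𝓝 0, I (V u) = u
  right_inv : ∀ᶠ x in 𝓝 0, V (I x) = x
  vCoord_eq : ∀ᶠ t in cobounded ℂ, vCoord t = V t⁻¹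

theorem exists_isLocalCoord : ∃ V I, IsLocalCoord V I := by
  obtain ⟨g, hg, hg0, hW⟩ := exists_wCoord_eq_sq_mul
  set q : ℂ → ℂ := fun u => (2 * g u) ^ (1 / 2 : ℂ) with hq
  have hqan : AnalyticAt ℂ q 0 := by
    refine (analyticAt_const.mul hg).cpow analyticAt_const ?_
    simp [hg0]
  have hq0 : q 0 = 1 := by simp [hq, hg0]
  have hq2 : ∀ u, q u ^ 2 = 2 * g u := by
    intro u
    simp only [hq]
    rw [← Complex.cpow_nat_mul]
    simp
  set V : ℂ → ℂ := fun u => u * q u with hV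
  have hVan : AnalyticAt ℂ V 0 := analyticAt_id.mul hqan
  have hVd : HasDerivAt V 1 0 := by
    have h := (hasDerivAt_id (0 : ℂ)).mul hqan.differentiableAt.hasDerivAt
    refine h.congr_deriv ?_
    simp [hq0]
  have hd : deriv V 0 ≠ 0 := by rw [hVd.deriv]; exact one_ne_zero
  have hV0 : V 0 = 0 := by simp [hV]
  have hs := hVan.hasStrictDerivAt
  set I := hs.localInverse _ _ _ hd with hI
  have hIan : AnalyticAt ℂ I 0 := by
    have := hVan.analyticAt_localInverse hd
    rwa [hV0] at this
  have hleft : ∀ᶠ u in 𝓝 0, I (V u) = u := hs.eventually_left_inverse hd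
  refine ⟨V, I, hVan, hIan, hV0, ?_, hVd, ?_, ?_, hleft, ?_, ?_⟩
  · have h := hleft.self_of_nhds
    rwa [hV0] at h
  · have h := (hs.to_localInverse hd).hasDerivAt
    rw [hV0] at h
    exact h.congr_deriv (by rw [hVd.deriv, inv_one])
  · refine Eventually.of_forall fun u => ?_
    simp only [hV]
    rw [mul_pow, hq2, hW]; ring
  · have h := hs.eventually_right_inverse hd
    rwa [hV0] at h
  · filter_upwards [eventually_ne_cobounded (0 : ℂ)] with t ht
    have h := hW t⁻¹
    rw [inv_inv] at h
    simp only [vCoord, hV, hq, h]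
    congr 2
    field_simp

namespace IsLocalCoord

variable {V I : ℂ → ℂ}

theorem wCoord_inv_inv (h : IsLocalCoord V I) : ∀ᶠ x in 𝓝 0, wCoord (I x)⁻¹ = x ^ 2 / 2 := by
  have hI : Tendsto I (𝓝 0) (𝓝 0) := by
    simpa [h.inv_zero] using h.analyticAt_inv.continuousAt.tendsto
  filter_upwards [h.right_inv, hI.eventually h.sq_eq] with x h1 h2
  rw [h1] at h2
  rw [h2]; ring

theorem tendsto_inv (h : IsLocalCoord V I) : Tendsto I (𝓝 0) (𝓝 0) := by
  simpa [h.inv_zero] using h.analyticAt_inv.continuousAt.tendsto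

theorem tendsto (h : IsLocalCoord V I) : Tendsto V (𝓝 0) (𝓝 0) := by
  simpa [h.map_zero] using h.analyticAt.continuousAt.tendsto

/-- Obtained by differentiating w = x²/2 along u = I(x), where dw/du = u/(1-u). This differential
equation is what turns t²(t-1) d/dt into -v⁻¹ d/dv. -/
theorem inv_mul_deriv (h : IsLocalCoord V I) :
    ∀ᶠ x in 𝓝 0, I x * deriv I x = x * (1 - I x) := by
  filter_upwards [h.wCoord_inv_inv.eventually_nhds, h.analyticAt_inv.eventually_analyticAt,
    h.tendsto_inv.eventually eventually_one_sub_mem_slitPlane] with x h1 h2 h3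
  have e1 := (hasDerivAt_wCoord_inv h3).comp x h2.differentiableAt.hasDerivAt
  have e2 : HasDerivAt (fun x : ℂ => x ^ 2 / 2) x x := by
    refine ((hasDerivAt_pow 2 x).div_const 2).congr_deriv ?_
    simp
  have e3 : HasDerivAt ((fun u : ℂ => wCoord u⁻¹) ∘ I) x x := e2.congr_of_eventuallyEq h1
  have e4 := e1.unique e3
  have h0 : 1 - I x ≠ 0 := Complex.slitPlane_ne_zero h3
  field_simp at e4
  rw [e4, mul_comm]

theorem inv_ne_zero (h : IsLocalCoord V I) : ∀ᶠ x in 𝓝[≠] 0, I x ≠ 0 := by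
  have := h.hasDerivAt_inv.eventually_ne (c := 0) one_ne_zero
  simpa [h.inv_zero] using this

theorem ne_zero (h : IsLocalCoord V I) : ∀ᶠ x in 𝓝[≠] 0, V x ≠ 0 := by
  have := h.hasDerivAt.eventually_ne (c := 0) one_ne_zero
  simpa [h.map_zero] using this

theorem tendsto_vCoord (h : IsLocalCoord V I) : Tendsto vCoord (cobounded ℂ) (𝓝[≠] 0) := by
  have h1 : Tendsto (fun t => V t⁻¹) (cobounded ℂ) (𝓝[≠] 0) := by
    refine tendsto_nhdsWithin_iff.2 ⟨h.tendsto.comp tendsto_inv₀_cobounded, ?_⟩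
    exact tendsto_inv₀_cobounded'.eventually h.ne_zero
  refine h1.congr' ?_
  filter_upwards [h.vCoord_eq] with t ht using ht.symm

theorem eq_inv_vCoord (h : IsLocalCoord V I) : ∀ᶠ t in cobounded ℂ, t = (I (vCoord t))⁻¹ := by
  filter_upwards [h.vCoord_eq, tendsto_inv₀_cobounded.eventually h.left_inv] with t h1 h2
  rw [h1, h2, inv_inv]

/-- Equal w means equal v², so 1/s(t) has coordinate v or -v; the first is excluded by s(t) ≠ t. -/
theorem deckInvolution_eq (h : IsLocalCoord V I) :
    ∀ᶠ t in cobounded ℂ, deckInvolution t = (I (-vCoord t))⁻¹ := by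
  have hs := isDeckTransformation_deckInvolution
  have hi : Tendsto (fun t : ℂ => t⁻¹) (cobounded ℂ) (𝓝 0) := tendsto_inv₀_cobounded
  filter_upwards [hs.2, hi.eventually h.sq_eq, (hi.comp hs.1).eventually h.sq_eq,
    hi.eventually h.left_inv, (hi.comp hs.1).eventually h.left_inv, h.vCoord_eq]
    with t h1 h2 h3 h4 h5 h6
  simp only [Function.comp_apply, inv_inv] at h2 h3 h5
  have h7 : V (deckInvolution t)⁻¹ ^ 2 = V t⁻¹ ^ 2 := by rw [h2, h3, h1.2]
  rcases sq_eq_sq_iff_eq_or_eq_neg.1 h7 with h8 | h8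
  · rw [h8, h4] at h5
    exact absurd (inv_injective h5).symm h1.1
  · rw [h6, ← h8, h5, inv_inv]

theorem sq_vCoord (h : IsLocalCoord V I) :
    ∀ᶠ t in cobounded ℂ, vCoord t ^ 2 / 2 = wCoord t := by
  filter_upwards [h.vCoord_eq, tendsto_inv₀_cobounded.eventually h.sq_eq] with t h1 h2
  rw [inv_inv] at h2
  rw [h1, h2]; ring

end IsLocalCoord

/-- A square root with positive real part is the principal one. -/
theorem eq_cpow_half_of_sq_eq {v w : ℂ} (hv : 0 < v.re) (h : v ^ 2 = w) :
    v = w ^ (1 / 2 : ℂ) := by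
  have harg := Complex.abs_arg_lt_pi_div_two_iff.2 (Or.inl hv)
  rw [abs_lt] at harg
  rw [← h]
  have := Complex.pow_cpow_nat_inv (x := v) (n := 2) two_ne_zero
    (by have := harg.1; push_cast; linarith) (by have := harg.2; push_cast; linarith)
  rw [← this]
  simp

theorem vCoord_eq_cpow_half : ∀ᶠ t in cobounded ℂ,
    0 < t.re → 0 < (wCoord t).re → vCoord t = (2 * wCoord t) ^ (1 / 2 : ℂ) := by
  obtain ⟨V, I, h⟩ := exists_isLocalCoord
  have hd : Tendsto (fun x => x⁻¹ * I x) (𝓝[≠] 0) (𝓝 1) := by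
    have := h.hasDerivAt_inv.tendsto_slope
    refine this.congr fun x => ?_
    simp [slope, h.inv_zero]
  have hd' : ∀ᶠ t in cobounded ℂ, ‖(vCoord t)⁻¹ * I (vCoord t) - 1‖ < 1 / 2 := by
    have := (hd.comp h.tendsto_vCoord).eventually (Metric.ball_mem_nhds 1 one_half_pos)
    filter_upwards [this] with t ht
    simpa [dist_eq_norm] using ht
  filter_upwards [h.sq_vCoord, hd', h.eq_inv_vCoord, eventually_ne_cobounded 0,
    h.tendsto_vCoord.eventually self_mem_nhdsWithin] with t h1 h2 h3 h4 h5 ht hw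
  set v := vCoord t with hv
  have h5' : v ≠ 0 := h5
  have hsq : v ^ 2 = 2 * wCoord t := by rw [← h1]; ring
  refine eq_cpow_half_of_sq_eq ?_ hsq
  -- If Re v ≤ 0, then Re v² > 0 forces |Im v| < -Re v. As t⁻¹ = v(1+ε) with |ε| < 1/2, this makes
  -- Re t⁻¹ ≤ 0, against Re t > 0.
  by_contra hneg
  push Not at hneg
  have e1 : 0 < v.re * v.re - v.im * v.im := by
    have := congrArg Complex.re hsq
    simp [sq] at this
    linarith
  set ε := v⁻¹ * I v - 1 with hε
  have e2 : t⁻¹ = v * (1 + ε) := by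
    rw [h3, inv_inv, hε]
    field_simp
    ring
  have e3 : 0 < (t⁻¹).re := by
    rw [Complex.inv_re]
    exact div_pos ht (Complex.normSq_pos.2 h4)
  rw [e2] at e3
  simp only [Complex.mul_re, Complex.add_re, Complex.one_re, Complex.add_im, Complex.one_im] at e3
  have e4 : ε.re ^ 2 + ε.im ^ 2 < 1 / 4 := by
    have := Complex.sq_norm ε
    rw [Complex.normSq_apply] at this
    nlinarith [norm_nonneg ε]
  have e5 : |v.im| < -v.re := by
    apply abs_lt_of_sq_lt_sq _ (by linarith)
    nlinarith
  have e6 := abs_lt.1 e5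
  have e7 : |ε.im| ≤ 1 / 2 := by
    apply abs_le_of_sq_le_sq _ (by norm_num)
    nlinarith [sq_nonneg ε.re]
  have e8 : |ε.re| ≤ 1 / 2 := by
    apply abs_le_of_sq_le_sq _ (by norm_num)
    nlinarith [sq_nonneg ε.im]
  have e9 : |v.im * ε.im| ≤ -v.re * (1 / 2) := by
    rw [abs_mul]
    exact mul_le_mul e5.le e7 (abs_nonneg _) (by linarith)
  have := abs_le.1 e9
  have := abs_le.1 e8
  nlinarith

/-! ### Taylor coefficients -/

/-- `f` is the sum of the convergent power series `∑ a_k z^k` near `0`. -/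
def HasTaylor {𝕜 : Type*} [RCLike 𝕜] (f : 𝕜 → 𝕜) (a : ℕ → 𝕜) : Prop :=
  ∀ᶠ z in 𝓝 (0 : 𝕜), HasSum (fun k => a k * z ^ k) (f z)

theorem hasTaylor_iff {𝕜 : Type*} [RCLike 𝕜] {f : 𝕜 → 𝕜} {a : ℕ → 𝕜} :
    HasTaylor f a ↔ HasFPowerSeriesAt f (FormalMultilinearSeries.ofScalars 𝕜 a) 0 := by
  rw [hasFPowerSeriesAt_iff]
  simp only [FormalMultilinearSeries.coeff_ofScalars, smul_eq_mul, zero_add, HasTaylor]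
  refine eventually_congr (Eventually.of_forall fun z => ?_)
  simp_rw [mul_comm]

namespace HasTaylor

variable {𝕜 : Type*} [RCLike 𝕜] {f g : 𝕜 → 𝕜} {a b : ℕ → 𝕜}

theorem analyticAt (h : HasTaylor f a) : AnalyticAt 𝕜 f 0 :=
  (hasTaylor_iff.1 h).analyticAt

theorem unique (h : HasTaylor f a) (h' : HasTaylor f b) : a = b := by
  have e := (hasTaylor_iff.1 h).eq_formalMultilinearSeries (hasTaylor_iff.1 h')
  funext k
  have := congrArg (fun p => p.coeff k) e
  simpa using this

theorem _root_.AnalyticAt.hasTaylor (h : AnalyticAt 𝕜 f 0) :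
    HasTaylor f fun n => iteratedDeriv n f 0 / (n ! : 𝕜) :=
  hasTaylor_iff.2 h.hasFPowerSeriesAt

theorem _root_.AnalyticAt.exists_hasTaylor (h : AnalyticAt 𝕜 f 0) : ∃ a, HasTaylor f a :=
  ⟨_, h.hasTaylor⟩

theorem deriv (h : HasTaylor f a) : HasTaylor (deriv f) fun k => (k + 1) * a (k + 1) := by
  have e := h.unique h.analyticAt.hasTaylor
  have h' := h.analyticAt.deriv.hasTaylor
  convert h' using 2 with k
  rw [e]
  simp only [iteratedDeriv_succ', Nat.factorial_succ]
  have h1 : (k ! : 𝕜) ≠ 0 := by exact_mod_cast k.factorial_ne_zero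
  have h2 : (k : 𝕜) + 1 ≠ 0 := by exact_mod_cast k.succ_ne_zero
  push_cast
  field_simp

theorem id_mul_deriv (h : HasTaylor f a) :
    HasTaylor (fun z => z * _root_.deriv f z) fun k => k * a k := by
  filter_upwards [h.deriv] with z hz
  rw [← hasSum_nat_add_iff' 1]
  simpa [pow_succ, mul_assoc, mul_comm, mul_left_comm] using hz.mul_left z

theorem add (h : HasTaylor f a) (h' : HasTaylor g b) :
    HasTaylor (fun z => f z + g z) fun k => a k + b k := by
  filter_upwards [h, h'] with z h1 h2
  simpa [add_mul] using h1.add h2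

theorem const_mul (h : HasTaylor f a) (c : 𝕜) :
    HasTaylor (fun z => c * f z) fun k => c * a k := by
  filter_upwards [h] with z h1
  simpa [mul_assoc] using h1.mul_left c

theorem congr (h : HasTaylor f a) (e : ∀ k, a k = b k) : HasTaylor f b := by
  have : a = b := funext e
  rwa [← this]

end HasTaylor

/-- Splitting of an analytic function into its even and odd parts. -/
theorem HasTaylor.exists_even_odd {f : ℂ → ℂ} {a : ℕ → ℂ} (h : HasTaylor f a) :
    ∃ E O : ℂ → ℂ, HasTaylor E (fun k => a (2 * k)) ∧ HasTaylor O (fun k => a (2 * k + 1)) ∧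
      ∀ᶠ v in 𝓝 0, f v = E (v ^ 2) + v * O (v ^ 2) := by
  set E : ℂ → ℂ := fun z => ∑' k, a (2 * k) * z ^ k
  set O : ℂ → ℂ := fun z => ∑' k, a (2 * k + 1) * z ^ k
  have hs : ∀ v, v ≠ 0 → HasSum (fun k => a k * v ^ k) (f v) →
      Summable (fun k => a (2 * k) * (v ^ 2) ^ k) ∧
      Summable (fun k => a (2 * k + 1) * (v ^ 2) ^ k) := by
    intro v hv hsum
    constructor
    · have := hsum.summable.comp_injective (i := fun k : ℕ => 2 * k)
        (fun x y hxy => by simpa using hxy)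
      refine this.congr fun k => ?_
      simp [pow_mul]
    · have := (hsum.summable.comp_injective (i := fun k : ℕ => 2 * k + 1)
        (fun x y hxy => by simpa using hxy)).mul_left v⁻¹
      refine this.congr fun k => ?_
      simp only [Function.comp_apply, pow_succ, pow_mul]
      field_simp
  -- Every z with |z| < r² is the square of some v with |v| < r, so the even and odd subseries
  -- inherit convergence from the series of f at v.
  have hroot : ∀ᶠ z in 𝓝 (0 : ℂ), Summable (fun k => a (2 * k) * z ^ k) ∧
      Summable (fun k => a (2 * k + 1) * z ^ k) := by
    obtain ⟨r, hr, hball⟩ := Metric.eventually_nhds_iff.1 h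
    filter_upwards [Metric.ball_mem_nhds (0 : ℂ) (by positivity : 0 < r ^ 2)] with z hz
    rcases eq_or_ne z 0 with rfl | hz0
    · exact ⟨summable_of_ne_finset_zero (s := {0}) fun k hk => by simp at hk; simp [hk],
        summable_of_ne_finset_zero (s := {0}) fun k hk => by simp at hk; simp [hk]⟩
    obtain ⟨v, hv⟩ := IsAlgClosed.exists_pow_nat_eq z (n := 2) (by norm_num)
    rw [← hv]
    refine hs v (by rintro rfl; simp at hv; exact hz0 hv.symm) (hball ?_)
    rw [dist_zero_right]
    rw [Metric.mem_ball, dist_zero_right, ← hv, norm_pow] at hz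
    exact lt_of_pow_lt_pow_left₀ 2 hr.le hz
  refine ⟨E, O, ?_, ?_, ?_⟩
  · filter_upwards [hroot] with z hz using hz.1.hasSum
  · filter_upwards [hroot] with z hz using hz.2.hasSum
  · have hsq : Tendsto (fun v : ℂ => v ^ 2) (𝓝 0) (𝓝 0) := by
      have : ContinuousAt (fun v : ℂ => v ^ 2) 0 := by fun_prop
      simpa using this.tendsto
    filter_upwards [h, hsq.eventually hroot] with v h1 h2
    refine h1.unique (HasSum.even_add_odd ?_ ?_)
    · simpa [pow_mul] using h2.1.hasSum
    · refine (h2.2.hasSum.mul_left v).congr_fun fun k => ?_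
      rw [pow_succ, pow_mul]
      ring

/-! ### Laurent expansion of `ξ̂_n` in the local coordinate -/

theorem oddDoubleFactorial_ne_zero (m : ℤ) : oddDoubleFactorial m ≠ 0 := by
  rcases m with m | j
  · change (((2 * m - 1)‼ : ℕ) : ℚ) ≠ 0
    exact_mod_cast (Nat.doubleFactorial_pos _).ne'
  · change ((-1) ^ (j + 1) / ((2 * j + 1)‼ : ℕ) : ℚ) ≠ 0
    have h0 : (((2 * j + 1)‼ : ℕ) : ℚ) ≠ 0 := by
      exact_mod_cast (Nat.doubleFactorial_pos _).ne'
    exact div_ne_zero (pow_ne_zero _ (by norm_num)) h0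

/-- The recursion also holds from ξ̂_{-1} to ξ̂_0, because ((t-1)/t)' = 1/t². Indexing by N = n + 1
lets one induction over ℕ cover all n ≥ -1. -/
theorem hasDerivAt_xiHat (N : ℕ) {t : ℂ} (h0 : t ≠ 0) (h1 : t ≠ 1) :
    HasDerivAt (xiHat ((N : ℤ) - 1)) (xiHat N t / (t ^ 2 * (t - 1))) t := by
  have h1' : t - 1 ≠ 0 := sub_ne_zero.2 h1
  rcases N with _ | N
  · have e : xiHat (((0 : ℕ) : ℤ) - 1) = fun t => (t - 1) / t := rfl
    rw [e]
    have := ((hasDerivAt_id t).sub_const 1).div (hasDerivAt_id t) h0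
    refine this.congr_deriv ?_
    change _ = (xiPoly 0).eval t / _
    simp [xiPoly]
    field_simp
  · have e : xiHat (((N + 1 : ℕ) : ℤ) - 1) = fun t => (xiPoly N).eval t := by
      funext t
      have : (((N + 1 : ℕ) : ℤ) - 1) = Int.ofNat N := by simp
      rw [this, xiHat]
    rw [e]
    refine ((xiPoly N).hasDerivAt t).congr_deriv ?_
    change _ = (xiPoly (N + 1)).eval t / _
    simp [xiPoly]
    field_simp

/-- The expansions `ξ̂_n(t) = v^{-2n-1} A_n(v²) + e_n(v²/2)` in the local coordinate, with
`n = N - 1`; the Taylor coefficients of `A_n` are `α_k (2(n-k)-1)!!`. -/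
structure IsLaurentSplitting (I : ℂ → ℂ) (α : ℕ → ℂ) (A e : ℕ → ℂ → ℂ) : Prop where
  hasTaylor : ∀ N : ℕ, HasTaylor (A N) fun k => α k * (oddDoubleFactorial ((N : ℤ) - 1 - k) : ℂ)
  analyticAt : ∀ N, AnalyticAt ℂ (e N) 0
  succ : ∀ N z, A (N + 1) z = (2 * N - 1) * A N z - 2 * (z * deriv (A N) z)
  eq : ∀ N : ℕ, ∀ᶠ v in 𝓝[≠] 0,
    xiHat ((N : ℤ) - 1) (I v)⁻¹ = v ^ (1 - 2 * (N : ℤ)) * A N (v ^ 2) + e N (v ^ 2 / 2)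

/-- On z^k the operator (2N-1) - 2z d/dz is multiplication by 2(N-1-k) + 1, the ratio of consecutive
odd double factorials. Hence α does not depend on N. -/
theorem HasTaylor.odd_step {A : ℂ → ℂ} {α : ℕ → ℂ} {N : ℕ}
    (h : HasTaylor A fun k => α k * (oddDoubleFactorial ((N : ℤ) - 1 - k) : ℂ)) :
    HasTaylor (fun z => (2 * N - 1) * A z - 2 * (z * _root_.deriv A z))
      fun k => α k * (oddDoubleFactorial (((N + 1 : ℕ) : ℤ) - 1 - k) : ℂ) := by
  have h1 := (h.const_mul (2 * N - 1)).add (h.id_mul_deriv.const_mul (-2))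
  have h2 := h1.congr (b := fun k => α k * (oddDoubleFactorial (((N + 1 : ℕ) : ℤ) - 1 - k) : ℂ)) ?_
  · refine h2.mono fun z hz => ?_
    convert hz using 1
    ring
  · intro k
    have e : (((N + 1 : ℕ) : ℤ) - 1 - k) = ((N : ℤ) - 1 - k) + 1 := by push_cast; ring
    rw [e, oddDoubleFactorial_succ]
    push_cast
    ring

/-- The action of -v⁻¹ d/dv on the odd part, with the factor -v kept on the right. The same formula
serves the recursion for ξ̂_n and the one for the Laplace transforms. -/
theorem hasDerivAt_zpow_mul_comp_sq (N : ℕ) {A : ℂ → ℂ} {v : ℂ} (hv : v ≠ 0)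
    (hA : DifferentiableAt ℂ A (v ^ 2)) :
    HasDerivAt (fun v => v ^ (1 - 2 * (N : ℤ)) * A (v ^ 2))
      (-v * (v ^ (1 - 2 * ((N + 1 : ℕ) : ℤ)) *
        ((2 * N - 1) * A (v ^ 2) - 2 * (v ^ 2 * deriv A (v ^ 2))))) v := by
  have h1 := hasDerivAt_zpow (1 - 2 * (N : ℤ)) v (Or.inl hv)
  have h2 : HasDerivAt (fun v => A (v ^ 2)) _ v := hA.hasDerivAt.comp v (hasDerivAt_pow 2 v)
  refine (h1.mul h2).congr_deriv ?_
  have e1 : v ^ (1 - 2 * (N : ℤ)) = v ^ (1 - 2 * ((N + 1 : ℕ) : ℤ)) * v ^ 2 := by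
    rw [← zpow_natCast v 2, ← zpow_add₀ hv]
    congr 1
    push_cast; ring
  have e2 : v ^ (1 - 2 * (N : ℤ) - 1) = v ^ (1 - 2 * ((N + 1 : ℕ) : ℤ)) * v := by
    rw [← zpow_add_one₀ hv]
    congr 1
    push_cast; ring
  rw [e1, e2]
  push_cast
  ring

theorem tendsto_sq_nhds_zero : Tendsto (fun v : ℂ => v ^ 2) (𝓝 0) (𝓝 0) := by
  have : ContinuousAt (fun v : ℂ => v ^ 2) 0 := by fun_prop
  simpa using this.tendsto

theorem tendsto_half_sq_nhds_zero : Tendsto (fun v : ℂ => v ^ 2 / 2) (𝓝 0) (𝓝 0) := by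
  have : ContinuousAt (fun v : ℂ => v ^ 2 / 2) 0 := by fun_prop
  simpa using this.tendsto

theorem IsLocalCoord.exists_isLaurentSplitting {V I : ℂ → ℂ} (h : IsLocalCoord V I) :
    ∃ α A e, IsLaurentSplitting I α A e := by
  obtain ⟨a, ha⟩ := h.analyticAt_inv.exists_hasTaylor
  obtain ⟨E, O, hE, hO, hEO⟩ := ha.exists_even_odd
  let A : ℕ → ℂ → ℂ := fun N => Nat.rec (fun z => -1 * O z)
    (fun N A z => (2 * N - 1) * A z - 2 * (z * deriv A z)) N
  let e : ℕ → ℂ → ℂ := fun N => Nat.rec (fun w => 1 - E (2 * w)) (fun _ e w => -deriv e w) N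
  -- The normalisation is forced at N = 0, where ξ̂_{-1} = 1 - I(v) has odd part -v O(v²); the
  -- double factorials never vanish, so the division is harmless.
  let α : ℕ → ℂ := fun k => -a (2 * k + 1) / (oddDoubleFactorial (-1 - k) : ℂ)
  have hA : ∀ N : ℕ,
      HasTaylor (A N) fun k => α k * (oddDoubleFactorial ((N : ℤ) - 1 - k) : ℂ) := by
    intro N
    induction N with
    | zero =>
      refine (hO.const_mul (-1)).congr fun k => ?_
      have h0 : (oddDoubleFactorial (-1 - k) : ℂ) ≠ 0 := by
        exact_mod_cast oddDoubleFactorial_ne_zero _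
      simp only [α, Nat.cast_zero, zero_sub]
      field_simp
    | succ N ih => exact ih.odd_step
  have he : ∀ N, AnalyticAt ℂ (e N) 0 := by
    intro N
    induction N with
    | zero =>
      refine analyticAt_const.sub (AnalyticAt.fun_comp ?_ (analyticAt_const.mul analyticAt_id))
      simpa using hE.analyticAt
    | succ N ih => exact ih.deriv.neg
  refine ⟨α, A, e, hA, he, fun N z => rfl, fun N => ?_⟩
  induction N with
  | zero =>
    filter_upwards [nhdsWithin_le_nhds hEO, h.inv_ne_zero] with v h1 h2
    change ((I v)⁻¹ - 1) / (I v)⁻¹ = v ^ (1 - 2 * ((0 : ℕ) : ℤ)) * (-1 * O (v ^ 2))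
      + (1 - E (2 * (v ^ 2 / 2)))
    have e1 : ((I v)⁻¹ - 1) / (I v)⁻¹ = 1 - I v := by field_simp
    rw [e1, h1, mul_div_cancel₀ _ two_ne_zero]
    simp
    ring
  | succ N ih =>
    have hne1 : ∀ᶠ v in 𝓝 (0 : ℂ), I v ≠ 1 := by
      refine h.tendsto_inv.eventually (isOpen_ne.mem_nhds zero_ne_one)
    filter_upwards [eventually_eventually_nhdsWithin.2 ih,
      self_mem_nhdsWithin, h.inv_ne_zero,
      nhdsWithin_le_nhds h.inv_mul_deriv,
      nhdsWithin_le_nhds h.analyticAt_inv.eventually_analyticAt,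
      nhdsWithin_le_nhds (tendsto_sq_nhds_zero.eventually (hA N).analyticAt.eventually_analyticAt),
      nhdsWithin_le_nhds (tendsto_half_sq_nhds_zero.eventually (he N).eventually_analyticAt),
      nhdsWithin_le_nhds hne1]
      with v h1 h2 h3 h4 h5 h6 h7 h8
    have hv : v ≠ 0 := h2
    rw [isOpen_compl_singleton.nhdsWithin_eq h2] at h1
    have ht1 : (I v)⁻¹ ≠ 1 := fun hh => h8 (by rw [← inv_inv (I v), hh, inv_one])
    have d1 := (hasDerivAt_xiHat N (_root_.inv_ne_zero h3) ht1).comp v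
      (h5.differentiableAt.hasDerivAt.inv h3)
    have d2 := hasDerivAt_zpow_mul_comp_sq N hv h6.differentiableAt
    have d3 : HasDerivAt (fun v => e N (v ^ 2 / 2)) _ v :=
      h7.differentiableAt.hasDerivAt.comp v ((hasDerivAt_pow 2 v).div_const 2)
    have d4 := (d2.add d3).congr_of_eventuallyEq (f₁ := xiHat ((N : ℤ) - 1) ∘ (I⁻¹)) h1
    have d5 := d1.unique d4
    have e1 : (((N + 1 : ℕ) : ℤ) - 1) = N := by push_cast; ring
    rw [e1]
    change xiHat N (I v)⁻¹ = v ^ (1 - 2 * ((N + 1 : ℕ) : ℤ)) *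
      ((2 * N - 1) * A N (v ^ 2) - 2 * (v ^ 2 * deriv (A N) (v ^ 2))) + -deriv (e N) (v ^ 2 / 2)
    have h8' : 1 - I v ≠ 0 := sub_ne_zero.2 (Ne.symm h8)
    -- The chain rule factor cancels by the differential equation of I: dξ̂_{N-1}/dv = -v ξ̂_N.
    have e2 : xiHat N (I v)⁻¹ / ((I v)⁻¹ ^ 2 * ((I v)⁻¹ - 1)) * (-deriv I v / I v ^ 2)
        = -v * xiHat N (I v)⁻¹ := by
      have e3 : deriv I v = v * (1 - I v) / I v := by
        field_simp
        rw [mul_comm, h4]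
      have h9 : (I v)⁻¹ - 1 = (1 - I v) / I v := by field_simp
      rw [e3, h9]
      field_simp
    have d6 := e2.symm.trans d5
    apply mul_left_cancel₀ (neg_ne_zero.2 hv)
    rw [d6]
    simp
    ring

/-! ### The Stirling series as a formal power series -/

/-- The parity condition in the definition may be dropped, since B_{m+1} = 0 for even m ≥ 2. -/
theorem coeff_stirlingExponent (m : ℕ) (hm : m ≠ 0) :
    PowerSeries.coeff m stirlingExponent = -(bernoulli (m + 1) / (((m : ℚ) + 1) * m)) := by
  rw [stirlingExponent, PowerSeries.coeff_mk]
  split_ifs with h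
  · rfl
  · rw [bernoulli_eq_zero_of_odd]
    · simp
    · exact (Nat.not_odd_iff_even.1 h).add_one
    · omega

theorem coeff_zero_stirlingExponent : PowerSeries.coeff 0 stirlingExponent = 0 := by
  simp [stirlingExponent]

theorem stirlingCoeff_zero : stirlingCoeff 0 = 1 := by
  rw [stirlingCoeff, PowerSeries.coeff_subst' hasSubst_stirlingExponent,
    finsum_eq_single _ 0]
  · simp
  · intro n hn
    have h : PowerSeries.constantCoeff stirlingExponent = 0 := by
      rw [← PowerSeries.coeff_zero_eq_constantCoeff_apply, coeff_zero_stirlingExponent]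
    simp [h, hn]

theorem derivative_stirling :
    PowerSeries.derivative ℚ ((PowerSeries.exp ℚ).subst stirlingExponent) =
      (PowerSeries.exp ℚ).subst stirlingExponent * PowerSeries.derivative ℚ stirlingExponent := by
  rw [PowerSeries.derivative_subst hasSubst_stirlingExponent, PowerSeries.derivative_exp]

/-- The polynomial `∑_{k ≤ K} s_k X^k`. -/
def stirlingPoly (K : ℕ) : Polynomial ℚ :=
  PowerSeries.trunc (K + 1) ((PowerSeries.exp ℚ).subst stirlingExponent)

/-- The truncation of the Stirling exponent at degree `K`. -/
def stirlingExpPoly (K : ℕ) : Polynomial ℚ :=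
  PowerSeries.trunc (K + 1) stirlingExponent

theorem aeval_stirlingPoly (K : ℕ) (x : ℝ) :
    Polynomial.aeval x (stirlingPoly K) =
      ∑ k ∈ Finset.range (K + 1), (stirlingCoeff k : ℝ) * x ^ k := by
  rw [stirlingPoly, Polynomial.aeval_def, PowerSeries.eval₂_trunc_eq_sum_range]
  rfl

theorem aeval_stirlingExpPoly (K : ℕ) (x : ℝ) :
    Polynomial.aeval x (stirlingExpPoly K) =
      ∑ k ∈ Finset.range (K + 1), ((PowerSeries.coeff k stirlingExponent : ℚ) : ℝ) * x ^ k := by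
  rw [stirlingExpPoly, Polynomial.aeval_def, PowerSeries.eval₂_trunc_eq_sum_range]
  rfl

/-- The coefficients of S' = E'S in degree below K involve only coefficients of S and E of degree at
most K, so the truncations satisfy the equation modulo X^K. -/
theorem X_pow_dvd_derivative_stirlingPoly (K : ℕ) :
    Polynomial.X ^ K ∣ (stirlingPoly K).derivative -
      (stirlingExpPoly K).derivative * stirlingPoly K := by
  rw [Polynomial.X_pow_dvd_iff]
  intro d hd
  have h := congrArg (PowerSeries.coeff d) derivative_stirling
  rw [PowerSeries.coeff_derivative, mul_comm ((PowerSeries.exp ℚ).subst stirlingExponent),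
    PowerSeries.coeff_mul] at h
  rw [Polynomial.coeff_sub, Polynomial.coeff_derivative, Polynomial.coeff_mul, stirlingPoly,
    PowerSeries.coeff_trunc, if_pos (by omega), h, sub_eq_zero]
  refine Finset.sum_congr rfl fun x hx => ?_
  have := Finset.HasAntidiagonal.mem_antidiagonal.1 hx
  rw [PowerSeries.coeff_derivative, Polynomial.coeff_derivative, stirlingExpPoly,
    PowerSeries.coeff_trunc, PowerSeries.coeff_trunc, if_pos (by omega), if_pos (by omega)]

/-- The truncated Stirling series is the exponential of the truncated exponent, up to
higher order. -/
theorem exists_exp_stirlingExpPoly_sub_le (K : ℕ) : ∃ C, ∀ x ∈ Set.Icc (0 : ℝ) 1,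
    |Real.exp (Polynomial.aeval x (stirlingExpPoly K)) - Polynomial.aeval x (stirlingPoly K)|
      ≤ C * x ^ (K + 1) := by
  obtain ⟨R, hR⟩ := X_pow_dvd_derivative_stirlingPoly K
  set P : ℝ → ℝ := fun x => Polynomial.aeval x (stirlingExpPoly K) with hP
  set S : ℝ → ℝ := fun x => Polynomial.aeval x (stirlingPoly K) with hS
  have hPc : Continuous P := Polynomial.continuous_aeval _
  -- By the divisibility S' - P'S = x^K R, the quotient S e^{-P} has derivative O(x^K); as it equals
  -- 1 at 0, it is 1 + O(x^{K+1}).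
  have hder : ∀ x, HasDerivAt (fun x => S x * Real.exp (-P x))
      (x ^ K * (Polynomial.aeval x R * Real.exp (-P x))) x := by
    intro x
    have h1 : HasDerivAt S _ x := Polynomial.hasDerivAt_aeval (stirlingPoly K) x
    have h2 : HasDerivAt P _ x := Polynomial.hasDerivAt_aeval (stirlingExpPoly K) x
    refine (h1.mul h2.neg.exp).congr_deriv ?_
    have h3 := congrArg (Polynomial.aeval x) hR
    simp only [map_sub, map_mul, map_pow, Polynomial.aeval_X] at h3
    simp only [hS, hP, Pi.neg_apply]
    linear_combination Real.exp (-Polynomial.aeval x (stirlingExpPoly K)) * h3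
  obtain ⟨M, hM⟩ := isCompact_Icc.exists_bound_of_continuousOn (s := Set.Icc (0 : ℝ) 1)
    (f := fun x => Polynomial.aeval x R * Real.exp (-P x))
    ((Polynomial.continuous_aeval R).mul (by fun_prop)).continuousOn
  obtain ⟨M', hM'⟩ := isCompact_Icc.exists_bound_of_continuousOn (s := Set.Icc (0 : ℝ) 1)
    (f := fun x => Real.exp (P x)) (by fun_prop)
  have hM0 : 0 ≤ M := (norm_nonneg _).trans (hM 0 (by simp))
  have h0 : S 0 * Real.exp (-P 0) = 1 := by
    simp only [hS, hP, aeval_stirlingPoly, aeval_stirlingExpPoly, Finset.sum_range_succ']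
    simp [stirlingCoeff_zero, stirlingExponent]
  refine ⟨M' * M, fun x hx => ?_⟩
  have h1 : |S x * Real.exp (-P x) - 1| ≤ M * x ^ (K + 1) := by
    have := Convex.norm_image_sub_le_of_norm_deriv_le
      (f := fun x => S x * Real.exp (-P x)) (s := Set.Icc 0 x) (C := x ^ K * M) (x := 0) (y := x)
      (fun y _ => (hder y).differentiableAt) (fun y hy => ?_) (convex_Icc _ _)
      (Set.left_mem_Icc.2 hx.1) (Set.right_mem_Icc.2 hx.1)
    · rw [h0, Real.norm_eq_abs, sub_zero, Real.norm_of_nonneg hx.1] at this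
      refine this.trans_eq ?_
      ring
    · rw [(hder y).deriv, norm_mul, norm_pow, Real.norm_of_nonneg hy.1]
      gcongr
      · exact pow_nonneg hx.1 _
      · exact hy.1
      · exact hy.2
      · exact hM y ⟨hy.1, hy.2.trans hx.2⟩
  have h2 : Real.exp (P x) - S x = -(Real.exp (P x) * (S x * Real.exp (-P x) - 1)) := by
    rw [Real.exp_neg]
    field_simp
    ring
  change |Real.exp (P x) - S x| ≤ _
  rw [h2, abs_neg, abs_mul, mul_assoc]
  have := hM' x hx
  rw [Real.norm_eq_abs] at this
  have h3 := abs_nonneg (Real.exp (P x))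
  gcongr
  exact h3.trans this

/-! ### The difference equation of the Stirling exponent -/

/-- The Taylor coefficients of `(x / (1 + x))^m`. -/
def shiftCoeff (m j : ℕ) : ℚ :=
  if m ≤ j then (-1) ^ (j - m) * ((j - 1).choose (m - 1) : ℚ) else 0

theorem shiftCoeff_self {m : ℕ} : shiftCoeff m m = 1 := by
  simp [shiftCoeff]

/-- The Bernoulli recursion for j + 2, with the terms 1 and -(j+2)/2 of indices 0 and 1 moved to the
right. -/
theorem sum_choose_mul_bernoulli (j : ℕ) :
    ∑ i ∈ Finset.range j, ((j + 2).choose (i + 2) : ℚ) * bernoulli (i + 2) = (j : ℚ) / 2 := by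
  have h := sum_bernoulli (j + 2)
  rw [if_neg (by omega), Finset.sum_range_succ', Finset.sum_range_succ'] at h
  simp only [zero_add, Nat.choose_one_right, Nat.choose_zero_right, bernoulli_one,
    bernoulli_zero] at h
  push_cast at h
  linear_combination h

/-- Coefficient of x^{j+1} in the formal identity E(x/(1+x)) - E(x) = (1/x + 1/2) log(1+x) - 1,
which encodes the step s ↦ s+1 for x = 1/s. The term i = j is absent because it cancels against
E(x). The binomial identity C(j,i)/((i+1)(i+2)) = C(j+2,i+2)/((j+1)(j+2)) reduces it to the
Bernoulli recursion. -/
theorem sum_stirlingExponent_mul_shiftCoeff (j : ℕ) :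
    ∑ i ∈ Finset.range j, (PowerSeries.coeff (i + 1) stirlingExponent) * shiftCoeff (i + 1) (j + 1)
      = (-1) ^ (j + 1) * (1 / ((j : ℚ) + 2) - 1 / (2 * ((j : ℚ) + 1))) := by
  have key : ∀ i ∈ Finset.range j,
      (PowerSeries.coeff (i + 1) stirlingExponent) * shiftCoeff (i + 1) (j + 1)
        = (-1) ^ (j + 1) / (((j : ℚ) + 1) * (j + 2)) *
          (((j + 2).choose (i + 2) : ℚ) * bernoulli (i + 2)) := by
    intro i hi
    have hij := Finset.mem_range.1 hi
    rw [coeff_stirlingExponent _ (by omega), shiftCoeff, if_pos (by omega)]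
    simp only [Nat.add_sub_cancel]
    -- The alternating sign becomes independent of i, because B_{i+2} vanishes whenever i is odd.
    have e1 : (-1 : ℚ) ^ (j + 1 - (i + 1)) * bernoulli (i + 2) = (-1) ^ j * bernoulli (i + 2) := by
      have h1 := bernoulli'_eq_bernoulli (i + 2)
      rw [← bernoulli_eq_bernoulli'_of_ne_one (by omega)] at h1
      have h2 : (-1 : ℚ) ^ j = (-1) ^ (j + 1 - (i + 1)) * (-1) ^ i := by
        rw [← pow_add]; congr 1; omega
      rw [h2, mul_assoc]
      congr 1
      rw [pow_add] at h1
      simpa using h1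
    have e2 := Nat.add_one_mul_choose_eq j i
    have e3 := Nat.add_one_mul_choose_eq (j + 1) (i + 1)
    have e2' : ((j : ℚ) + 1) * (j.choose i : ℚ) = ((j + 1).choose (i + 1) : ℚ) * (i + 1) := by
      exact_mod_cast e2
    have e3' : ((j : ℚ) + 1 + 1) * ((j + 1).choose (i + 1) : ℚ)
        = ((j + 2).choose (i + 2) : ℚ) * (i + 1 + 1) := by
      exact_mod_cast e3
    have hi1 : (i : ℚ) + 1 ≠ 0 := by positivity
    have hi2 : (i : ℚ) + 1 + 1 ≠ 0 := by positivity
    have hj1 : (j : ℚ) + 1 ≠ 0 := by positivity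
    have hj2 : (j : ℚ) + 2 ≠ 0 := by positivity
    have e4 : (j.choose i : ℚ) / ((i + 1 + 1) * (i + 1)) =
        ((j + 2).choose (i + 2) : ℚ) / ((j + 1) * (j + 2)) := by
      rw [div_eq_div_iff (by positivity) (by positivity)]
      linear_combination (j + 2 : ℚ) * e2' + (i + 1 : ℚ) * e3'
    have e5 : -(bernoulli (i + 1 + 1) / (((i + 1 : ℕ) : ℚ) + 1) / ((i + 1 : ℕ) : ℚ)) *
        ((-1) ^ (j + 1 - (i + 1)) * (j.choose i : ℚ)) =
        -((-1) ^ (j + 1 - (i + 1)) * bernoulli (i + 2)) *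
          ((j.choose i : ℚ) / ((i + 1 + 1) * (i + 1))) := by
      push_cast
      field_simp
    rw [← div_div, e5, e1, e4]
    rw [pow_succ]
    ring
  rw [Finset.sum_congr rfl key, ← Finset.mul_sum, sum_choose_mul_bernoulli]
  have hj1 : (j : ℚ) + 1 ≠ 0 := by positivity
  have hj2 : (j : ℚ) + 2 ≠ 0 := by positivity
  field_simp
  ring

theorem sum_stirlingExponent_mul_shiftCoeff_sub {K j : ℕ} (hj : j ≤ K) :
    ∑ m ∈ Finset.range K, (PowerSeries.coeff (m + 1) stirlingExponent) *
        (shiftCoeff (m + 1) (j + 1) - if j + 1 = m + 1 then 1 else 0)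
      = (-1) ^ (j + 1) * (1 / ((j : ℚ) + 2) - 1 / (2 * ((j : ℚ) + 1))) := by
  rw [← sum_stirlingExponent_mul_shiftCoeff]
  symm
  rw [← Finset.sum_subset (Finset.range_subset_range.2 hj)]
  · refine Finset.sum_congr rfl fun i hi => ?_
    have := Finset.mem_range.1 hi
    rw [if_neg (by omega), sub_zero]
  · intro i _ hi
    have hi' : j ≤ i := by simpa using hi
    rcases hi'.eq_or_lt with rfl | h
    · simp [shiftCoeff_self]
    · rw [shiftCoeff, if_neg (by omega), if_neg (by omega)]
      simp

namespace HasTaylor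

variable {𝕜 : Type*} [RCLike 𝕜] {f g : 𝕜 → 𝕜} {a b : ℕ → 𝕜}

theorem sub (h : HasTaylor f a) (h' : HasTaylor g b) :
    HasTaylor (fun z => f z - g z) fun k => a k - b k := by
  filter_upwards [h, h'] with z h1 h2
  simpa [sub_mul] using h1.sub h2

theorem finset_sum {ι : Type*} (s : Finset ι) {f : ι → 𝕜 → 𝕜} {a : ι → ℕ → 𝕜}
    (h : ∀ i, HasTaylor (f i) (a i)) :
    HasTaylor (fun z => ∑ i ∈ s, f i z) fun k => ∑ i ∈ s, a i k := by
  have := (Filter.eventually_all_finset s).2 fun i _ => h i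
  filter_upwards [this] with z hz
  simpa [Finset.sum_mul] using hasSum_sum hz

theorem id_mul (h : HasTaylor f a) :
    HasTaylor (fun z => z * f z) fun k => if k = 0 then 0 else a (k - 1) := by
  filter_upwards [h] with z hz
  rw [← hasSum_nat_add_iff' 1]
  simpa [pow_succ, mul_assoc, mul_comm, mul_left_comm] using hz.mul_left z

theorem pow (m : ℕ) : HasTaylor (fun z : 𝕜 => z ^ m) fun k => if k = m then 1 else 0 := by
  refine Eventually.of_forall fun z => ?_
  have := hasSum_ite_eq m (z ^ m)
  refine this.congr_fun fun k => ?_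
  by_cases h : k = m
  · simp [h]
  · simp [h]

theorem isBigO_pow (h : HasTaylor f a) {n : ℕ} (hn : ∀ k < n, a k = 0) :
    f =O[𝓝 0] fun z => z ^ n := by
  have h1 := (hasTaylor_iff.1 h).isBigO_sub_partialSum_pow n
  simp only [zero_add] at h1
  have h2 : (FormalMultilinearSeries.ofScalars 𝕜 a).partialSum n = 0 := by
    funext x
    simp only [FormalMultilinearSeries.partialSum, Pi.zero_apply]
    refine Finset.sum_eq_zero fun k hk => ?_
    rw [FormalMultilinearSeries.ofScalars_apply_eq, hn k (Finset.mem_range.1 hk), zero_smul]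
  simp only [h2, Pi.zero_apply, sub_zero] at h1
  refine h1.trans (Asymptotics.isBigO_of_le _ fun x => ?_)
  simp

end HasTaylor

theorem hasTaylor_shift (m : ℕ) :
    HasTaylor (fun x : ℝ => (x / (1 + x)) ^ (m + 1)) fun j => (shiftCoeff (m + 1) j : ℝ) := by
  filter_upwards [Metric.ball_mem_nhds (0 : ℝ) one_pos] with x hx
  have hx' : ‖-x‖ < 1 := by simpa using hx
  have h := (hasSum_choose_mul_geometric_of_norm_lt_one m hx').mul_left (x ^ (m + 1))
  rw [← hasSum_nat_add_iff' (m + 1)]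
  have h0 : ∑ i ∈ Finset.range (m + 1), (shiftCoeff (m + 1) i : ℝ) * x ^ i = 0 := by
    refine Finset.sum_eq_zero fun i hi => ?_
    have := Finset.mem_range.1 hi
    rw [shiftCoeff, if_neg (by omega)]
    simp
  rw [h0, sub_zero]
  have e : x ^ (m + 1) * (1 / (1 - -x) ^ (m + 1)) = (x / (1 + x)) ^ (m + 1) := by
    rw [div_pow, sub_neg_eq_add]; ring
  rw [e] at h
  refine h.congr_fun fun n => ?_
  rw [shiftCoeff, if_pos (by omega)]
  have e1 : n + (m + 1) - 1 = n + m := by omega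
  simp only [Nat.add_sub_cancel, e1]
  rw [neg_pow x n, pow_add x n]
  push_cast
  ring

theorem hasTaylor_log_one_add :
    HasTaylor (fun x : ℝ => Real.log (1 + x)) fun j => -(-1) ^ j / (j : ℝ) := by
  filter_upwards [Metric.ball_mem_nhds (0 : ℝ) one_pos] with x hx
  have hx' : |-x| < 1 := by simpa using hx
  have h := (Real.hasSum_pow_div_log_of_abs_lt_one hx').neg
  rw [← hasSum_nat_add_iff' 1]
  simp only [sub_neg_eq_add, neg_neg] at h
  simp only [Finset.range_one, Finset.sum_singleton, Nat.cast_zero, div_zero, zero_mul, sub_zero]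
  refine h.congr_fun fun n => ?_
  rw [neg_pow x]
  push_cast
  ring

/-- The identity for E(x/(1+x)) - E(x), multiplied by x to clear 1/x and truncated at degree K: all
coefficients up to x^{K+2} cancel. -/
theorem isBigO_stirling_difference (K : ℕ) :
    (fun x : ℝ => Real.log (1 + x) + 1 / 2 * (x * Real.log (1 + x)) - x ^ 1
      - x * ∑ m ∈ Finset.range K, ((PowerSeries.coeff (m + 1) stirlingExponent : ℚ) : ℝ) *
        ((x / (1 + x)) ^ (m + 1) - x ^ (m + 1))) =O[𝓝 0] fun x => x ^ (K + 3) := by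
  have h1 := (hasTaylor_log_one_add.add (hasTaylor_log_one_add.id_mul.const_mul (1 / 2))).sub
    (HasTaylor.pow 1)
  have h2 := HasTaylor.finset_sum (Finset.range K) fun m =>
    ((hasTaylor_shift m).sub (HasTaylor.pow (m + 1))).const_mul
      ((PowerSeries.coeff (m + 1) stirlingExponent : ℚ) : ℝ)
  refine (h1.sub h2.id_mul).isBigO_pow fun k hk => ?_
  rcases k with _ | _ | j
  · simp
  · simp only [zero_add, Nat.sub_self, one_ne_zero, if_true, if_false]
    have : ∑ i ∈ Finset.range K, ((PowerSeries.coeff (i + 1) stirlingExponent : ℚ) : ℝ) *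
        ((shiftCoeff (i + 1) 0 : ℝ) - if 0 = i + 1 then 1 else 0) = 0 := by
      refine Finset.sum_eq_zero fun i _ => ?_
      rw [shiftCoeff, if_neg (by omega), if_neg (by omega)]
      simp
    rw [this]
    simp
  · have hs := sum_stirlingExponent_mul_shiftCoeff_sub (K := K) (j := j) (by omega)
    have hs' := congrArg (fun q : ℚ => (q : ℝ)) hs
    push_cast [apply_ite (Rat.cast : ℚ → ℝ)] at hs'
    simp only [Nat.add_sub_cancel, if_neg (Nat.succ_ne_zero _)]
    push_cast
    rw [hs']
    have hj1 : (j : ℝ) + 1 ≠ 0 := by positivity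
    have hj2 : (j : ℝ) + 2 ≠ 0 := by positivity
    have hj3 : (j : ℝ) + 1 + 1 ≠ 0 := by positivity
    field_simp
    ring

/-! ### Stirling's asymptotic series for the real Gamma function -/

/-- `log (s^s e^{-s} √(2πs) / Γ(s+1))`. -/
def logStirlingRatio (s : ℝ) : ℝ :=
  -s + s * Real.log s - Real.log (Real.Gamma (s + 1)) + Real.log (2 * Real.pi * s) / 2

theorem logStirlingRatio_add_one_sub {s : ℝ} (hs : 0 < s) :
    logStirlingRatio (s + 1) - logStirlingRatio s = (s + 1 / 2) * Real.log (1 + 1 / s) - 1 := by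
  have hG : 0 < Real.Gamma (s + 1) := Real.Gamma_pos_of_pos (by linarith)
  have h1 : Real.log (1 + 1 / s) = Real.log (s + 1) - Real.log s := by
    rw [← Real.log_div (by positivity) hs.ne']
    congr 1
    field_simp
  simp only [logStirlingRatio]
  rw [Real.Gamma_add_one (s := s + 1) (by positivity), Real.log_mul (by positivity) hG.ne',
    Real.log_mul (by positivity) (by positivity), Real.log_mul (by positivity) hs.ne', h1]
  ring

theorem log_Gamma_add_nat {s : ℝ} (hs : 0 < s) (n : ℕ) :
    Real.log (Real.Gamma (s + n)) =
      Real.log (Real.Gamma s) + ∑ m ∈ Finset.range n, Real.log (s + m) := by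
  induction n with
  | zero => simp
  | succ n ih =>
    have h : 0 < s + n := by positivity
    rw [Finset.sum_range_succ, ← add_assoc, ← ih, Nat.cast_add, Nat.cast_one, ← add_assoc,
      Real.Gamma_add_one h.ne', Real.log_mul h.ne' (Real.Gamma_pos_of_pos h).ne']
    ring

/-- Gauss's limit formula for log Γ(s) reduces real arguments to Stirling's formula for n!. This
fixes what the difference equation leaves free; a limit along s + ℕ for each fixed s suffices. -/
theorem tendsto_logStirlingRatio_add_nat {s : ℝ} (hs : 0 < s) :
    Tendsto (fun n : ℕ => logStirlingRatio (s + n)) atTop (𝓝 0) := by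
  have h1 := Real.BohrMollerup.tendsto_log_gamma hs
  have h2 : Tendsto (fun n => Real.log (Stirling.stirlingSeq n)) atTop (𝓝 (Real.log √Real.pi)) :=
    (Real.continuousAt_log (by positivity)).tendsto.comp Stirling.tendsto_stirlingSeq_sqrt_pi
  have h3 : Tendsto (fun n : ℕ => (n : ℝ) * Real.log (1 + s / n)) atTop (𝓝 s) :=
    (Real.tendsto_mul_log_one_add_div_atTop s).comp tendsto_natCast_atTop_atTop
  have h4 : Tendsto (fun n : ℕ => Real.log (1 + s / n)) atTop (𝓝 0) := by
    have h5 : Tendsto (fun n : ℕ => 1 + s / (n : ℝ)) atTop (𝓝 (1 + 0)) :=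
      tendsto_const_nhds.add (tendsto_const_div_atTop_nhds_zero_nat s)
    rw [add_zero] at h5
    have := (Real.continuousAt_log one_ne_zero).tendsto.comp h5
    rwa [Real.log_one] at this
  have h5 := ((h1.sub_const (Real.log (Real.Gamma s))).sub (h2.sub_const (Real.log √Real.pi))).add
    ((h3.sub_const s).add (h4.const_mul (s + 1 / 2)))
  have h6 : Real.log (Real.Gamma s) - Real.log (Real.Gamma s) - (Real.log √Real.pi -
      Real.log √Real.pi) + (s - s + (s + 1 / 2) * 0) = 0 := by ring
  rw [h6] at h5
  refine h5.congr' ?_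
  filter_upwards [eventually_gt_atTop 0] with n hn
  have hn' : (0 : ℝ) < n := by exact_mod_cast hn
  have e1 : Real.log (1 + s / n) = Real.log (s + n) - Real.log n := by
    rw [← Real.log_div (by positivity) hn'.ne']
    congr 1
    field_simp
    ring
  have e2 := log_Gamma_add_nat hs (n + 1)
  rw [Nat.cast_add, Nat.cast_one, ← add_assoc] at e2
  have hsn : s + n ≠ 0 := by positivity
  have e3 : Real.log (2 * Real.pi * (s + n)) =
      Real.log 2 + Real.log Real.pi + Real.log (s + n) := by
    rw [Real.log_mul (by positivity) hsn, Real.log_mul (by norm_num) (by positivity)]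
  rw [Stirling.log_stirlingSeq_formula, Real.BohrMollerup.logGammaSeq, e1, logStirlingRatio, e2,
    Real.log_div hn'.ne' (Real.exp_ne_zero _), Real.log_exp, Real.log_mul (by norm_num) hn'.ne',
    Real.log_sqrt Real.pi_pos.le, e3]
  ring

/-- The error D satisfies |D(s+1) - D(s)| ≤ C s^{-K-2}, which is dominated by a telescoping
difference of 2C s^{-K-1}; since D(s+n) → 0, summing over n bounds D(s). -/
theorem exists_logStirlingRatio_sub_le (K : ℕ) : ∃ C S : ℝ, 1 ≤ S ∧ ∀ s, S ≤ s →
    |logStirlingRatio s - Polynomial.aeval s⁻¹ (stirlingExpPoly K)| ≤ C * s⁻¹ ^ (K + 1) := by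
  obtain ⟨C, hC⟩ := (isBigO_stirling_difference K).bound
  obtain ⟨r, hr, hball⟩ := Metric.eventually_nhds_iff.1 hC
  set S : ℝ := max 1 (r⁻¹ + 1) with hS
  have hS1 : 1 ≤ S := le_max_left _ _
  set P : ℝ → ℝ := fun x => Polynomial.aeval x (stirlingExpPoly K) with hP
  set D : ℝ → ℝ := fun s => logStirlingRatio s - P s⁻¹ with hD
  have hC0 : 0 ≤ C := by
    have h1 := hball (y := r / 2) (by
      rw [dist_zero_right, Real.norm_of_nonneg (by positivity)]; linarith)
    have h2 := (norm_nonneg _).trans h1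
    have h3 : 0 < ‖(r / 2) ^ (K + 3)‖ := norm_pos_iff.2 (by positivity)
    exact nonneg_of_mul_nonneg_left h2 h3
  have hPsum : ∀ x, P x = ∑ m ∈ Finset.range K,
      ((PowerSeries.coeff (m + 1) stirlingExponent : ℚ) : ℝ) * x ^ (m + 1) := by
    intro x
    simp only [hP, aeval_stirlingExpPoly]
    rw [Finset.sum_range_succ', coeff_zero_stirlingExponent]
    simp
  have hstep : ∀ s, S ≤ s → |D (s + 1) - D s| ≤
      2 * C * (s⁻¹ ^ (K + 1) - (s + 1)⁻¹ ^ (K + 1)) := by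
    intro s hs
    have hs1 : 1 ≤ s := hS1.trans hs
    have hs0 : 0 < s := by linarith
    have h1 := hball (y := s⁻¹) (by
      rw [dist_zero_right, Real.norm_of_nonneg (by positivity)]
      refine inv_lt_of_inv_lt₀ hr ?_
      have : r⁻¹ + 1 ≤ S := le_max_right _ _
      linarith)
    have e1 : s⁻¹ / (1 + s⁻¹) = (s + 1)⁻¹ := by field_simp
    have e2 : D (s + 1) - D s = s * (Real.log (1 + s⁻¹) + 1 / 2 * (s⁻¹ * Real.log (1 + s⁻¹))
        - s⁻¹ ^ 1 - s⁻¹ * ∑ m ∈ Finset.range K,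
          ((PowerSeries.coeff (m + 1) stirlingExponent : ℚ) : ℝ) *
        ((s⁻¹ / (1 + s⁻¹)) ^ (m + 1) - s⁻¹ ^ (m + 1))) := by
      have := logStirlingRatio_add_one_sub hs0
      have e3 : D (s + 1) - D s = (logStirlingRatio (s + 1) - logStirlingRatio s)
        - (P (s + 1)⁻¹ - P s⁻¹) := by simp only [hD]; ring
      have e4 : P (s + 1)⁻¹ - P s⁻¹ = ∑ m ∈ Finset.range K,
          ((PowerSeries.coeff (m + 1) stirlingExponent : ℚ) : ℝ) *
          ((s⁻¹ / (1 + s⁻¹)) ^ (m + 1) - s⁻¹ ^ (m + 1)) := by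
        simp only [hPsum, e1, mul_sub, Finset.sum_sub_distrib]
      rw [e3, this, e4, one_div s]
      generalize ∑ m ∈ Finset.range K, ((PowerSeries.coeff (m + 1) stirlingExponent : ℚ) : ℝ) *
        ((s⁻¹ / (1 + s⁻¹)) ^ (m + 1) - s⁻¹ ^ (m + 1)) = T
      generalize Real.log (1 + s⁻¹) = L
      field_simp
    rw [Real.norm_eq_abs, norm_pow, Real.norm_of_nonneg (by positivity : 0 ≤ s⁻¹)] at h1
    rw [e2, abs_mul, abs_of_pos hs0]
    refine (mul_le_mul_of_nonneg_left h1 hs0.le).trans ?_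
    have e4 : s * (C * s⁻¹ ^ (K + 3)) = C * (s⁻¹ ^ (K + 1) * s⁻¹) := by
      have : s⁻¹ ^ (K + 3) = s⁻¹ ^ (K + 1) * s⁻¹ * s⁻¹ := by ring
      rw [this]
      field_simp
    -- For s ≥ 1 one has (s/(s+1))^{K+1} ≤ s/(s+1) ≤ 1 - 1/(2s). This makes the telescoping
    -- difference at least s^{-K-2}/2, whence the constant 2C.
    have e5 : (s + 1)⁻¹ ^ (K + 1) ≤ s⁻¹ ^ (K + 1) * (1 - s⁻¹ / 2) := by
      have e6 : (s + 1)⁻¹ = s⁻¹ * (s / (s + 1)) := by field_simp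
      rw [e6, mul_pow]
      gcongr
      have e7 : s / (s + 1) ≤ 1 - s⁻¹ / 2 := by
        rw [div_le_iff₀ (by positivity)]
        field_simp
        nlinarith
      refine (pow_le_of_le_one (by positivity) ?_ (by omega)).trans e7
      rw [div_le_one (by positivity)]
      linarith
    rw [e4]
    nlinarith [mul_le_mul_of_nonneg_left e5 hC0]
  have hsum : ∀ s, S ≤ s → ∀ n : ℕ, |D (s + n) - D s| ≤
      2 * C * (s⁻¹ ^ (K + 1) - (s + n)⁻¹ ^ (K + 1)) := by
    intro s hs n
    induction n with
    | zero => simp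
    | succ n ih =>
      have h1 := hstep (s + n) (hs.trans (by simp))
      have h2 := abs_sub_le (D (s + n + 1)) (D (s + n)) (D s)
      rw [Nat.cast_add, Nat.cast_one, ← add_assoc]
      linarith
  refine ⟨2 * C, S, hS1, fun s hs => ?_⟩
  have hs0 : 0 < s := by linarith
  have hlim : Tendsto (fun n : ℕ => |D (s + n) - D s|) atTop (𝓝 |0 - D s|) := by
    refine Tendsto.abs (Tendsto.sub_const ?_ _)
    have h1 : Tendsto (fun n : ℕ => (s + n)⁻¹) atTop (𝓝 0) :=
      tendsto_inv_atTop_zero.comp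
        (tendsto_atTop_add_const_left _ _ tendsto_natCast_atTop_atTop)
    have h2 : Tendsto P (𝓝 0) (𝓝 0) := by
      have : Continuous P := Polynomial.continuous_aeval _
      have h3 := this.tendsto 0
      rwa [hPsum, Finset.sum_eq_zero (by simp)] at h3
    simpa using (tendsto_logStirlingRatio_add_nat hs0).sub (h2.comp h1)
  rw [zero_sub, abs_neg] at hlim
  refine le_of_tendsto hlim (Eventually.of_forall fun n => (hsum s hs n).trans ?_)
  have : 0 ≤ (s + n)⁻¹ ^ (K + 1) := by positivity
  nlinarith

/-- `e^{-s} s^s / Γ(s+1)`. -/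
def stirlingRatio (s : ℝ) : ℝ := Real.exp (-s) * s ^ s / Real.Gamma (s + 1)

theorem stirlingRatio_mul_sqrt {s : ℝ} (hs : 0 < s) :
    stirlingRatio s * √(2 * Real.pi * s) = Real.exp (logStirlingRatio s) := by
  have hG : 0 < Real.Gamma (s + 1) := Real.Gamma_pos_of_pos (by linarith)
  rw [logStirlingRatio, Real.exp_add, Real.exp_sub, Real.exp_add, Real.exp_log hG, stirlingRatio,
    Real.rpow_def_of_pos hs, mul_comm (Real.log s), ← Real.log_sqrt (by positivity),
    Real.exp_log (by positivity)]

/-- Stirling's asymptotic series. -/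
theorem exists_stirlingRatio_sub_le (K : ℕ) : ∃ C S : ℝ, 1 ≤ S ∧ ∀ s, S ≤ s →
    |stirlingRatio s * √(2 * Real.pi * s) -
      ∑ k ∈ Finset.range (K + 1), (stirlingCoeff k : ℝ) * s⁻¹ ^ k| ≤ C * s⁻¹ ^ (K + 1) := by
  obtain ⟨C, S, hS, h⟩ := exists_logStirlingRatio_sub_le K
  obtain ⟨C', h'⟩ := exists_exp_stirlingExpPoly_sub_le K
  set P : ℝ → ℝ := fun x => Polynomial.aeval x (stirlingExpPoly K) with hP
  obtain ⟨M, hM⟩ := isCompact_Icc.exists_bound_of_continuousOn (s := Set.Icc (0 : ℝ) 1)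
    (f := fun x => Real.exp (P x))
    (Real.continuous_exp.comp (Polynomial.continuous_aeval _)).continuousOn
  have hM0 : 0 ≤ M := (norm_nonneg _).trans (hM 0 (by simp))
  have hC0 : 0 ≤ C := by
    have h1 := (abs_nonneg _).trans (h S le_rfl)
    exact nonneg_of_mul_nonneg_left h1 (by positivity)
  refine ⟨M * (Real.exp C * C) + C', S, hS, fun s hs => ?_⟩
  have hs1 : 1 ≤ s := hS.trans hs
  have hx : s⁻¹ ∈ Set.Icc (0 : ℝ) 1 := ⟨by positivity, inv_le_one_of_one_le₀ hs1⟩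
  rw [stirlingRatio_mul_sqrt (by linarith), ← aeval_stirlingPoly]
  set d := logStirlingRatio s - P s⁻¹ with hd
  have hdle : |d| ≤ C * s⁻¹ ^ (K + 1) := h s hs
  have hdC : |d| ≤ C := hdle.trans (mul_le_of_le_one_right hC0 (pow_le_one₀ hx.1 hx.2))
  have e1 : Real.exp (logStirlingRatio s) = Real.exp (P s⁻¹) * Real.exp d := by
    rw [← Real.exp_add, hd]; ring_nf
  have e2 : |Real.exp d - 1| ≤ Real.exp C * |d| := by
    have := Convex.norm_image_sub_le_of_norm_deriv_le
      (f := Real.exp) (s := Set.Icc (-C) C) (C := Real.exp C) (x := 0) (y := d)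
      (fun y _ => Real.differentiableAt_exp) (fun y hy => ?_) (convex_Icc _ _)
      ⟨by linarith, hC0⟩ (abs_le.1 hdC)
    · simpa using this
    · rw [Real.deriv_exp, Real.norm_of_nonneg (Real.exp_pos _).le]
      exact Real.exp_le_exp.2 hy.2
  have e3 : |Real.exp (P s⁻¹)| ≤ M := hM _ hx
  have e4 := h' _ hx
  calc |Real.exp (logStirlingRatio s) - Polynomial.aeval s⁻¹ (stirlingPoly K)|
      = |Real.exp (P s⁻¹) * (Real.exp d - 1) +
          (Real.exp (P s⁻¹) - Polynomial.aeval s⁻¹ (stirlingPoly K))| := by rw [e1]; ring_nf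
    _ ≤ |Real.exp (P s⁻¹)| * |Real.exp d - 1| +
          |Real.exp (P s⁻¹) - Polynomial.aeval s⁻¹ (stirlingPoly K)| := by
        rw [← abs_mul]; exact abs_add_le _ _
    _ ≤ M * (Real.exp C * (C * s⁻¹ ^ (K + 1))) + C' * s⁻¹ ^ (K + 1) := by
        gcongr
        exact e2.trans (by gcongr)
    _ = _ := by ring

/-! ### Laplace transforms -/

theorem integrableOn_rpow_mul_exp_neg_mul {p a : ℝ} (hp : -1 < p) (ha : 0 < a) :
    IntegrableOn (fun s : ℝ => s ^ p * Real.exp (-a * s)) (Set.Ioi 0) := by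
  have := integrableOn_rpow_mul_exp_neg_mul_rpow (p := 1) hp one_pos ha
  simpa using this

theorem norm_cexp_neg_ofReal_mul (s : ℝ) (w : ℂ) :
    ‖Complex.exp (-(s : ℂ) * w)‖ = Real.exp (-w.re * s) := by
  rw [Complex.norm_exp]
  congr 1
  simp
  ring

theorem aestronglyMeasurable_mul_cexp_neg {g : ℝ → ℂ} {μ : Measure ℝ}
    (hg : AEStronglyMeasurable g μ) (w : ℂ) :
    AEStronglyMeasurable (fun s : ℝ => g s * Complex.exp (-(s : ℂ) * w)) μ :=
  hg.mul (by fun_prop : Continuous fun s : ℝ => Complex.exp (-(s : ℂ) * w)).aestronglyMeasurable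

theorem integrableOn_laplace {g : ℝ → ℂ} {p : ℝ} (hp : -1 < p)
    (hg : AEStronglyMeasurable g (volume.restrict (Set.Ioi 0)))
    (hle : ∀ s, 0 < s → ‖g s‖ ≤ s ^ p) {w : ℂ} (hw : 0 < w.re) :
    IntegrableOn (fun s : ℝ => g s * Complex.exp (-(s : ℂ) * w)) (Set.Ioi 0) := by
  refine (integrableOn_rpow_mul_exp_neg_mul hp hw).mono' (aestronglyMeasurable_mul_cexp_neg hg w) ?_
  refine (ae_restrict_iff' measurableSet_Ioi).2 (Eventually.of_forall fun s hs => ?_)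
  rw [norm_mul, norm_cexp_neg_ofReal_mul]
  gcongr
  exact hle s hs

theorem hasDerivAt_laplace {g : ℝ → ℂ} {p : ℝ} (hp : -1 < p)
    (hg : AEStronglyMeasurable g (volume.restrict (Set.Ioi 0)))
    (hle : ∀ s, 0 < s → ‖g s‖ ≤ s ^ p) {w : ℂ} (hw : 0 < w.re) :
    HasDerivAt (fun w => ∫ s in Set.Ioi (0 : ℝ), g s * Complex.exp (-(s : ℂ) * w))
      (-∫ s in Set.Ioi (0 : ℝ), (s * g s) * Complex.exp (-(s : ℂ) * w)) w := by
  -- On this half-plane around w a single integrable function dominates all the differentiated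
  -- integrands.
  have hopen : IsOpen {z : ℂ | w.re / 2 < z.re} := isOpen_lt continuous_const Complex.continuous_re
  have h := hasDerivAt_integral_of_dominated_loc_of_deriv_le
    (μ := volume.restrict (Set.Ioi (0 : ℝ)))
    (F := fun w (s : ℝ) => g s * Complex.exp (-(s : ℂ) * w))
    (F' := fun w (s : ℝ) => -((s * g s) * Complex.exp (-(s : ℂ) * w)))
    (x₀ := w) (s := {z : ℂ | w.re / 2 < z.re})
    (bound := fun s => s ^ (p + 1) * Real.exp (-(w.re / 2) * s))
    (hopen.mem_nhds (by simp only [Set.mem_ofPred_eq]; linarith))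
    (Eventually.of_forall fun z => aestronglyMeasurable_mul_cexp_neg hg z)
    (integrableOn_laplace hp hg hle hw)
    (aestronglyMeasurable_mul_cexp_neg
      (Complex.continuous_ofReal.aestronglyMeasurable.mul hg) w).neg
    ?_ (integrableOn_rpow_mul_exp_neg_mul (by linarith) (by linarith)) ?_
  · refine h.2.congr_deriv ?_
    rw [integral_neg]
  · refine (ae_restrict_iff' measurableSet_Ioi).2 (Eventually.of_forall fun s hs z hz => ?_)
    have hs' : 0 < s := hs
    have hz' : w.re / 2 < z.re := hz
    rw [norm_neg, norm_mul, norm_mul, norm_cexp_neg_ofReal_mul, Complex.norm_real,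
      Real.norm_of_nonneg hs'.le, Real.rpow_add hs', Real.rpow_one, mul_comm s]
    gcongr
    exact hle s hs
  · refine Eventually.of_forall fun s z _ => ?_
    have h1 : HasDerivAt (fun z : ℂ => -(s : ℂ) * z) (-(s : ℂ)) z := by
      simpa using (hasDerivAt_id z).const_mul (-(s : ℂ))
    refine (h1.cexp.const_mul (g s)).congr_deriv ?_
    ring

theorem aestronglyMeasurable_ofReal_rpow (p : ℝ) :
    AEStronglyMeasurable (fun s : ℝ => ((s ^ p : ℝ) : ℂ)) (volume.restrict (Set.Ioi 0)) := by
  refine ContinuousOn.aestronglyMeasurable ?_ measurableSet_Ioi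
  refine Complex.continuous_ofReal.comp_continuousOn (continuousOn_id.rpow_const fun x hx => ?_)
  exact Or.inl (ne_of_gt hx)

/-- The Gamma integral with a complex rate. -/
theorem integral_rpow_mul_cexp_neg_mul {a : ℝ} (ha : 0 < a) {w : ℂ} (hw : 0 < w.re) :
    ∫ s in Set.Ioi (0 : ℝ), ((s ^ (a - 1) : ℝ) : ℂ) * Complex.exp (-(s : ℂ) * w) =
      (Real.Gamma a : ℂ) * w ^ (-a : ℂ) := by
  have hp : -1 < a - 1 := by linarith
  have hle : ∀ s : ℝ, 0 < s → ‖((s ^ (a - 1) : ℝ) : ℂ)‖ ≤ s ^ (a - 1) := fun s hs => by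
    rw [Complex.norm_real, Real.norm_of_nonneg (by positivity)]
  set U : Set ℂ := {z | 0 < z.re} with hU
  have hUo : IsOpen U := isOpen_lt continuous_const Complex.continuous_re
  have hUc : IsPreconnected U := (convex_halfSpace_re_gt 0).isPreconnected
  have h1 : AnalyticOnNhd ℂ (fun w => ∫ s in Set.Ioi (0 : ℝ),
      ((s ^ (a - 1) : ℝ) : ℂ) * Complex.exp (-(s : ℂ) * w)) U := by
    refine DifferentiableOn.analyticOnNhd (fun z hz => ?_) hUo
    exact (hasDerivAt_laplace hp (aestronglyMeasurable_ofReal_rpow _) hle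
      hz).differentiableAt.differentiableWithinAt
  have h2 : AnalyticOnNhd ℂ (fun w : ℂ => (Real.Gamma a : ℂ) * w ^ (-a : ℂ)) U := by
    intro z hz
    exact analyticAt_const.mul (analyticAt_id.cpow analyticAt_const (Or.inl hz))
  -- Identity theorem: both sides are analytic on Re w > 0 and agree at real points accumulating at
  -- 1, where the real Gamma integral applies.
  refine h1.eqOn_of_preconnected_of_frequently_eq h2 hUc (z₀ := 1) (by simp [hU]) ?_ hw
  have h3 : ∀ᶠ x : ℝ in 𝓝[>] 1, (∫ s in Set.Ioi (0 : ℝ),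
      ((s ^ (a - 1) : ℝ) : ℂ) * Complex.exp (-(s : ℂ) * (x : ℂ))) =
        (Real.Gamma a : ℂ) * (x : ℂ) ^ (-a : ℂ) := by
    filter_upwards [self_mem_nhdsWithin] with x hx
    have hx0 : 0 < x := lt_trans one_pos hx
    have h4 := Real.integral_rpow_mul_exp_neg_mul_Ioi ha hx0
    have h5 : ((∫ t in Set.Ioi (0 : ℝ), t ^ (a - 1) * Real.exp (-(x * t)) : ℝ) : ℂ) =
        ((1 / x) ^ a * Real.Gamma a : ℝ) := by rw [h4]
    rw [← integral_complex_ofReal] at h5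
    have h6 : (x : ℂ) ^ (-a : ℂ) = (((1 / x) ^ a : ℝ) : ℂ) := by
      rw [one_div, Real.inv_rpow hx0.le, ← Real.rpow_neg hx0.le, Complex.ofReal_cpow hx0.le]
      simp
    rw [h6, mul_comm, ← Complex.ofReal_mul, ← h5]
    refine setIntegral_congr_fun measurableSet_Ioi fun t _ => ?_
    push_cast
    congr 2
    ring
  have h4 : Tendsto (fun x : ℝ => (x : ℂ)) (𝓝[>] 1) (𝓝[≠] 1) := by
    refine tendsto_nhdsWithin_iff.2 ⟨?_, ?_⟩
    · have : Tendsto (fun x : ℝ => (x : ℂ)) (𝓝 1) (𝓝 ((1 : ℝ) : ℂ)) :=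
        Complex.continuous_ofReal.tendsto 1
      rw [Complex.ofReal_one] at this
      exact this.mono_left nhdsWithin_le_nhds
    · filter_upwards [self_mem_nhdsWithin] with x hx
      have : x ≠ 1 := ne_of_gt hx
      exact fun h => this (Complex.ofReal_eq_one.1 h)
  exact h4.frequently h3.frequently

/-! ### The line integral for `s^s e^{-s} / Γ(s+1)` -/

/-- `ψ(y) = log (1 + iy) - iy`. -/
def linePhase (y : ℝ) : ℂ := Complex.log (1 + y * Complex.I) - y * Complex.I

theorem one_add_mul_I_mem_slitPlane (y : ℝ) : 1 + (y : ℂ) * Complex.I ∈ Complex.slitPlane :=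
  Or.inl (by simp)

theorem one_add_mul_I_ne_zero (y : ℝ) : 1 + (y : ℂ) * Complex.I ≠ 0 :=
  Complex.slitPlane_ne_zero (one_add_mul_I_mem_slitPlane y)

theorem continuous_linePhase : Continuous linePhase := by
  have h : Continuous fun y : ℝ => 1 + (y : ℂ) * Complex.I := by fun_prop
  exact (h.clog one_add_mul_I_mem_slitPlane).sub (by fun_prop)

theorem norm_one_add_mul_I (y : ℝ) : ‖1 + (y : ℂ) * Complex.I‖ = √(1 + y ^ 2) := by
  rw [Complex.norm_def, Complex.normSq_apply]
  congr 1
  simp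
  ring

theorem linePhase_re (y : ℝ) : (linePhase y).re = Real.log (1 + y ^ 2) / 2 := by
  rw [linePhase, Complex.sub_re, Complex.log_re, norm_one_add_mul_I, Real.log_sqrt (by positivity)]
  simp

theorem linePhase_re_nonneg (y : ℝ) : 0 ≤ (linePhase y).re := by
  rw [linePhase_re]
  have := Real.log_nonneg (x := 1 + y ^ 2) (by nlinarith [sq_nonneg y])
  positivity

theorem integrable_one_add_mul_I_cpow {s : ℝ} (hs : 0 < s) :
    Integrable fun y : ℝ => (1 + (y : ℂ) * Complex.I) ^ (-(s + 1 : ℝ) : ℂ) := by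
  have h := integrable_rpow_neg_one_add_norm_sq (E := ℝ) (μ := volume) (r := s + 1) (by simpa)
  refine h.mono' (Continuous.aestronglyMeasurable ?_) (Eventually.of_forall fun y => ?_)
  · exact Continuous.cpow (by fun_prop) continuous_const one_add_mul_I_mem_slitPlane
  · rw [← Complex.ofReal_neg, Complex.norm_cpow_real, norm_one_add_mul_I,
      Real.sqrt_eq_rpow, ← Real.rpow_mul (by positivity), Real.norm_eq_abs, sq_abs]
    refine le_of_eq ?_
    congr 1
    ring

open FourierTransform in
-- The Gamma integral with rate 1 + iy says that Γ(s+1)(1+iy)^{-s-1} is the Fourier transform of x^s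
-- e^{-x} on (0,∞); the formula is Fourier inversion at the point x = s.
theorem stirling_inversion {s : ℝ} (hs : 0 < s) :
    ((s ^ s * Real.exp (-s) : ℝ) : ℂ) = (Real.Gamma (s + 1) : ℂ) * (1 / (2 * Real.pi) *
      ∫ y : ℝ, Complex.exp (y * s * Complex.I) *
        (1 + (y : ℂ) * Complex.I) ^ (-(s + 1 : ℝ) : ℂ)) := by
  set f : ℝ → ℂ := (Set.Ioi (0 : ℝ)).indicator fun x => ((x ^ s * Real.exp (-x) : ℝ) : ℂ) with hf
  have hfi : Integrable f := by
    rw [hf, integrable_indicator_iff measurableSet_Ioi]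
    have := integrableOn_rpow_mul_exp_neg_mul (p := s) (a := 1) (by linarith) one_pos
    simp only [neg_mul, one_mul] at this
    exact this.ofReal
  set g : ℝ → ℂ := fun y => (1 + (y : ℂ) * Complex.I) ^ (-(s + 1 : ℝ) : ℂ) with hg
  have hF : 𝓕 f = fun ξ => (Real.Gamma (s + 1) : ℂ) * g (2 * Real.pi * ξ) := by
    funext ξ
    rw [Real.fourier_real_eq_integral_exp_smul]
    have h1 := integral_rpow_mul_cexp_neg_mul (a := s + 1) (by linarith)
      (w := 1 + ((2 * Real.pi * ξ : ℝ) : ℂ) * Complex.I) (by simp)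
    simp only [hg]
    rw [← h1, ← integral_indicator measurableSet_Ioi]
    refine integral_congr_ae (Eventually.of_forall fun x => ?_)
    simp only [hf, Set.indicator]
    split_ifs with hx
    · simp only [smul_eq_mul, add_sub_cancel_right]
      push_cast
      rw [mul_left_comm, ← Complex.exp_add]
      congr 2
      ring
    · simp
  have hgi : Integrable fun ξ : ℝ => g (2 * Real.pi * ξ) :=
    (integrable_one_add_mul_I_cpow hs).comp_mul_left' (by positivity)
  have hFi : Integrable (𝓕 f) := by
    rw [hF]
    exact hgi.const_mul _
  have hcont : ContinuousAt f s := by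
    have h1 : ContinuousAt (fun x : ℝ => ((x ^ s * Real.exp (-x) : ℝ) : ℂ)) s := by
      refine Complex.continuous_ofReal.continuousAt.comp ?_
      exact (Real.continuousAt_rpow_const _ _ (Or.inl hs.ne')).mul (by fun_prop)
    refine h1.congr ?_
    filter_upwards [Ioi_mem_nhds hs] with x hx
    simp only [hf, Set.indicator]
    rw [if_pos hx]
  have hinv := hfi.fourierInv_fourier_eq hFi hcont
  rw [Real.fourierInv_eq', hF] at hinv
  have hfs : f s = ((s ^ s * Real.exp (-s) : ℝ) : ℂ) := by
    exact Set.indicator_of_mem (Set.mem_Ioi.2 hs) _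
  rw [← hfs, ← hinv]
  -- The substitution y = 2πξ absorbs the normalisation of the Fourier transform.
  have h2 := Measure.integral_comp_mul_left
    (fun y : ℝ => Complex.exp (y * s * Complex.I) * g y) (2 * Real.pi)
  rw [abs_of_pos (by positivity)] at h2
  have h3 : (1 / (2 * Real.pi) : ℂ) * ∫ y : ℝ, Complex.exp (y * s * Complex.I) * g y =
      ∫ ξ : ℝ, Complex.exp ((2 * Real.pi * ξ : ℝ) * s * Complex.I) * g (2 * Real.pi * ξ) := by
    rw [h2, Complex.real_smul]
    push_cast
    rw [one_div]
  change _ = _ * (1 / (2 * Real.pi) * ∫ y : ℝ, Complex.exp (y * s * Complex.I) * g y)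
  rw [h3, ← integral_const_mul]
  refine integral_congr_ae (Eventually.of_forall fun ξ => ?_)
  simp only [smul_eq_mul, RCLike.inner_apply, conj_trivial]
  push_cast
  rw [mul_left_comm]
  congr 3
  ring

theorem cexp_mul_one_add_mul_I_cpow (s y : ℝ) :
    Complex.exp (y * s * Complex.I) * (1 + (y : ℂ) * Complex.I) ^ (-(s + 1 : ℝ) : ℂ) =
      (1 + (y : ℂ) * Complex.I)⁻¹ * Complex.exp (-(s : ℂ) * linePhase y) := by
  have h := one_add_mul_I_ne_zero y
  have h1 : (1 + (y : ℂ) * Complex.I)⁻¹ = Complex.exp (-Complex.log (1 + (y : ℂ) * Complex.I)) := by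
    rw [Complex.exp_neg, Complex.exp_log h]
  rw [Complex.cpow_def_of_ne_zero h, ← Complex.exp_add, linePhase, h1, ← Complex.exp_add]
  congr 1
  push_cast
  ring

theorem stirlingRatio_eq_integral {s : ℝ} (hs : 0 < s) :
    (stirlingRatio s : ℂ) = 1 / (2 * Real.pi) *
      ∫ y : ℝ, (1 + (y : ℂ) * Complex.I)⁻¹ * Complex.exp (-(s : ℂ) * linePhase y) := by
  have hG : Real.Gamma (s + 1) ≠ 0 := (Real.Gamma_pos_of_pos (by linarith)).ne'
  have h := stirling_inversion hs
  simp only [cexp_mul_one_add_mul_I_cpow] at h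
  rw [stirlingRatio, mul_comm (Real.exp (-s)), Complex.ofReal_div, h, mul_div_cancel_left₀]
  exact_mod_cast hG

theorem stirlingRatio_nonneg {s : ℝ} (hs : 0 < s) : 0 ≤ stirlingRatio s := by
  have hG : 0 < Real.Gamma (s + 1) := Real.Gamma_pos_of_pos (by linarith)
  rw [stirlingRatio]
  positivity

/-- Indeed s^s e^{-s} = ∫_s^∞ s^s e^{-x} dx ≤ ∫_s^∞ x^s e^{-x} dx ≤ Γ(s+1). -/
theorem stirlingRatio_le_one {s : ℝ} (hs : 0 < s) : stirlingRatio s ≤ 1 := by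
  have hs1 : 0 < s + 1 := by linarith
  rw [stirlingRatio, div_le_one (Real.Gamma_pos_of_pos hs1), Real.Gamma_eq_integral hs1,
    ← integral_exp_neg_Ioi, ← integral_mul_const]
  have hi := Real.GammaIntegral_convergent hs1
  have hsub : Set.Ioi s ⊆ Set.Ioi 0 := Set.Ioi_subset_Ioi hs.le
  calc ∫ x in Set.Ioi s, Real.exp (-x) * s ^ s
      ≤ ∫ x in Set.Ioi s, Real.exp (-x) * x ^ (s + 1 - 1) := by
        refine setIntegral_mono_on ((integrableOn_exp_neg_Ioi s).mul_const _)
          (hi.mono_set hsub) measurableSet_Ioi fun x hx => ?_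
        rw [add_sub_cancel_right]
        have : s < x := hx
        gcongr
    _ ≤ ∫ x in Set.Ioi 0, Real.exp (-x) * x ^ (s + 1 - 1) := by
        refine setIntegral_mono_set hi ?_ hsub.eventuallyLE
        refine (ae_restrict_iff' measurableSet_Ioi).2 (Eventually.of_forall fun x hx => ?_)
        have : (0 : ℝ) < x := hx
        positivity

/-! ### Cauchy-type integrals depending on a parameter -/

/-- For |w| < c/2 ≤ |k|/2 one has |w+k| ≥ |k|/2, so the differentiated integrand is at most
(4/c)|g/k|. It gives both the derivative of the line integral and the holomorphy at w = 0 of all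
pieces away from the saddle. -/
theorem hasDerivAt_integral_div_add {α : Type*} [MeasurableSpace α] {μ : Measure α} {g k : α → ℂ}
    (hg : AEStronglyMeasurable g μ) (hk : AEStronglyMeasurable k μ)
    (hgk : Integrable (fun x => g x / k x) μ) {c : ℝ} (hc : 0 < c) (hck : ∀ᵐ x ∂μ, c ≤ ‖k x‖)
    {w : ℂ} (hw : ‖w‖ < c / 2) :
    HasDerivAt (fun w => ∫ x, g x / (w + k x) ∂μ) (-∫ x, g x / (w + k x) ^ 2 ∂μ) w := by
  have hlow : ∀ᵐ x ∂μ, ∀ z ∈ Metric.ball (0 : ℂ) (c / 2), ‖k x‖ / 2 ≤ ‖z + k x‖ := by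
    filter_upwards [hck] with x hx z hz
    have h1 : ‖z‖ < c / 2 := by simpa using hz
    have h2 := norm_sub_le (z + k x) z
    rw [add_sub_cancel_left] at h2
    linarith
  have hw' : w ∈ Metric.ball (0 : ℂ) (c / 2) := by simpa using hw
  have hmeas : ∀ z, AEStronglyMeasurable (fun x => g x / (z + k x)) μ := fun z =>
    (hg.aemeasurable.div (hk.aemeasurable.const_add z)).aestronglyMeasurable
  have h := hasDerivAt_integral_of_dominated_loc_of_deriv_le
    (μ := μ) (F := fun w x => g x / (w + k x)) (F' := fun w x => -(g x / (w + k x) ^ 2))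
    (x₀ := w) (s := Metric.ball (0 : ℂ) (c / 2)) (bound := fun x => 4 / c * ‖g x / k x‖)
    (Metric.isOpen_ball.mem_nhds hw') (Eventually.of_forall hmeas) ?_ ?_ ?_
    (hgk.norm.const_mul _) ?_
  · refine h.2.congr_deriv ?_
    rw [integral_neg]
  · refine (hgk.norm.const_mul 2).mono' (hmeas w) ?_
    filter_upwards [hck, hlow] with x h1 h2
    have h3 := h2 w hw'
    have h4 : 0 < ‖k x‖ := hc.trans_le h1
    have h5 : 0 < ‖w + k x‖ := by linarith
    rw [norm_div, norm_div, div_le_iff₀ h5]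
    calc ‖g x‖ = 2 * (‖g x‖ / ‖k x‖) * (‖k x‖ / 2) := by field_simp
      _ ≤ _ := by gcongr
  · exact (hg.aemeasurable.div
      ((hk.aemeasurable.const_add w).pow_const 2)).aestronglyMeasurable.neg
  · filter_upwards [hck, hlow] with x h1 h2 z hz
    have h3 := h2 z hz
    have h4 : 0 < ‖k x‖ := hc.trans_le h1
    have h5 : 0 < ‖z + k x‖ := by linarith
    rw [norm_neg, norm_div, norm_div, norm_pow, div_le_iff₀ (by positivity)]
    have h6 : c * ‖k x‖ ≤ 4 * ‖z + k x‖ ^ 2 := by nlinarith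
    calc ‖g x‖ = (‖g x‖ / ‖k x‖) / c * (c * ‖k x‖) := by field_simp
      _ ≤ (‖g x‖ / ‖k x‖) / c * (4 * ‖z + k x‖ ^ 2) := by gcongr
      _ = _ := by ring
  · filter_upwards [hck, hlow] with x h1 h2 z hz
    have h3 := h2 z hz
    have h4 : 0 < ‖k x‖ := hc.trans_le h1
    have h5 : z + k x ≠ 0 := norm_pos_iff.1 (by linarith)
    have h6 := ((hasDerivAt_id z).add_const (k x)).inv h5
    refine (h6.const_mul (g x)).congr_deriv ?_
    simp only [id]
    ring

theorem analyticAt_integral_div_add {α : Type*} [MeasurableSpace α] {μ : Measure α} {g k : α → ℂ}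
    (hg : AEStronglyMeasurable g μ) (hk : AEStronglyMeasurable k μ)
    (hgk : Integrable (fun x => g x / k x) μ) {c : ℝ} (hc : 0 < c)
    (hck : ∀ᵐ x ∂μ, c ≤ ‖k x‖) :
    AnalyticAt ℂ (fun w => ∫ x, g x / (w + k x) ∂μ) 0 := by
  refine DifferentiableOn.analyticAt (s := Metric.ball 0 (c / 2)) (fun w hw => ?_)
    (Metric.ball_mem_nhds 0 (by positivity))
  have hw' : ‖w‖ < c / 2 := by simpa using hw
  exact (hasDerivAt_integral_div_add hg hk hgk hc hck hw').differentiableAt.differentiableWithinAt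

/-! ### Bounds for the phase -/

/-- The imaginary part of ψ(y) is arg(1+iy) - y, with bounded argument, so |k+ψ(y)| grows linearly;
the lower bound A absorbs the constants. The integrand of the line integral is thus O((1+y²)⁻¹). -/
theorem sqrt_le_mul_norm_add_linePhase {k : ℂ} {y A : ℝ} (hA : 0 < A)
    (h : A ≤ ‖k + linePhase y‖) :
    √(1 + y ^ 2) ≤ (1 + (‖k‖ + Real.pi + 1) / A) * ‖k + linePhase y‖ := by
  have h1 : √(1 + y ^ 2) ≤ 1 + |y| := by
    refine Real.sqrt_le_iff.2 ⟨by positivity, ?_⟩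
    nlinarith [sq_abs y, abs_nonneg y]
  have h2 : |y| ≤ ‖k + linePhase y‖ + ‖k‖ + Real.pi := by
    have e1 : y = k.im + Complex.arg (1 + y * Complex.I) - (k + linePhase y).im := by
      simp [linePhase, Complex.log_im]
    have e2 := Complex.abs_arg_le_pi (1 + y * Complex.I)
    have e3 := Complex.abs_im_le_norm k
    have e4 := Complex.abs_im_le_norm (k + linePhase y)
    rw [abs_le] at *
    constructor <;> linarith
  have h3 : ‖k‖ + Real.pi + 1 ≤ (‖k‖ + Real.pi + 1) / A * ‖k + linePhase y‖ := by
    rw [div_mul_eq_mul_div, le_div_iff₀ hA]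
    have := Real.pi_pos
    gcongr
  linarith

theorem integrable_inv_div_add_linePhase {μ : Measure ℝ} (hμ : μ ≤ volume) {k : ℂ} {A : ℝ}
    (hA : 0 < A) (h : ∀ᵐ y ∂μ, A ≤ ‖k + linePhase y‖) :
    Integrable (fun y : ℝ => (1 + (y : ℂ) * Complex.I)⁻¹ / (k + linePhase y)) μ := by
  have hb := (integrable_inv_one_add_sq.mono_measure hμ).const_mul
    (1 + (‖k‖ + Real.pi + 1) / A)
  refine hb.mono' ?_ ?_
  · refine (Measurable.div ?_ ?_).aestronglyMeasurable
    · exact (by fun_prop : Continuous fun y : ℝ => 1 + (y : ℂ) * Complex.I).measurable.inv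
    · exact (continuous_const.add continuous_linePhase).measurable
  · filter_upwards [h] with y hy
    have h1 := sqrt_le_mul_norm_add_linePhase hA hy
    have h2 : 0 < ‖k + linePhase y‖ := hA.trans_le hy
    have h3 : (0 : ℝ) < 1 + y ^ 2 := by positivity
    have h4 : 0 < √(1 + y ^ 2) := Real.sqrt_pos.2 h3
    rw [norm_div, norm_inv, norm_one_add_mul_I, div_le_iff₀ h2]
    calc (√(1 + y ^ 2))⁻¹ = √(1 + y ^ 2) * (1 + y ^ 2)⁻¹ := by
          nth_rw 3 [← Real.sq_sqrt h3.le]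
          field_simp
      _ ≤ ((1 + (‖k‖ + Real.pi + 1) / A) * ‖k + linePhase y‖) * (1 + y ^ 2)⁻¹ := by gcongr
      _ = _ := by ring

/-- Comparison with the derivative of -1/(1 + arsinh y). The square matters: to the first power the
integral diverges like log log, so Fubini is used for the transform with n = 1 and not for n = 0. -/
theorem integrable_inv_sqrt_mul_inv_sq {a : ℝ} (ha : 0 < a) :
    Integrable fun y : ℝ => (√(1 + y ^ 2))⁻¹ * ((a + Real.log (1 + y ^ 2) / 2) ^ 2)⁻¹ := by
  have h0 : IntegrableOn (fun y : ℝ => (√(1 + y ^ 2))⁻¹ / (1 + Real.arsinh y) ^ 2) (Set.Ici 0) := by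
    rw [integrableOn_Ici_iff_integrableOn_Ioi]
    refine integrableOn_Ioi_deriv_of_nonneg' (g := fun y => -(1 + Real.arsinh y)⁻¹) (l := -0)
      (fun x hx => ?_) (fun x hx => by positivity) ?_
    · have hx' : 0 ≤ Real.arsinh x := Real.arsinh_nonneg_iff.2 hx
      have h1 : 1 + Real.arsinh x ≠ 0 := by positivity
      refine (((Real.hasDerivAt_arsinh x).const_add 1).inv h1).neg.congr_deriv ?_
      ring
    · refine Tendsto.neg (tendsto_inv_atTop_zero.comp ?_)
      refine tendsto_atTop_add_const_left _ _ (tendsto_atTop_mono' _ ?_ Real.tendsto_log_atTop)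
      filter_upwards [eventually_gt_atTop 0] with x hx
      exact Real.log_le_log hx (le_add_of_nonneg_right (Real.sqrt_nonneg _))
  rw [← integrable_indicator_iff measurableSet_Ici] at h0
  set h := (Set.Ici (0 : ℝ)).indicator
    (fun y : ℝ => (√(1 + y ^ 2))⁻¹ / (1 + Real.arsinh y) ^ 2) with hh
  -- With L = log(1+y²)/2 and arsinh y ≤ 1 + L, this m gives m(1 + arsinh y) ≤ m(2 + L) ≤ a + L.
  set m := min (a / 2) 1 with hm
  have hm0 : 0 < m := by positivity
  have hb := (h0.add h0.comp_neg).const_mul (m ^ 2)⁻¹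
  have hnn : ∀ y, 0 ≤ h y := fun y => Set.indicator_nonneg (fun y _ => by positivity) y
  have hle : ∀ y, 0 ≤ y → (√(1 + y ^ 2))⁻¹ * ((a + Real.log (1 + y ^ 2) / 2) ^ 2)⁻¹ ≤
      (m ^ 2)⁻¹ * h y := by
    intro y hy
    have e1 : h y = (√(1 + y ^ 2))⁻¹ / (1 + Real.arsinh y) ^ 2 :=
      Set.indicator_of_mem (Set.mem_Ici.2 hy) _
    have hy' : 0 ≤ Real.arsinh y := Real.arsinh_nonneg_iff.2 hy
    have e2 : Real.arsinh y ≤ 1 + Real.log (1 + y ^ 2) / 2 := by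
      have hs : y ≤ √(1 + y ^ 2) := Real.le_sqrt_of_sq_le (by linarith)
      have hs0 : 0 < √(1 + y ^ 2) := Real.sqrt_pos.2 (by positivity)
      rw [← Real.log_sqrt (by positivity), Real.arsinh]
      calc Real.log (y + √(1 + y ^ 2)) ≤ Real.log (2 * √(1 + y ^ 2)) :=
            Real.log_le_log (by positivity) (by linarith)
        _ = Real.log 2 + Real.log √(1 + y ^ 2) := Real.log_mul two_ne_zero hs0.ne'
        _ ≤ _ := by have := Real.log_two_lt_d9; linarith
    have e3 : 0 ≤ Real.log (1 + y ^ 2) := Real.log_nonneg (by nlinarith [sq_nonneg y])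
    have e4 : m * (1 + Real.arsinh y) ≤ a + Real.log (1 + y ^ 2) / 2 := by
      have h1 : m ≤ a / 2 := min_le_left _ _
      have h2 : m ≤ 1 := min_le_right _ _
      nlinarith
    rw [e1]
    calc _ ≤ (√(1 + y ^ 2))⁻¹ * ((m * (1 + Real.arsinh y)) ^ 2)⁻¹ := by gcongr
      _ = _ := by rw [mul_pow, mul_inv]; ring
  refine hb.mono' (Measurable.aestronglyMeasurable (by fun_prop)) (Eventually.of_forall fun y => ?_)
  rw [Real.norm_of_nonneg (by positivity)]
  simp only [Pi.add_apply, mul_add]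
  rcases le_total 0 y with hy | hy
  · have := hle y hy
    have := hnn (-y)
    have : 0 ≤ (m ^ 2)⁻¹ * h (-y) := by positivity
    linarith
  · have := hle (-y) (by linarith)
    rw [neg_sq] at this
    have := hnn y
    have : 0 ≤ (m ^ 2)⁻¹ * h y := by positivity
    linarith

/-! ### The Laplace transforms of `s^{s+n} e^{-s} / Γ(s+1)` -/

/-- `s^n · s^s e^{-s} / Γ(s+1)` as a complex number. -/
def laplaceDensity (n : ℕ) (s : ℝ) : ℂ := (s : ℂ) ^ n * (stirlingRatio s : ℂ)

theorem laplaceIntegrand_eq (n : ℕ) (w : ℂ) {s : ℝ} (hs : 0 < s) :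
    laplaceIntegrand n w s = laplaceDensity n s * Complex.exp (-(s : ℂ) * w) := by
  rw [laplaceIntegrand, laplaceDensity, stirlingRatio, Real.rpow_add hs, Real.rpow_natCast]
  push_cast
  ring

theorem aestronglyMeasurable_stirlingRatio :
    AEStronglyMeasurable (fun s => (stirlingRatio s : ℂ)) (volume.restrict (Set.Ioi 0)) := by
  refine ContinuousOn.aestronglyMeasurable ?_ measurableSet_Ioi
  refine Complex.continuous_ofReal.comp_continuousOn ?_
  intro s hs
  have hs' : 0 < s := hs
  refine ContinuousAt.continuousWithinAt ?_
  have h1 : ContinuousAt (fun s : ℝ => s ^ s) s :=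
    continuousAt_id.rpow continuousAt_id (Or.inl hs'.ne')
  have h2 : ContinuousAt (fun s : ℝ => Real.Gamma (s + 1)) s := by
    refine ContinuousAt.comp (f := fun s : ℝ => s + 1) (g := Real.Gamma) ?_ (by fun_prop)
    refine (Real.differentiableAt_Gamma fun m => ?_).continuousAt
    have : (0 : ℝ) ≤ m := m.cast_nonneg
    linarith
  exact ((by fun_prop : ContinuousAt (fun s : ℝ => Real.exp (-s)) s).mul h1).div h2
    (Real.Gamma_pos_of_pos (by linarith)).ne'

theorem aestronglyMeasurable_laplaceDensity (n : ℕ) :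
    AEStronglyMeasurable (laplaceDensity n) (volume.restrict (Set.Ioi 0)) :=
  (by fun_prop : Continuous fun s : ℝ => (s : ℂ) ^ n).aestronglyMeasurable.mul
    aestronglyMeasurable_stirlingRatio

theorem norm_laplaceDensity_le (n : ℕ) (s : ℝ) (hs : 0 < s) :
    ‖laplaceDensity n s‖ ≤ s ^ (n : ℝ) := by
  rw [laplaceDensity, norm_mul, norm_pow, Complex.norm_real, Complex.norm_real,
    Real.norm_of_nonneg hs.le, Real.norm_of_nonneg (stirlingRatio_nonneg hs), Real.rpow_natCast]
  exact mul_le_of_le_one_right (by positivity) (stirlingRatio_le_one hs)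

theorem neg_one_lt_natCast (n : ℕ) : (-1 : ℝ) < n := by
  have : (0 : ℝ) ≤ n := n.cast_nonneg
  linarith

theorem integrableOn_laplaceIntegrand (n : ℕ) {w : ℂ} (hw : 0 < w.re) :
    IntegrableOn (laplaceIntegrand n w) (Set.Ioi 0) := by
  refine (integrableOn_laplace (neg_one_lt_natCast n) (aestronglyMeasurable_laplaceDensity n)
    (norm_laplaceDensity_le n) hw).congr_fun (fun s hs => ?_) measurableSet_Ioi
  exact (laplaceIntegrand_eq n w hs).symm

/-- The Laplace transform of `s^{s+n} e^{-s} / Γ(s+1)`. -/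
def laplaceTransform (n : ℕ) (w : ℂ) : ℂ := ∫ s in Set.Ioi (0 : ℝ), laplaceIntegrand n w s

theorem laplaceTransform_eq (n : ℕ) (w : ℂ) : laplaceTransform n w =
    ∫ s in Set.Ioi (0 : ℝ), laplaceDensity n s * Complex.exp (-(s : ℂ) * w) :=
  setIntegral_congr_fun measurableSet_Ioi fun _ hs => laplaceIntegrand_eq n w hs

theorem hasDerivAt_laplaceTransform (n : ℕ) {w : ℂ} (hw : 0 < w.re) :
    HasDerivAt (laplaceTransform n) (-laplaceTransform (n + 1) w) w := by
  have h := hasDerivAt_laplace (neg_one_lt_natCast n) (aestronglyMeasurable_laplaceDensity n)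
    (norm_laplaceDensity_le n) hw
  have e : laplaceTransform n =
      fun w => ∫ s in Set.Ioi (0 : ℝ), laplaceDensity n s * Complex.exp (-(s : ℂ) * w) :=
    funext (laplaceTransform_eq n)
  rw [e, laplaceTransform_eq]
  refine h.congr_deriv ?_
  congr 2
  funext s
  rw [laplaceDensity, laplaceDensity]
  ring

/-- Insert the line integral for the density, exchange the integrals, and use ∫ s e^{-sz} ds = z⁻².
-/
theorem laplaceTransform_one {w : ℂ} (hw : 0 < w.re) :
    laplaceTransform 1 w = 1 / (2 * Real.pi) *
      ∫ y : ℝ, (1 + (y : ℂ) * Complex.I)⁻¹ / (w + linePhase y) ^ 2 := by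
  set F : ℝ → ℝ → ℂ := fun s y => (1 + (y : ℂ) * Complex.I)⁻¹ *
    (((s ^ (2 - 1 : ℝ) : ℝ) : ℂ) * Complex.exp (-(s : ℂ) * (w + linePhase y))) with hF
  have hre : ∀ y, 0 < (w + linePhase y).re := fun y => by
    rw [Complex.add_re]
    have := linePhase_re_nonneg y
    linarith
  have hnorm : ∀ s y : ℝ, 0 < s → ‖F s y‖ = (√(1 + y ^ 2))⁻¹ *
      (s ^ (2 - 1 : ℝ) * Real.exp (-((w + linePhase y).re * s))) := by
    intro s y hs
    rw [hF, norm_mul, norm_inv, norm_one_add_mul_I, norm_mul, norm_cexp_neg_ofReal_mul,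
      Complex.norm_real, Real.norm_of_nonneg (by positivity), neg_mul]
  have hmeas : AEStronglyMeasurable (Function.uncurry F)
      ((volume.restrict (Set.Ioi (0 : ℝ))).prod volume) := by
    refine Continuous.aestronglyMeasurable ?_
    have h1 : Continuous fun p : ℝ × ℝ => (1 + (p.2 : ℂ) * Complex.I)⁻¹ :=
      Continuous.inv₀ (by fun_prop) fun p => one_add_mul_I_ne_zero p.2
    have h2 : Continuous fun p : ℝ × ℝ => linePhase p.2 := continuous_linePhase.comp continuous_snd
    have h3 : Continuous fun p : ℝ × ℝ => ((p.1 ^ (2 - 1 : ℝ) : ℝ) : ℂ) := by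
      norm_num
      fun_prop
    exact h1.mul (h3.mul (by fun_prop))
  have hint : ∀ y, IntegrableOn (fun s => F s y) (Set.Ioi 0) := fun y =>
    (integrableOn_laplace (g := fun s : ℝ => ((s ^ (2 - 1 : ℝ) : ℝ) : ℂ)) (p := 2 - 1)
      (by norm_num) (aestronglyMeasurable_ofReal_rpow _) (fun s hs => by
        rw [Complex.norm_real, Real.norm_of_nonneg (by positivity)]) (hre y)).const_mul _
  have hprod : Integrable (Function.uncurry F)
      ((volume.restrict (Set.Ioi (0 : ℝ))).prod volume) := by
    rw [integrable_prod_iff' hmeas]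
    refine ⟨Eventually.of_forall hint, ?_⟩
    refine (integrable_inv_sqrt_mul_inv_sq hw).congr (Eventually.of_forall fun y => ?_)
    have h1 : ∫ s in Set.Ioi (0 : ℝ), ‖F s y‖ = ∫ s in Set.Ioi (0 : ℝ), (√(1 + y ^ 2))⁻¹ *
        (s ^ (2 - 1 : ℝ) * Real.exp (-((w + linePhase y).re * s))) :=
      setIntegral_congr_fun measurableSet_Ioi fun s hs => hnorm s y hs
    simp only [Function.uncurry]
    rw [h1, integral_const_mul, Real.integral_rpow_mul_exp_neg_mul_Ioi two_pos (hre y),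
      Real.Gamma_two, mul_one, Complex.add_re, linePhase_re]
    norm_num
  have hinner : ∀ y, ∫ s in Set.Ioi (0 : ℝ), F s y =
      (1 + (y : ℂ) * Complex.I)⁻¹ / (w + linePhase y) ^ 2 := by
    intro y
    simp only [hF]
    rw [integral_const_mul, integral_rpow_mul_cexp_neg_mul two_pos (hre y), Real.Gamma_two]
    have : (-((2 : ℝ) : ℂ)) = ((-2 : ℤ) : ℂ) := by norm_num
    rw [this, Complex.cpow_intCast]
    simp [div_eq_mul_inv, zpow_neg]
  have hswap := integral_integral_swap hprod
  simp only [hinner] at hswap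
  rw [← hswap, laplaceTransform_eq, ← integral_const_mul]
  refine setIntegral_congr_fun measurableSet_Ioi fun s hs => ?_
  rw [laplaceDensity, stirlingRatio_eq_integral hs, ← integral_const_mul, ← integral_const_mul,
    ← integral_const_mul, ← integral_mul_const]
  refine integral_congr_ae (Eventually.of_forall fun y => ?_)
  have e1 : (2 : ℝ) - 1 = 1 := by norm_num
  simp only [hF, e1, Real.rpow_one, pow_one, mul_add, Complex.exp_add]
  ring

/-- The line integral whose derivative is `-laplaceTransform 1`. -/
def lineIntegral (w : ℂ) : ℂ := 1 / (2 * Real.pi) *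
  ∫ y : ℝ, (1 + (y : ℂ) * Complex.I)⁻¹ / (w + linePhase y)

theorem hasDerivAt_lineIntegral {w : ℂ} (hw : 0 < w.re) :
    HasDerivAt lineIntegral (-laplaceTransform 1 w) w := by
  have hlow : ∀ y, w.re ≤ ‖w + linePhase y‖ := fun y => by
    refine le_trans ?_ (Complex.re_le_norm _)
    rw [Complex.add_re]
    have := linePhase_re_nonneg y
    linarith
  have hm1 : AEStronglyMeasurable (fun y : ℝ => (1 + (y : ℂ) * Complex.I)⁻¹) volume :=
    (by fun_prop : Continuous fun y : ℝ => 1 + (y : ℂ) * Complex.I).measurable.inv.aestronglyMeasurable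
  -- The parameter is recentred at w: the kernel w + ψ is bounded below by Re w, and the derivative
  -- is taken at parameter 0, rewritten as w - w.
  have h := hasDerivAt_integral_div_add (μ := volume) (k := fun y => w + linePhase y) hm1
    (continuous_const.add continuous_linePhase).aestronglyMeasurable
    (integrable_inv_div_add_linePhase le_rfl hw (Eventually.of_forall hlow)) hw
    (Eventually.of_forall hlow) (w := 0) (by simpa using hw)
  have h0 : w - w = 0 := sub_self w
  rw [← h0] at h
  have h2 := (h.comp_sub_const w w).const_mul (1 / (2 * Real.pi) : ℂ)
  simp only [sub_self, zero_add] at h2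
  rw [laplaceTransform_one hw]
  refine (h2.congr_deriv (by ring)).congr_of_eventuallyEq (Eventually.of_forall fun z => ?_)
  simp only [lineIntegral, ← add_assoc, sub_add_cancel]

/-- Both functions have derivative -`laplaceTransform 1` on the connected half-plane. The value of
the constant is never needed. -/
theorem exists_laplaceTransform_zero_eq : ∃ c, ∀ w : ℂ, 0 < w.re →
    laplaceTransform 0 w = lineIntegral w + c := by
  have hopen : IsOpen {w : ℂ | 0 < w.re} := isOpen_lt continuous_const Complex.continuous_re
  have hd : ∀ w ∈ {w : ℂ | 0 < w.re},
      HasDerivAt (fun w => laplaceTransform 0 w - lineIntegral w) 0 w := fun w hw =>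
    ((hasDerivAt_laplaceTransform 0 hw).sub (hasDerivAt_lineIntegral hw)).congr_deriv (sub_self _)
  obtain ⟨c, hc⟩ := hopen.exists_is_const_of_deriv_eq_zero
    (convex_halfSpace_re_gt 0).isPreconnected
    (fun w hw => (hd w hw).differentiableAt.differentiableWithinAt)
    (fun w hw => (hd w hw).deriv)
  exact ⟨c, fun w hw => by rw [← hc w hw]; ring⟩

/-! ### Cauchy's formula on a rectangle -/

theorem integral_div_affine {p q : ℂ} {a b : ℝ}
    (h : ∀ x ∈ Set.uIcc a b, p + x * q ∈ Complex.slitPlane) :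
    ∫ x in a..b, q / (p + x * q) = Complex.log (p + b * q) - Complex.log (p + a * q) := by
  refine intervalIntegral.integral_eq_sub_of_hasDerivAt
    (f := fun x : ℝ => Complex.log (p + x * q)) (fun x hx => ?_) ?_
  · have h1 : HasDerivAt (fun x : ℝ => p + (x : ℂ) * q) q x := by
      simpa using (((hasDerivAt_id x).ofReal_comp).mul_const q).const_add p
    exact h1.clog_real (h x hx)
  · refine ContinuousOn.intervalIntegrable fun x hx => ContinuousAt.continuousWithinAt ?_
    exact continuousAt_const.div (by fun_prop) (Complex.slitPlane_ne_zero (h x hx))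

theorem log_sub_log_neg_of_im_pos {z : ℂ} (hz : 0 < z.im) :
    Complex.log z - Complex.log (-z) = Real.pi * Complex.I := by
  rw [Complex.log, Complex.log, norm_neg, Complex.arg_neg_eq_arg_sub_pi_of_im_pos hz]
  push_cast
  ring

/-- Each side is integrated with a principal logarithm. On the left side log(u - z) replaces log(z -
u) to avoid the cut, and the two switches at its ends contribute πi each; all other values cancel at
the corners. -/
theorem rect_integral_inv_sub {u : ℂ} {δ : ℝ} (h0 : 0 < u.re) (h1 : u.re < δ) (h2 : |u.im| < δ) :
    (((∫ x in (0 : ℝ)..δ, (((x : ℂ) + ((-δ : ℝ) : ℂ) * Complex.I) - u)⁻¹) -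
      ∫ x in (0 : ℝ)..δ, (((x : ℂ) + (δ : ℂ) * Complex.I) - u)⁻¹) +
      Complex.I • ∫ y in (-δ)..δ, (((δ : ℂ) + (y : ℂ) * Complex.I) - u)⁻¹) -
      Complex.I • ∫ y in (-δ)..δ, ((((0 : ℝ) : ℂ) + (y : ℂ) * Complex.I) - u)⁻¹
      = 2 * Real.pi * Complex.I := by
  have h3 := abs_lt.1 h2
  have e1 := integral_div_affine (p := -δ * Complex.I - u) (q := 1) (a := 0) (b := δ)
    (fun x _ => Or.inr (by simp; linarith))
  have e2 := integral_div_affine (p := δ * Complex.I - u) (q := 1) (a := 0) (b := δ)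
    (fun x _ => Or.inr (by simp; linarith))
  have e3 := integral_div_affine (p := δ - u) (q := Complex.I) (a := -δ) (b := δ)
    (fun x _ => Or.inl (by simp; linarith))
  have e4 := integral_div_affine (p := u) (q := -Complex.I) (a := -δ) (b := δ)
    (fun x _ => Or.inl (by simp; linarith))
  have f1 : ∫ x in (0 : ℝ)..δ, (((x : ℂ) + ((-δ : ℝ) : ℂ) * Complex.I) - u)⁻¹ =
      ∫ x in (0 : ℝ)..δ, 1 / (-δ * Complex.I - u + x * 1) := by
    refine intervalIntegral.integral_congr fun x _ => ?_
    simp only [one_div]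
    push_cast
    congr 1
    ring
  have f2 : ∫ x in (0 : ℝ)..δ, (((x : ℂ) + (δ : ℂ) * Complex.I) - u)⁻¹ =
      ∫ x in (0 : ℝ)..δ, 1 / (δ * Complex.I - u + x * 1) := by
    refine intervalIntegral.integral_congr fun x _ => ?_
    simp only [one_div]
    congr 1
    ring
  have f3 : Complex.I • ∫ y in (-δ)..δ, (((δ : ℂ) + (y : ℂ) * Complex.I) - u)⁻¹ =
      ∫ y in (-δ)..δ, Complex.I / (δ - u + y * Complex.I) := by
    rw [← intervalIntegral.integral_smul]
    refine intervalIntegral.integral_congr fun x _ => ?_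
    simp only [smul_eq_mul, div_eq_mul_inv]
    congr 2
    ring
  have f4 : Complex.I • ∫ y in (-δ)..δ, ((((0 : ℝ) : ℂ) + (y : ℂ) * Complex.I) - u)⁻¹ =
      ∫ y in (-δ)..δ, -Complex.I / (u + y * -Complex.I) := by
    rw [← intervalIntegral.integral_smul]
    refine intervalIntegral.integral_congr fun x _ => ?_
    simp only [smul_eq_mul, div_eq_mul_inv, neg_mul, ← mul_neg, ← inv_neg]
    congr 2
    push_cast
    ring
  rw [f1, f2, f3, f4, e1, e2, e3, e4]
  have g1 := log_sub_log_neg_of_im_pos (z := u + δ * Complex.I) (by simp; linarith)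
  have g2 := log_sub_log_neg_of_im_pos (z := δ * Complex.I - u) (by simp; linarith)
  have a1 : -(δ : ℂ) * Complex.I - u + ((0 : ℝ) : ℂ) * 1 = -(u + δ * Complex.I) := by
    push_cast; ring
  have a2 : (δ : ℂ) * Complex.I - u + ((0 : ℝ) : ℂ) * 1 = δ * Complex.I - u := by push_cast; ring
  have a3 : (δ : ℂ) - u + ((-δ : ℝ) : ℂ) * Complex.I = -(δ : ℂ) * Complex.I - u + δ * 1 := by
    push_cast; ring
  have a4 : (δ : ℂ) * Complex.I - u + δ * 1 = (δ : ℂ) - u + δ * Complex.I := by ring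
  have a5 : u + (δ : ℂ) * -Complex.I = -(δ * Complex.I - u) := by ring
  have a6 : u + ((-δ : ℝ) : ℂ) * -Complex.I = u + δ * Complex.I := by push_cast; ring
  rw [a1, a2, a3, a4, a5, a6]
  linear_combination g1 + g2

/-- Splitting N(z)/(z-u) into the holomorphic slope of N at u plus N(u)/(z-u) reduces Cauchy's
formula to Cauchy's theorem and the integral of 1/(z-u). -/
theorem integral_div_sub_eq {N γ : ℂ → ℂ} {D : Set ℂ} {u : ℂ} (hD : IsOpen D)
    (hN : DifferentiableOn ℂ N D) (hu : u ∈ D) (hγ : Continuous γ) {a b : ℝ}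
    (h : ∀ x ∈ Set.uIcc a b, γ x ∈ D ∧ γ x ≠ u) :
    ∫ x in a..b, N (γ (x : ℝ)) / (γ x - u) =
      (∫ x in a..b, dslope N u (γ (x : ℝ))) + N u * ∫ x in a..b, (γ (x : ℝ) - u)⁻¹ := by
  have hd : DifferentiableOn ℂ (dslope N u) D :=
    (Complex.differentiableOn_dslope (hD.mem_nhds hu)).2 hN
  have hγ' : Continuous fun x : ℝ => γ x := hγ.comp Complex.continuous_ofReal
  rw [← intervalIntegral.integral_const_mul, ← intervalIntegral.integral_add]
  · refine intervalIntegral.integral_congr fun x hx => ?_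
    have h1 := sub_ne_zero.2 (h x hx).2
    have h2 := sub_smul_dslope N u (γ x)
    rw [smul_eq_mul] at h2
    field_simp
    linear_combination -h2
  · exact (hd.continuousOn.comp hγ'.continuousOn fun x hx => (h x hx).1).intervalIntegrable
  · refine ContinuousOn.intervalIntegrable fun x hx => ContinuousAt.continuousWithinAt ?_
    exact continuousAt_const.mul
      ((hγ'.continuousAt.sub continuousAt_const).inv₀ (sub_ne_zero.2 (h x hx).2))

theorem mem_rect {z : ℂ} {δ : ℝ} (hδ : 0 < δ) (h1 : 0 ≤ z.re) (h2 : z.re ≤ δ) (h3 : -δ ≤ z.im)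
    (h4 : z.im ≤ δ) : z ∈ Set.uIcc 0 δ ×ℂ Set.uIcc (-δ) δ := by
  rw [Complex.mem_reProdIm, Set.uIcc_of_le hδ.le, Set.uIcc_of_le (by linarith)]
  exact ⟨⟨h1, h2⟩, h3, h4⟩

theorem rect_integral_div_sub {N : ℂ → ℂ} {D : Set ℂ} {u : ℂ} {δ : ℝ} (hD : IsOpen D)
    (hN : DifferentiableOn ℂ N D) (hsub : Set.uIcc 0 δ ×ℂ Set.uIcc (-δ) δ ⊆ D)
    (h0 : 0 < u.re) (h1 : u.re < δ) (h2 : |u.im| < δ) :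
    (((∫ x in (0 : ℝ)..δ, N ((x : ℂ) + ((-δ : ℝ) : ℂ) * Complex.I) /
        ((x : ℂ) + ((-δ : ℝ) : ℂ) * Complex.I - u)) -
      ∫ x in (0 : ℝ)..δ, N ((x : ℂ) + (δ : ℂ) * Complex.I) /
        ((x : ℂ) + (δ : ℂ) * Complex.I - u)) +
      Complex.I • ∫ y in (-δ)..δ, N ((δ : ℂ) + (y : ℂ) * Complex.I) /
        ((δ : ℂ) + (y : ℂ) * Complex.I - u)) -
      Complex.I • ∫ y in (-δ)..δ, N (((0 : ℝ) : ℂ) + (y : ℂ) * Complex.I) /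
        (((0 : ℝ) : ℂ) + (y : ℂ) * Complex.I - u)
      = 2 * Real.pi * Complex.I * N u := by
  have hδ : 0 < δ := h0.trans h1
  have h3 := abs_lt.1 h2
  have hu : u ∈ D := hsub (mem_rect hδ h0.le h1.le h3.1.le h3.2.le)
  have hd : DifferentiableOn ℂ (dslope N u) D :=
    (Complex.differentiableOn_dslope (hD.mem_nhds hu)).2 hN
  have hc := Complex.integral_boundary_rect_eq_zero_of_differentiableOn (dslope N u)
    ⟨0, -δ⟩ ⟨δ, δ⟩ (hd.mono hsub)
  simp only at hc
  have hl := rect_integral_inv_sub h0 h1 h2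
  have r1 : ∀ x ∈ Set.uIcc 0 δ, 0 ≤ x ∧ x ≤ δ := fun x hx => by
    rwa [Set.uIcc_of_le hδ.le] at hx
  have r2 : ∀ x ∈ Set.uIcc (-δ) δ, -δ ≤ x ∧ x ≤ δ := fun x hx => by
    rwa [Set.uIcc_of_le (by linarith)] at hx
  rw [integral_div_sub_eq (γ := fun z => z + ((-δ : ℝ) : ℂ) * Complex.I) hD hN hu (by fun_prop)
      fun x hx => ⟨hsub (mem_rect hδ (by simpa using (r1 x hx).1) (by simpa using (r1 x hx).2)
        (by simp) (by simp; linarith)),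
        fun h => by have := congrArg Complex.im h; simp at this; linarith⟩,
    integral_div_sub_eq (γ := fun z => z + (δ : ℂ) * Complex.I) hD hN hu (by fun_prop)
      fun x hx => ⟨hsub (mem_rect hδ (by simpa using (r1 x hx).1) (by simpa using (r1 x hx).2)
        (by simp; linarith) (by simp)),
        fun h => by have := congrArg Complex.im h; simp at this; linarith⟩,
    integral_div_sub_eq (γ := fun z => (δ : ℂ) + z * Complex.I) hD hN hu (by fun_prop)
      fun x hx => ⟨hsub (mem_rect hδ (by simpa using hδ.le) (by simp)
        (by simpa using (r2 x hx).1) (by simpa using (r2 x hx).2)),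
        fun h => by have := congrArg Complex.re h; simp at this; linarith⟩,
    integral_div_sub_eq (γ := fun z => ((0 : ℝ) : ℂ) + z * Complex.I) hD hN hu (by fun_prop)
      fun x hx => ⟨hsub (mem_rect hδ (by simp) (by simpa using hδ.le)
        (by simpa using (r2 x hx).1) (by simpa using (r2 x hx).2)),
        fun h => by have := congrArg Complex.re h; simp at this; linarith⟩]
  simp only [smul_eq_mul] at hc hl ⊢
  linear_combination hc + N u * hl

/-! ### The principal square root on the right half plane -/

theorem sq_cpow_half (z : ℂ) : (z ^ (1 / 2 : ℂ)) ^ 2 = z := by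
  rw [← Complex.cpow_nat_mul]
  simp

theorem cpow_half_re_pos {z : ℂ} (hz : 0 < z.re) : 0 < (z ^ (1 / 2 : ℂ)).re := by
  rw [one_div, Complex.cpow_inv_two_re]
  have := norm_nonneg z
  exact Real.sqrt_pos.2 (by linarith)

theorem tendsto_cpow_half : Tendsto (fun w : ℂ => (2 * w) ^ (1 / 2 : ℂ)) (𝓝 0) (𝓝 0) := by
  rw [tendsto_zero_iff_norm_tendsto_zero]
  have h1 : ∀ w : ℂ, ‖(2 * w) ^ (1 / 2 : ℂ)‖ = √(2 * ‖w‖) := fun w => by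
    symm
    rw [Real.sqrt_eq_iff_eq_sq (by positivity) (norm_nonneg _), ← norm_pow, sq_cpow_half]
    simp
  simp only [h1]
  have : Continuous fun w : ℂ => √(2 * ‖w‖) := by fun_prop
  simpa using this.tendsto 0

/-! ### Deformation of the line integral -/

/-- The integration line is the imaginary axis u = -iy, and the saddle y = 0 is the point t = ∞. -/
theorem linePhase_eq (y : ℝ) : linePhase y = -wCoord (-(y * Complex.I))⁻¹ := by
  rw [wCoord_inv, linePhase]
  ring_nf

theorem continuousOn_wCoord_inv {s : Set ℂ} (hs : ∀ u ∈ s, 1 - u ∈ Complex.slitPlane) :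
    ContinuousOn (fun u : ℂ => wCoord u⁻¹) s := fun u hu =>
  (hasDerivAt_wCoord_inv (hs u hu)).continuousAt.continuousWithinAt

theorem analyticAt_intervalIntegral_wCoord {γ : ℝ → ℂ} (hγ : Continuous γ) {a b : ℝ}
    (hab : a ≤ b) (h : ∀ x ∈ Set.Icc a b, 1 - γ x ∈ Complex.slitPlane ∧ wCoord (γ x)⁻¹ ≠ 0) :
    AnalyticAt ℂ (fun w => ∫ x in a..b, (1 - γ x)⁻¹ / (w - wCoord (γ x)⁻¹)) 0 := by
  have hk : ContinuousOn (fun x => -wCoord (γ x)⁻¹) (Set.Icc a b) :=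
    (ContinuousOn.comp (continuousOn_wCoord_inv (s := γ '' Set.Icc a b) (by
      rintro _ ⟨x, hx, rfl⟩; exact (h x hx).1)) hγ.continuousOn (Set.mapsTo_image _ _)).neg
  have hg : ContinuousOn (fun x => (1 - γ x)⁻¹) (Set.Icc a b) :=
    (by fun_prop : ContinuousOn (fun x => 1 - γ x) (Set.Icc a b)).inv₀
      fun x hx => Complex.slitPlane_ne_zero (h x hx).1
  have hk0 : ∀ x ∈ Set.Icc a b, -wCoord (γ x)⁻¹ ≠ 0 := fun x hx => neg_ne_zero.2 (h x hx).2
  obtain ⟨x₀, hx₀, hmin⟩ := isCompact_Icc.exists_isMinOn (Set.nonempty_Icc.2 hab) hk.norm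
  have hc : 0 < ‖-wCoord (γ x₀)⁻¹‖ := norm_pos_iff.2 (hk0 x₀ hx₀)
  have := analyticAt_integral_div_add (μ := volume.restrict (Set.Icc a b))
    (hg.aestronglyMeasurable measurableSet_Icc) (hk.aestronglyMeasurable measurableSet_Icc)
    ((hg.div hk hk0).integrableOn_Icc) hc
    ((ae_restrict_iff' measurableSet_Icc).2 (Eventually.of_forall fun x hx => hmin hx))
  refine this.congr (Eventually.of_forall fun w => ?_)
  simp only [← sub_eq_add_neg]
  rw [intervalIntegral.integral_of_le hab, integral_Icc_eq_integral_Ioc]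

/-- Away from the saddle Re ψ(y) ≥ log(1+δ²)/2 > 0, so the denominator stays bounded away from zero
for small w. -/
theorem analyticAt_tail {δ : ℝ} (hδ : 0 < δ) :
    AnalyticAt ℂ (fun w => ∫ y in (Set.Ioc (-δ) δ)ᶜ,
      (1 + (y : ℂ) * Complex.I)⁻¹ / (w + linePhase y)) 0 := by
  set c := Real.log (1 + δ ^ 2) / 2 with hc
  have hc0 : 0 < c := by
    have := Real.log_pos (x := 1 + δ ^ 2) (by nlinarith)
    positivity
  have hlow : ∀ᵐ y ∂volume.restrict (Set.Ioc (-δ) δ)ᶜ, c ≤ ‖linePhase y‖ := by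
    refine (ae_restrict_iff' measurableSet_Ioc.compl).2 (Eventually.of_forall fun y hy => ?_)
    have h1 : δ ^ 2 ≤ y ^ 2 := by
      simp only [Set.mem_compl_iff, Set.mem_Ioc, not_and, not_le] at hy
      rcases lt_or_ge (-δ) y with h | h
      · have := hy h
        nlinarith
      · nlinarith
    refine le_trans ?_ (Complex.re_le_norm _)
    rw [linePhase_re, hc]
    have := Real.log_le_log (x := 1 + δ ^ 2) (y := 1 + y ^ 2) (by positivity) (by linarith)
    linarith
  have hm1 : Measurable fun y : ℝ => (1 + (y : ℂ) * Complex.I)⁻¹ :=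
    (by fun_prop : Continuous fun y : ℝ => 1 + (y : ℂ) * Complex.I).measurable.inv
  have hi := integrable_inv_div_add_linePhase (μ := volume.restrict (Set.Ioc (-δ) δ)ᶜ) (k := 0)
    Measure.restrict_le_self hc0 (by simpa using hlow)
  simp only [zero_add] at hi
  exact analyticAt_integral_div_add hm1.aestronglyMeasurable
    continuous_linePhase.aestronglyMeasurable hi hc0 hlow

/-- The part of the line integral away from the saddle point, together with the integrals over
the remaining sides of the rectangle. -/
def lineRemainder (δ : ℝ) (w : ℂ) : ℂ :=
  1 / (2 * Real.pi) * (∫ y in (Set.Ioc (-δ) δ)ᶜ,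
    (1 + (y : ℂ) * Complex.I)⁻¹ / (w + linePhase y)) +
  -Complex.I / (2 * Real.pi) * (((∫ x in (0 : ℝ)..δ, (1 - ((x : ℂ) + ((-δ : ℝ) : ℂ) * Complex.I))⁻¹ /
      (w - wCoord ((x : ℂ) + ((-δ : ℝ) : ℂ) * Complex.I)⁻¹)) -
    ∫ x in (0 : ℝ)..δ, (1 - ((x : ℂ) + (δ : ℂ) * Complex.I))⁻¹ /
      (w - wCoord ((x : ℂ) + (δ : ℂ) * Complex.I)⁻¹)) +
    Complex.I • ∫ y in (-δ)..δ, (1 - ((δ : ℂ) + (y : ℂ) * Complex.I))⁻¹ /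
      (w - wCoord ((δ : ℂ) + (y : ℂ) * Complex.I)⁻¹))

/-- The segment |y| ≤ δ is the left side of the rectangle. In the variable z the integrand is
(1-z)⁻¹/(w - W(z)), W(z) = w(1/z), with its only pole at u; since W'(u) = u/(1-u), the residue is
-u⁻¹. -/
theorem lineIntegral_eq_of_pole {δ : ℝ} {w u : ℂ} {D : Set ℂ} (hw : 0 < w.re) (hD : IsOpen D)
    (hsub : Set.uIcc 0 δ ×ℂ Set.uIcc (-δ) δ ⊆ D) (hslit : ∀ z ∈ D, 1 - z ∈ Complex.slitPlane)
    (h0 : 0 < u.re) (h1 : u.re < δ) (h2 : |u.im| < δ) (huw : wCoord u⁻¹ = w)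
    (huniq : ∀ z ∈ Set.uIcc 0 δ ×ℂ Set.uIcc (-δ) δ, wCoord z⁻¹ = w → z = u) :
    lineIntegral w = u⁻¹ + lineRemainder δ w := by
  have hδ : 0 < δ := h0.trans h1
  have h3 := abs_lt.1 h2
  have hu0 : u ≠ 0 := fun h => by simp [h] at h0
  have huD : u ∈ D := hsub (mem_rect hδ h0.le h1.le h3.1.le h3.2.le)
  set W : ℂ → ℂ := fun z => wCoord z⁻¹ with hW
  have hWd : DifferentiableOn ℂ W D := fun z hz =>
    (hasDerivAt_wCoord_inv (hslit z hz)).differentiableAt.differentiableWithinAt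
  have hSd : DifferentiableOn ℂ (dslope W u) D :=
    (Complex.differentiableOn_dslope (hD.mem_nhds huD)).2 hWd
  have hSu : dslope W u u = u / (1 - u) := by
    rw [dslope_same, (hasDerivAt_wCoord_inv (hslit u huD)).deriv]
  have hS : ∀ z, w - W z = -((z - u) * dslope W u z) := fun z => by
    have := sub_smul_dslope W u z
    rw [smul_eq_mul] at this
    rw [this, hW]
    simp only [huw]
    ring
  have hSne : ∀ z ∈ Set.uIcc 0 δ ×ℂ Set.uIcc (-δ) δ, dslope W u z ≠ 0 := by
    intro z hz hz0
    have h4 := hS z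
    rw [hz0, mul_zero, neg_zero] at h4
    have h5 := huniq z hz (sub_eq_zero.1 h4).symm
    rw [h5, hSu] at hz0
    exact div_ne_zero hu0 (Complex.slitPlane_ne_zero (hslit u huD)) hz0
  set D' : Set ℂ := {z | z ∈ D ∧ dslope W u z ≠ 0} with hD'
  have hD'o : IsOpen D' := hSd.continuousOn.isOpen_inter_preimage hD isOpen_ne
  set N : ℂ → ℂ := fun z => (1 - z)⁻¹ / -(dslope W u z) with hN
  have hNd : DifferentiableOn ℂ N D' := by
    refine DifferentiableOn.div ?_ (hSd.mono fun z hz => hz.1).neg fun z hz => neg_ne_zero.2 hz.2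
    exact DifferentiableOn.inv (by fun_prop) fun z hz => Complex.slitPlane_ne_zero (hslit z hz.1)
  have hNu : N u = -u⁻¹ := by
    have := Complex.slitPlane_ne_zero (hslit u huD)
    simp only [hN, hSu]
    field_simp
  have hG : ∀ z, N z / (z - u) = (1 - z)⁻¹ / (w - wCoord z⁻¹) := fun z => by
    change _ = (1 - z)⁻¹ / (w - W z)
    rw [hS, hN]
    simp only [div_div]
    congr 1
    ring
  have hc := rect_integral_div_sub hD'o hNd (fun z hz => ⟨hsub hz, hSne z hz⟩) h0 h1 h2
  simp only [hG, hNu] at hc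
  have hlow : ∀ y, w.re ≤ ‖w + linePhase y‖ := fun y => by
    refine le_trans ?_ (Complex.re_le_norm _)
    rw [Complex.add_re]
    have := linePhase_re_nonneg y
    linarith
  have hint := integrable_inv_div_add_linePhase (μ := volume) le_rfl hw (Eventually.of_forall hlow)
  have hsplit := integral_add_compl (measurableSet_Ioc (a := -δ) (b := δ)) hint
  have hleft : ∫ y in Set.Ioc (-δ) δ, (1 + (y : ℂ) * Complex.I)⁻¹ / (w + linePhase y) =
      ∫ y in (-δ)..δ, (1 - (((0 : ℝ) : ℂ) + (y : ℂ) * Complex.I))⁻¹ /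
        (w - wCoord (((0 : ℝ) : ℂ) + (y : ℂ) * Complex.I)⁻¹) := by
    have h4 := intervalIntegral.integral_comp_neg (a := -δ) (b := δ)
      (fun y : ℝ => (1 - (((0 : ℝ) : ℂ) + (y : ℂ) * Complex.I))⁻¹ /
        (w - wCoord (((0 : ℝ) : ℂ) + (y : ℂ) * Complex.I)⁻¹))
    rw [neg_neg] at h4
    rw [← h4, intervalIntegral.integral_of_le (by linarith)]
    refine setIntegral_congr_fun measurableSet_Ioc fun y _ => ?_
    simp only [linePhase_eq]
    push_cast
    ring_nf
  have hpi : (Real.pi : ℂ) ≠ 0 := by exact_mod_cast Real.pi_ne_zero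
  rw [lineIntegral, lineRemainder, ← hsplit, hleft]
  simp only [smul_eq_mul] at hc ⊢
  generalize (∫ y in (-δ)..δ, (1 - (((0 : ℝ) : ℂ) + (y : ℂ) * Complex.I))⁻¹ /
        (w - wCoord (((0 : ℝ) : ℂ) + (y : ℂ) * Complex.I)⁻¹)) = J at hc ⊢
  generalize (∫ y in (-δ)..δ, (1 - ((δ : ℂ) + (y : ℂ) * Complex.I))⁻¹ /
      (w - wCoord ((δ : ℂ) + (y : ℂ) * Complex.I)⁻¹)) = J1 at hc ⊢
  generalize (∫ x in (0 : ℝ)..δ, (1 - ((x : ℂ) + (δ : ℂ) * Complex.I))⁻¹ /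
      (w - wCoord ((x : ℂ) + (δ : ℂ) * Complex.I)⁻¹)) = J2 at hc ⊢
  generalize (∫ x in (0 : ℝ)..δ, (1 - ((x : ℂ) + ((-δ : ℝ) : ℂ) * Complex.I))⁻¹ /
      (w - wCoord ((x : ℂ) + ((-δ : ℝ) : ℂ) * Complex.I)⁻¹)) = J3 at hc ⊢
  generalize (∫ y in (Set.Ioc (-δ) δ)ᶜ, (1 + (y : ℂ) * Complex.I)⁻¹ / (w + linePhase y)) = T
  have hJ : J = -Complex.I * (J3 - J2 + Complex.I * J1) + 2 * Real.pi * u⁻¹ := by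
    linear_combination Complex.I * hc + (J - 2 * Real.pi * u⁻¹) * Complex.I_sq
  rw [hJ]
  field_simp
  ring

/-- The equation W(z) = w has the two small roots I(±√(2w)), and for Re w > 0 only the one with the
plus sign has positive real part. The other three sides avoid z = 0, the only zero of W, so their
integrals are holomorphic at w = 0. -/
theorem IsLocalCoord.exists_lineIntegral_eq {V I : ℂ → ℂ} (h : IsLocalCoord V I) :
    ∃ R : ℂ → ℂ, AnalyticAt ℂ R 0 ∧ ∀ᶠ w in 𝓝 (0 : ℂ), 0 < w.re →
      lineIntegral w = (I ((2 * w) ^ (1 / 2 : ℂ)))⁻¹ + R w := by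
  obtain ⟨r, hr, hball⟩ := Metric.eventually_nhds_iff.1
    (eventually_one_sub_mem_slitPlane.and (h.sq_eq.and h.left_inv))
  set δ := r / 2 with hδdef
  have hδ : 0 < δ := by positivity
  have hrect : Set.uIcc 0 δ ×ℂ Set.uIcc (-δ) δ ⊆ Metric.ball 0 r := by
    intro z hz
    rw [Complex.mem_reProdIm, Set.uIcc_of_le hδ.le, Set.uIcc_of_le (by linarith)] at hz
    obtain ⟨⟨h1, h2⟩, h3, h4⟩ := hz
    rw [mem_ball_zero_iff, ← sq_lt_sq₀ (norm_nonneg _) hr.le, Complex.sq_norm,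
      Complex.normSq_apply]
    nlinarith
  have hW0 : ∀ z ∈ Metric.ball (0 : ℂ) r, z ≠ 0 → wCoord z⁻¹ ≠ 0 := by
    intro z hz hz0 hw
    obtain ⟨-, h2, h3⟩ := hball hz
    rw [hw, mul_zero] at h2
    rw [pow_eq_zero_iff two_ne_zero] at h2
    rw [h2, h.inv_zero] at h3
    exact hz0 h3.symm
  have hedge : ∀ z ∈ Set.uIcc 0 δ ×ℂ Set.uIcc (-δ) δ, z ≠ 0 →
      1 - z ∈ Complex.slitPlane ∧ wCoord z⁻¹ ≠ 0 := fun z hz hz0 =>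
    ⟨(hball (hrect hz)).1, hW0 z (hrect hz) hz0⟩
  refine ⟨lineRemainder δ, ?_, ?_⟩
  · have a1 := analyticAt_intervalIntegral_wCoord
      (γ := fun x : ℝ => (x : ℂ) + ((-δ : ℝ) : ℂ) * Complex.I) (by fun_prop) hδ.le
      fun x hx => hedge _ (mem_rect hδ (by simpa using hx.1) (by simpa using hx.2)
        (by simp) (by simp; linarith))
        fun h0 => by have := congrArg Complex.im h0; simp at this; linarith
    have a2 := analyticAt_intervalIntegral_wCoord
      (γ := fun x : ℝ => (x : ℂ) + (δ : ℂ) * Complex.I) (by fun_prop) hδ.le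
      fun x hx => hedge _ (mem_rect hδ (by simpa using hx.1) (by simpa using hx.2)
        (by simp; linarith) (by simp))
        fun h0 => by have := congrArg Complex.im h0; simp at this; linarith
    have a3 := analyticAt_intervalIntegral_wCoord (a := -δ) (b := δ)
      (γ := fun y : ℝ => (δ : ℂ) + (y : ℂ) * Complex.I) (by fun_prop) (by linarith)
      fun x hx => hedge _ (mem_rect hδ (by simpa using hδ.le) (by simp)
        (by simpa using hx.1) (by simpa using hx.2))
        fun h0 => by have := congrArg Complex.re h0; simp at this; linarith
    exact (analyticAt_const.mul (analyticAt_tail hδ)).add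
      (analyticAt_const.mul ((a1.sub a2).add (a3.const_smul (c := Complex.I))))
  · have hneg : Tendsto (fun w : ℂ => -(2 * w) ^ (1 / 2 : ℂ)) (𝓝 0) (𝓝 0) := by
      simpa using tendsto_cpow_half.neg
    have hlin : ∀ᶠ x in 𝓝 (0 : ℂ), ‖I x - x‖ ≤ 1 / 2 * ‖x‖ := by
      have := (hasDerivAt_iff_isLittleO.1 h.hasDerivAt_inv).def (c := 1 / 2) (by norm_num)
      simpa [h.inv_zero] using this
    have hsmall : ∀ᶠ x in 𝓝 (0 : ℂ), ‖I x‖ < δ := by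
      simpa using h.tendsto_inv.eventually (Metric.ball_mem_nhds 0 hδ)
    filter_upwards [tendsto_cpow_half.eventually h.wCoord_inv_inv, tendsto_cpow_half.eventually hlin,
      hneg.eventually hlin, tendsto_cpow_half.eventually hsmall] with w h1 h2 h3 h4 hw
    set v := (2 * w) ^ (1 / 2 : ℂ) with hv
    have hvsq : v ^ 2 = 2 * w := sq_cpow_half _
    have hvre : 0 < v.re := cpow_half_re_pos (by simpa using hw)
    -- Since Re v² > 0 and Re v > 0, |Im v| < Re v. The error |I(±v) ∓ v| ≤ |v|/2 is then below Re v
    -- and cannot change the sign of the real part.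
    have hvn : ‖v‖ < 2 * v.re := by
      have e1 := congrArg Complex.re hvsq
      simp [sq] at e1
      have e2 := Complex.sq_norm v
      rw [Complex.normSq_apply] at e2
      refine lt_of_pow_lt_pow_left₀ 2 (by linarith) ?_
      nlinarith
    have hre1 : 0 < (I v).re := by
      have := (Complex.abs_re_le_norm _).trans h2
      rw [Complex.sub_re] at this
      have := (abs_le.1 this).1
      linarith
    have hre2 : (I (-v)).re < 0 := by
      have := (Complex.abs_re_le_norm _).trans h3
      rw [Complex.sub_re, norm_neg, Complex.neg_re] at this
      have := (abs_le.1 this).2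
      linarith
    refine lineIntegral_eq_of_pole hw Metric.isOpen_ball hrect (fun z hz => (hball hz).1) hre1
      ((Complex.re_le_norm _).trans_lt h4) ((Complex.abs_im_le_norm _).trans_lt h4) ?_ ?_
    · rw [h1, hvsq]; ring
    · intro z hz hzw
      obtain ⟨-, h5, h6⟩ := hball (hrect hz)
      rw [hzw, ← hvsq] at h5
      rcases sq_eq_sq_iff_eq_or_eq_neg.1 h5 with h7 | h7
      · rw [← h6, h7]
      · rw [h7] at h6
        rw [Complex.mem_reProdIm, Set.uIcc_of_le hδ.le] at hz
        have := hz.1.1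
        rw [← h6] at this
        linarith

/-! ### Laplace transforms modulo holomorphic functions of w -/

theorem hasDerivAt_two_mul_cpow_half {w : ℂ} (hw : 0 < w.re) :
    HasDerivAt (fun w : ℂ => (2 * w) ^ (1 / 2 : ℂ)) ((2 * w) ^ (1 / 2 : ℂ))⁻¹ w := by
  have h0 : 2 * w ∈ Complex.slitPlane := Or.inl (by simpa using hw)
  have h := ((hasDerivAt_id w).const_mul 2).cpow_const (c := 1 / 2) h0
  refine h.congr_deriv ?_
  have e : (1 / 2 : ℂ) - 1 = -(1 / 2) := by norm_num
  simp only [id, e, Complex.cpow_neg]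
  ring

theorem two_mul_cpow_half_ne_zero {w : ℂ} (hw : 0 < w.re) : (2 * w) ^ (1 / 2 : ℂ) ≠ 0 := by
  have := cpow_half_re_pos (z := 2 * w) (by simpa using hw)
  intro h
  rw [h] at this
  simp at this

/-- For n = 0 the pole contributes t = ξ̂_0 + 1, whose even part is holomorphic in w. The induction
applies -d/dw, which raises n for the transform and, through dv/dw = 1/v, for the odd part. -/
theorem IsLaurentSplitting.exists_laplaceTransform_eq {V I : ℂ → ℂ} {α : ℕ → ℂ}
    {A e : ℕ → ℂ → ℂ} (hs : IsLaurentSplitting I α A e) (hl : IsLocalCoord V I) (n : ℕ) :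
    ∃ h : ℂ → ℂ, AnalyticAt ℂ h 0 ∧ ∀ᶠ w in 𝓝 (0 : ℂ), 0 < w.re →
      laplaceTransform n w = ((2 * w) ^ (1 / 2 : ℂ)) ^ (1 - 2 * ((n + 1 : ℕ) : ℤ)) *
        A (n + 1) (((2 * w) ^ (1 / 2 : ℂ)) ^ 2) + h w := by
  induction n with
  | zero =>
    obtain ⟨R, hR, hRe⟩ := hl.exists_lineIntegral_eq
    obtain ⟨c, hc⟩ := exists_laplaceTransform_zero_eq
    refine ⟨fun w => e 1 w + 1 + R w + c,
      (((hs.analyticAt 1).add analyticAt_const).add hR).add analyticAt_const, ?_⟩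
    filter_upwards [hRe, tendsto_cpow_half.eventually (eventually_nhdsWithin_iff.1 (hs.eq 1))]
      with w h1 h2 hw
    have h3 := h2 (two_mul_cpow_half_ne_zero hw)
    have h4 : ((2 * w) ^ (1 / 2 : ℂ)) ^ 2 / 2 = w := by rw [sq_cpow_half]; ring
    have h5 : xiHat (((1 : ℕ) : ℤ) - 1) (I ((2 * w) ^ (1 / 2 : ℂ)))⁻¹ =
        (I ((2 * w) ^ (1 / 2 : ℂ)))⁻¹ - 1 := by
      change (xiPoly 0).eval _ = _
      simp [xiPoly]
    rw [h5, h4] at h3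
    rw [hc w hw, h1 hw]
    linear_combination h3
  | succ n ih =>
    obtain ⟨h, hh, he⟩ := ih
    refine ⟨fun w => -deriv h w, hh.deriv.neg, ?_⟩
    have hA : ∀ᶠ z in 𝓝 (0 : ℂ), DifferentiableAt ℂ (A (n + 1)) z :=
      (hs.hasTaylor (n + 1)).analyticAt.eventually_analyticAt.mono fun z hz =>
        hz.differentiableAt
    filter_upwards [he.eventually_nhds, hh.eventually_analyticAt,
      (tendsto_sq_nhds_zero.comp tendsto_cpow_half).eventually hA] with w h1 h2 h3 hw
    have hv := two_mul_cpow_half_ne_zero hw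
    have d1 := (hasDerivAt_zpow_mul_comp_sq (n + 1) hv h3).comp w (hasDerivAt_two_mul_cpow_half hw)
    have d2 := d1.add h2.differentiableAt.hasDerivAt
    have hpos : ∀ᶠ z in 𝓝 w, 0 < z.re :=
      Complex.continuous_re.continuousAt.eventually (lt_mem_nhds hw)
    have d3 := d2.congr_of_eventuallyEq (f₁ := laplaceTransform n) (by
      filter_upwards [h1, hpos] with z hz hz'
      exact hz hz')
    have d4 := (hasDerivAt_laplaceTransform n hw).unique d3
    rw [hs.succ (n + 1)]
    have hc := mul_inv_cancel₀ hv
    push_cast at d4 hc ⊢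
    linear_combination -d4 + ((((2 * w) ^ (1 / 2 : ℂ)) ^ (1 - 2 * ((n : ℤ) + 1 + 1)) *
      ((2 * ((n : ℂ) + 1) - 1) * A (n + 1) (((2 * w) ^ (1 / 2 : ℂ)) ^ 2) -
        2 * (((2 * w) ^ (1 / 2 : ℂ)) ^ 2 *
          deriv (A (n + 1)) (((2 * w) ^ (1 / 2 : ℂ)) ^ 2))))) * hc

/-! ### Watson's lemma and identification of the coefficients -/

/-- A bound O(x^{n+1/2}) along positive reals excludes a leading term b_n x^n. The half power arises
as |v|^{2n+1} = x^n √x for v² = x. -/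
theorem HasTaylor.eq_zero_of_le {f : ℂ → ℂ} {b : ℕ → ℂ} (h : HasTaylor f b) {n : ℕ}
    (hn : ∀ k < n, b k = 0) {C : ℝ}
    (hC : ∀ᶠ x : ℝ in 𝓝[>] 0, ‖f x‖ ≤ C * (x ^ n * √x)) : b n = 0 := by
  have h1 : HasTaylor (fun z => f z - b n * z ^ n) fun k => b k - b n * if k = n then 1 else 0 :=
    h.sub ((HasTaylor.pow n).const_mul (b n))
  have h2 := h1.isBigO_pow (n := n + 1) (fun k hk => by
    rcases Nat.lt_succ_iff_lt_or_eq.1 hk with h' | h'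
    · simp [hn k h', h'.ne]
    · simp [h'])
  obtain ⟨D, hD⟩ := h2.bound
  have hx : Tendsto (fun x : ℝ => (x : ℂ)) (𝓝[>] 0) (𝓝 0) := by
    have : Tendsto (fun x : ℝ => (x : ℂ)) (𝓝 0) (𝓝 ((0 : ℝ) : ℂ)) :=
      Complex.continuous_ofReal.continuousAt
    exact (by simpa using this : Tendsto _ _ _).mono_left nhdsWithin_le_nhds
  have h3 : ∀ᶠ x in 𝓝[>] (0 : ℝ), ‖b n‖ ≤ C * √x + D * x := by
    filter_upwards [hC, hx.eventually hD, self_mem_nhdsWithin] with x h4 h5 (h6 : 0 < x)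
    have h7 : ‖b n * (x : ℂ) ^ n‖ ≤ ‖f x‖ + ‖f x - b n * (x : ℂ) ^ n‖ := by
      have := norm_sub_le (f x) (f x - b n * (x : ℂ) ^ n)
      simpa using this
    simp only [norm_mul, norm_pow, Complex.norm_real, Real.norm_eq_abs, abs_of_pos h6] at h5 h7
    have hp : 0 < x ^ n := by positivity
    rw [pow_succ] at h5
    refine le_of_mul_le_mul_right ?_ hp
    linarith
  have h8 : Tendsto (fun x : ℝ => C * √x + D * x) (𝓝[>] 0) (𝓝 0) := by
    have : Continuous (fun x : ℝ => C * √x + D * x) := by fun_prop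
    have := this.tendsto 0
    simp only [Real.sqrt_zero, mul_zero, add_zero] at this
    exact this.mono_left nhdsWithin_le_nhds
  exact norm_le_zero_iff.1 (ge_of_tendsto h8 h3)

/-- The source of the double factorials: Γ(m+1/2) = (2m-1)!! √π / 2^m, so s^{m-1/2}/√(2π) has
Laplace transform (2m-1)!! / v^{2m+1}. -/
theorem inv_sqrt_two_pi_mul_Gamma_mul_cpow (m : ℕ) {w : ℂ} (hw : 0 < w.re) :
    (((√(2 * Real.pi))⁻¹ : ℝ) : ℂ) * (Real.Gamma (m + 1 / 2) * w ^ (-((m : ℂ) + 1 / 2))) =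
      (oddDoubleFactorial m : ℂ) * (((2 * w) ^ (1 / 2 : ℂ)) ^ (2 * m + 1))⁻¹ := by
  have h2 : (√2 : ℝ) ^ 2 = 2 := Real.sq_sqrt (by norm_num)
  have hv : (2 * w) ^ (1 / 2 : ℂ) = (√2 : ℝ) * w ^ (1 / 2 : ℂ) := by
    symm
    apply eq_cpow_half_of_sq_eq
    · rw [Complex.re_ofReal_mul]
      exact mul_pos (by positivity) (cpow_half_re_pos hw)
    · rw [mul_pow, sq_cpow_half, ← Complex.ofReal_pow, h2]
      norm_num
  have hw' : w ^ (-((m : ℂ) + 1 / 2)) = ((w ^ (1 / 2 : ℂ)) ^ (2 * m + 1))⁻¹ := by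
    rw [Complex.cpow_neg, ← Complex.cpow_nat_mul]
    congr 2
    push_cast
    ring
  have hd : (oddDoubleFactorial m : ℂ) = ((2 * m - 1)‼ : ℕ) := by
    change ((((2 * m - 1)‼ : ℕ) : ℚ) : ℂ) = _
    simp
  have h3 : (√2 : ℝ) ^ (2 * m + 1) = 2 ^ m * √2 := by rw [pow_succ, pow_mul, h2]
  rw [hv, hw', hd, Real.Gamma_nat_add_half, Real.sqrt_mul (by norm_num), mul_pow,
    ← Complex.ofReal_pow, h3]
  have hpi : (√Real.pi : ℂ) ≠ 0 := by
    exact_mod_cast (Real.sqrt_pos.2 Real.pi_pos).ne'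
  push_cast
  field_simp

/-- Termwise, η_{N-1}(v) is v^{1-2N} times the Taylor series of `A N` at v², so its convergence is
the analyticity of `A N`. -/
theorem eta_hasSum {I : ℂ → ℂ} {A e : ℕ → ℂ → ℂ}
    (hs : IsLaurentSplitting I (fun k => (stirlingCoeff k : ℂ)) A e) (N : ℕ) :
    ∀ᶠ v in 𝓝[≠] (0 : ℂ),
      HasSum (etaTerm ((N : ℤ) - 1) v) (v ^ (1 - 2 * (N : ℤ)) * A N (v ^ 2)) := by
  filter_upwards [nhdsWithin_le_nhds (tendsto_sq_nhds_zero.eventually (hs.hasTaylor N)),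
    self_mem_nhdsWithin] with v h (hv : v ≠ 0)
  have e0 : etaTerm ((N : ℤ) - 1) v = fun k : ℕ => v ^ (1 - 2 * (N : ℤ)) *
      ((stirlingCoeff k : ℂ) * (oddDoubleFactorial ((N : ℤ) - 1 - k) : ℂ) * (v ^ 2) ^ k) := by
    funext k
    have e1 : v ^ (1 - 2 * (N : ℤ)) = v⁻¹ * (v ^ (2 * ((N : ℤ) - 1 - k)))⁻¹ / (v ^ 2) ^ k := by
      rw [← zpow_neg, ← zpow_neg_one, ← zpow_add₀ hv, ← pow_mul, ← zpow_natCast, ← zpow_sub₀ hv]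
      congr 1
      push_cast
      ring
    rw [etaTerm, e1]
    field_simp
  rw [e0]
  exact h.mul_left _

/-- Stirling's series to order n leaves O(s^n s^{-1/2} s^{-n-1}) = O(s^{-3/2}) at infinity, while
near 0 the density is bounded and all subtracted exponents are at least -1/2. -/
theorem exists_laplaceDensity_remainder (n : ℕ) : ∃ r : ℝ → ℂ, IntegrableOn r (Set.Ioi 0) ∧
    ∀ s > 0, laplaceDensity n s = r s + ∑ k ∈ Finset.range (n + 1), (stirlingCoeff k : ℂ) *
      ((((√(2 * Real.pi))⁻¹ : ℝ) : ℂ) * (s ^ (((n - k : ℕ) : ℝ) + 1 / 2 - 1) : ℝ)) := by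
  obtain ⟨C, S, hS, hC⟩ := exists_stirlingRatio_sub_le n
  set T : ℝ → ℂ := fun s => ∑ k ∈ Finset.range (n + 1), (stirlingCoeff k : ℂ) *
      ((((√(2 * Real.pi))⁻¹ : ℝ) : ℂ) * (s ^ (((n - k : ℕ) : ℝ) + 1 / 2 - 1) : ℝ)) with hT
  have hTc : ContinuousOn T (Set.Ioi 0) := by
    refine continuousOn_finsetSum _ fun k _ => continuousOn_const.mul (continuousOn_const.mul ?_)
    refine Complex.continuous_ofReal.comp_continuousOn fun s hs => ?_
    exact (Real.continuousAt_rpow_const _ _ (Or.inl (ne_of_gt hs))).continuousWithinAt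
  have hmeas : AEStronglyMeasurable (fun s => laplaceDensity n s - T s)
      (volume.restrict (Set.Ioi 0)) :=
    (aestronglyMeasurable_laplaceDensity n).sub (hTc.aestronglyMeasurable measurableSet_Ioi)
  have hS0 : 0 < S := by linarith
  refine ⟨fun s => laplaceDensity n s - T s, ?_, fun s _ => (sub_add_cancel _ _).symm⟩
  rw [← Set.Ioc_union_Ioi_eq_Ioi hS0.le]
  refine IntegrableOn.union ?_ ?_
  · refine Integrable.sub ?_ ?_
    · refine Integrable.of_bound (C := S ^ n)
        ((aestronglyMeasurable_laplaceDensity n).mono_measure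
          (Measure.restrict_mono Set.Ioc_subset_Ioi_self le_rfl)) ?_
      refine (ae_restrict_iff' measurableSet_Ioc).2 (Eventually.of_forall fun s hs => ?_)
      refine (norm_laplaceDensity_le n s hs.1).trans ?_
      rw [Real.rpow_natCast]
      exact pow_le_pow_left₀ hs.1.le hs.2 n
    · refine integrable_finsetSum _ fun k _ => Integrable.const_mul (Integrable.const_mul ?_ _) _
      have h0 : (0 : ℝ) ≤ ((n - k : ℕ) : ℝ) := Nat.cast_nonneg _
      have := intervalIntegral.intervalIntegrable_rpow' (a := 0) (b := S)
        (r := ((n - k : ℕ) : ℝ) + 1 / 2 - 1) (by linarith)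
      rw [intervalIntegrable_iff_integrableOn_Ioc_of_le hS0.le] at this
      exact Integrable.ofReal this
  · have hi : IntegrableOn (fun s : ℝ => C * s ^ (-3 / 2 : ℝ)) (Set.Ioi S) :=
      (integrableOn_Ioi_rpow_of_lt (by norm_num) hS0).const_mul C
    refine hi.mono' (hmeas.mono_measure
      (Measure.restrict_mono (Set.Ioi_subset_Ioi hS0.le) le_rfl)) ?_
    refine (ae_restrict_iff' measurableSet_Ioi).2 (Eventually.of_forall fun s (hs : S < s) => ?_)
    have hs0 : 0 < s := hS0.trans hs
    have hp : 0 < √(2 * Real.pi) := Real.sqrt_pos.2 (by positivity)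
    have hq : 0 < √s := Real.sqrt_pos.2 hs0
    have hsq : √s ^ 2 = s := Real.sq_sqrt hs0.le
    have e1 : ∀ k ∈ Finset.range (n + 1), s ^ (((n - k : ℕ) : ℝ) + 1 / 2 - 1) =
        s ^ n * s⁻¹ ^ k / √s := by
      intro k hk
      have hk' : k ≤ n := Nat.lt_succ_iff.1 (Finset.mem_range.1 hk)
      have e : ((n - k : ℕ) : ℝ) + 1 / 2 - 1 = ((n - k : ℕ) : ℝ) - 1 / 2 := by ring
      rw [e, Real.rpow_sub hs0, Real.rpow_natCast, ← Real.sqrt_eq_rpow, pow_sub₀ _ hs0.ne' hk',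
        inv_pow]
    have e2 : laplaceDensity n s - T s = (((√(2 * Real.pi))⁻¹ * (s ^ n / √s) *
        (stirlingRatio s * √(2 * Real.pi * s) -
          ∑ k ∈ Finset.range (n + 1), (stirlingCoeff k : ℝ) * s⁻¹ ^ k) : ℝ) : ℂ) := by
      have e3 : T s = (((√(2 * Real.pi))⁻¹ * (s ^ n / √s) *
          ∑ k ∈ Finset.range (n + 1), (stirlingCoeff k : ℝ) * s⁻¹ ^ k : ℝ) : ℂ) := by
        rw [hT, Finset.mul_sum]
        push_cast
        refine Finset.sum_congr rfl fun k hk => ?_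
        rw [e1 k hk]
        push_cast
        ring
      rw [e3, laplaceDensity, Real.sqrt_mul (by positivity : 0 ≤ 2 * Real.pi) s, mul_sub, Complex.ofReal_sub]
      congr 1
      norm_cast
      field_simp
    rw [e2, Complex.norm_real, norm_mul, Real.norm_of_nonneg (by positivity)]
    have h1 : (√(2 * Real.pi))⁻¹ ≤ 1 := by
      refine inv_le_one_of_one_le₀ (Real.one_le_sqrt.2 ?_)
      linarith [Real.pi_gt_three]
    have e4 : s ^ (-3 / 2 : ℝ) = s ^ n / √s * s⁻¹ ^ (n + 1) := by
      have e : (-3 / 2 : ℝ) = -(1 : ℕ) - 1 / 2 := by norm_num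
      rw [e, Real.rpow_sub hs0, Real.rpow_neg hs0.le, Real.rpow_natCast, ← Real.sqrt_eq_rpow,
        inv_pow, pow_succ]
      field_simp
      ring
    calc (√(2 * Real.pi))⁻¹ * (s ^ n / √s) * ‖_‖
        ≤ 1 * (s ^ n / √s) * (C * s⁻¹ ^ (n + 1)) := by
          gcongr
          exact hC s hs.le
      _ = C * s ^ (-3 / 2 : ℝ) := by rw [e4]; ring

/-- Watson's lemma for the Laplace transform. -/
theorem exists_laplaceTransform_sub_le (n : ℕ) : ∃ C : ℝ, ∀ w : ℂ, 0 < w.re →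
    ‖laplaceTransform n w - ∑ k ∈ Finset.range (n + 1), (stirlingCoeff k : ℂ) *
      ((oddDoubleFactorial ((n - k : ℕ) : ℤ) : ℂ) *
        (((2 * w) ^ (1 / 2 : ℂ)) ^ (2 * (n - k) + 1))⁻¹)‖ ≤ C := by
  obtain ⟨r, hr, h⟩ := exists_laplaceDensity_remainder n
  -- As |e^{-sw}| ≤ 1, the L¹ norm of the remainder bounds its transform uniformly in w.
  refine ⟨∫ s in Set.Ioi (0 : ℝ), ‖r s‖, fun w hw => ?_⟩
  have hle : ∀ s : ℝ, 0 < s → ‖Complex.exp (-(s : ℂ) * w)‖ ≤ 1 := by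
    intro s hs
    rw [norm_cexp_neg_ofReal_mul, Real.exp_le_one_iff]
    nlinarith
  have hrw : IntegrableOn (fun s => r s * Complex.exp (-(s : ℂ) * w)) (Set.Ioi 0) := by
    refine hr.norm.mono' (aestronglyMeasurable_mul_cexp_neg hr.aestronglyMeasurable w) ?_
    refine (ae_restrict_iff' measurableSet_Ioi).2 (Eventually.of_forall fun s hs => ?_)
    rw [norm_mul]
    exact mul_le_of_le_one_right (norm_nonneg _) (hle s hs)
  have hk : ∀ m : ℕ, IntegrableOn (fun s : ℝ => ((s ^ ((m : ℝ) + 1 / 2 - 1) : ℝ) : ℂ) *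
      Complex.exp (-(s : ℂ) * w)) (Set.Ioi 0) := by
    intro m
    have h0 : (0 : ℝ) ≤ m := Nat.cast_nonneg _
    refine integrableOn_laplace (p := (m : ℝ) + 1 / 2 - 1) (by linarith)
      (aestronglyMeasurable_ofReal_rpow _) (fun s hs => ?_) hw
    rw [Complex.norm_real, Real.norm_of_nonneg (by positivity)]
  have e1 : laplaceTransform n w = (∫ s in Set.Ioi (0 : ℝ), r s * Complex.exp (-(s : ℂ) * w)) +
      ∑ k ∈ Finset.range (n + 1), (stirlingCoeff k : ℂ) *
        ((oddDoubleFactorial ((n - k : ℕ) : ℤ) : ℂ) *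
          (((2 * w) ^ (1 / 2 : ℂ)) ^ (2 * (n - k) + 1))⁻¹) := by
    have e2 : ∀ s ∈ Set.Ioi (0 : ℝ), laplaceDensity n s * Complex.exp (-(s : ℂ) * w) =
        r s * Complex.exp (-(s : ℂ) * w) + ∑ k ∈ Finset.range (n + 1), (stirlingCoeff k : ℂ) *
          ((((√(2 * Real.pi))⁻¹ : ℝ) : ℂ) * (((s ^ (((n - k : ℕ) : ℝ) + 1 / 2 - 1) : ℝ) : ℂ) *
            Complex.exp (-(s : ℂ) * w))) := by
      intro s hs
      rw [h s hs, add_mul, Finset.sum_mul]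
      simp only [mul_assoc]
    rw [laplaceTransform_eq, setIntegral_congr_fun measurableSet_Ioi e2, integral_add hrw
      (integrable_finsetSum _ fun k _ => ((hk _).const_mul _).const_mul _),
      integral_finsetSum _ fun k _ => ((hk _).const_mul _).const_mul _]
    congr 1
    refine Finset.sum_congr rfl fun k _ => ?_
    rw [integral_const_mul, integral_const_mul, integral_rpow_mul_cexp_neg_mul (by positivity) hw,
      ← inv_sqrt_two_pi_mul_Gamma_mul_cpow _ hw]
    push_cast
    rfl
  rw [e1, add_sub_cancel_right]
  refine (norm_integral_le_integral_norm _).trans (setIntegral_mono_on hrw.norm hr.norm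
    measurableSet_Ioi fun s hs => ?_)
  rw [norm_mul]
  exact mul_le_of_le_one_right (norm_nonneg _) (hle s hs)

/-- The exact and the asymptotic form of the n-th transform differ by a bounded amount as w = x/2 →
0⁺. Multiplied by v^{2n+1}, this leaves a power series in x = v² of size O(x^n √x). Its coefficients
below n vanish by induction, and the n-th is (α_n - s_n)(-1)!!. -/
theorem IsLaurentSplitting.coeff_eq_stirlingCoeff {V I : ℂ → ℂ} {α : ℕ → ℂ}
    {A e : ℕ → ℂ → ℂ} (hs : IsLaurentSplitting I α A e) (hl : IsLocalCoord V I) (n : ℕ) :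
    α n = stirlingCoeff n := by
  induction n using Nat.strong_induction_on with
  | _ n ih =>
  obtain ⟨h, hh, he⟩ := hs.exists_laplaceTransform_eq hl n
  obtain ⟨C, hC⟩ := exists_laplaceTransform_sub_le n
  set c : ℕ → ℂ := fun k =>
    (stirlingCoeff k : ℂ) * (oddDoubleFactorial ((n - k : ℕ) : ℤ) : ℂ) with hc
  have hT := (hs.hasTaylor (n + 1)).sub (HasTaylor.finset_sum (Finset.range (n + 1))
    fun k => (HasTaylor.pow (𝕜 := ℂ) k).const_mul (c k))
  have hb : ∀ j ≤ n, α j * (oddDoubleFactorial (((n + 1 : ℕ) : ℤ) - 1 - j) : ℂ) -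
      ∑ k ∈ Finset.range (n + 1), c k * (if j = k then 1 else 0) =
      (α j - stirlingCoeff j) * (oddDoubleFactorial ((n - j : ℕ) : ℤ) : ℂ) := by
    intro j hj
    have e1 : ((n + 1 : ℕ) : ℤ) - 1 - j = ((n - j : ℕ) : ℤ) := by omega
    have e2 : j < n + 1 := by omega
    simp only [mul_ite, mul_one, mul_zero, Finset.sum_ite_eq, Finset.mem_range, e2, if_true, e1, hc]
    ring
  have hz := hT.eq_zero_of_le (n := n) (C := C + (‖h 0‖ + 1)) (fun k hk => by
    rw [hb k hk.le, ih k hk, sub_self, zero_mul]) ?_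
  · rw [hb n le_rfl] at hz
    have h0 : (oddDoubleFactorial ((n - n : ℕ) : ℤ) : ℂ) ≠ 0 := by
      exact_mod_cast oddDoubleFactorial_ne_zero _
    exact sub_eq_zero.1 ((mul_eq_zero.1 hz).resolve_right h0)
  have hx : Tendsto (fun x : ℝ => (x : ℂ) / 2) (𝓝[>] 0) (𝓝 0) := by
    have : Continuous fun x : ℝ => (x : ℂ) / 2 := by fun_prop
    have := this.tendsto 0
    rw [Complex.ofReal_zero, zero_div] at this
    exact this.mono_left nhdsWithin_le_nhds
  filter_upwards [hx.eventually he, hx.eventually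
    (hh.continuousAt.norm.eventually_le_const (lt_add_one ‖h 0‖)), self_mem_nhdsWithin]
    with x h1 h2 (h3 : 0 < x)
  have hw : 0 < ((x : ℂ) / 2).re := by
    rw [show (x : ℂ) / 2 = ((x / 2 : ℝ) : ℂ) by push_cast; ring, Complex.ofReal_re]
    positivity
  have h4 := hC _ hw
  have hv0 := two_mul_cpow_half_ne_zero hw
  have hv2 := sq_cpow_half (2 * ((x : ℂ) / 2))
  rw [h1 hw] at h4
  set v := (2 * ((x : ℂ) / 2)) ^ (1 / 2 : ℂ) with hv
  have hv3 : v ^ 2 = x := by rw [hv2]; ring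
  have hn1 : ‖v‖ ^ 2 = x := by
    rw [← norm_pow, hv3, Complex.norm_real, Real.norm_of_nonneg h3.le]
  have hn2 : ‖v‖ ^ (2 * n + 1) = x ^ n * √x := by
    rw [pow_succ, pow_mul, hn1, ← hn1, Real.sqrt_sq (norm_nonneg _), hn1]
  have e1 : v ^ (1 - 2 * ((n + 1 : ℕ) : ℤ)) = (v ^ (2 * n + 1))⁻¹ := by
    rw [← zpow_natCast, ← zpow_neg]
    congr 1
  have e2 : A (n + 1) x - ∑ k ∈ Finset.range (n + 1), c k * (x : ℂ) ^ k =
      v ^ (2 * n + 1) * ((v ^ (1 - 2 * ((n + 1 : ℕ) : ℤ)) * A (n + 1) (v ^ 2) + h ((x : ℂ) / 2) -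
        ∑ k ∈ Finset.range (n + 1), (stirlingCoeff k : ℂ) *
          ((oddDoubleFactorial ((n - k : ℕ) : ℤ) : ℂ) * (v ^ (2 * (n - k) + 1))⁻¹)) -
        h ((x : ℂ) / 2)) := by
    have e3 : ∑ k ∈ Finset.range (n + 1), c k * (x : ℂ) ^ k =
        v ^ (2 * n + 1) * ∑ k ∈ Finset.range (n + 1), (stirlingCoeff k : ℂ) *
          ((oddDoubleFactorial ((n - k : ℕ) : ℤ) : ℂ) * (v ^ (2 * (n - k) + 1))⁻¹) := by
      rw [Finset.mul_sum]
      refine Finset.sum_congr rfl fun k hk => ?_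
      have hk' : k ≤ n := Nat.lt_succ_iff.1 (Finset.mem_range.1 hk)
      have e4 : v ^ (2 * n + 1) = v ^ (2 * (n - k) + 1) * (v ^ 2) ^ k := by
        rw [← pow_mul, ← pow_add]
        congr 1
        omega
      rw [e4, hv3, hc]
      field_simp
    rw [e3, e1, hv3]
    field_simp
    ring
  rw [e2, norm_mul, norm_pow, hn2, mul_comm]
  refine mul_le_mul_of_nonneg_right ((norm_sub_le _ _).trans (add_le_add h4 h2)) (by positivity)

/-! ### Comparison of η_n with ξ̂_n, and conclusion -/

theorem IsLocalCoord.exists_eta {V I : ℂ → ℂ} (hl : IsLocalCoord V I) :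
    ∃ A e, IsLaurentSplitting I (fun k => (stirlingCoeff k : ℂ)) A e := by
  obtain ⟨α, A, e, hs⟩ := hl.exists_isLaurentSplitting
  have : α = fun k => (stirlingCoeff k : ℂ) := funext (hs.coeff_eq_stirlingCoeff hl)
  exact ⟨A, e, this ▸ hs⟩

theorem eta_eq {I : ℂ → ℂ} {A e : ℕ → ℂ → ℂ}
    (hs : IsLaurentSplitting I (fun k => (stirlingCoeff k : ℂ)) A e) (N : ℕ) :
    ∀ᶠ v in 𝓝[≠] (0 : ℂ), eta ((N : ℤ) - 1) v = v ^ (1 - 2 * (N : ℤ)) * A N (v ^ 2) :=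
  (eta_hasSum hs N).mono fun _ h => h.tsum_eq

theorem eta_neg (n : ℤ) (v : ℂ) : eta n (-v) = -eta n v := by
  rw [eta, eta, ← tsum_neg]
  congr 1
  funext k
  rw [etaTerm, etaTerm, (even_two_mul _).neg_zpow, inv_neg, neg_mul]

theorem eta_eq_xiHat_sub {I : ℂ → ℂ} {A e : ℕ → ℂ → ℂ}
    (hs : IsLaurentSplitting I (fun k => (stirlingCoeff k : ℂ)) A e) (N : ℕ) :
    ∀ᶠ v in 𝓝[≠] (0 : ℂ),
      eta ((N : ℤ) - 1) v = xiHat ((N : ℤ) - 1) (I v)⁻¹ - e N (v ^ 2 / 2) := by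
  filter_upwards [eta_eq hs N, hs.eq N] with v h1 h2
  rw [h1, h2]
  ring

theorem tendsto_neg_vCoord {V I : ℂ → ℂ} (hl : IsLocalCoord V I) :
    Tendsto (fun t => -vCoord t) (cobounded ℂ) (𝓝[≠] 0) := by
  have h := tendsto_nhdsWithin_iff.1 hl.tendsto_vCoord
  refine tendsto_nhdsWithin_iff.2 ⟨by simpa using h.1.neg, h.2.mono fun t ht => ?_⟩
  simpa using ht

/-- The points t and s(t) have coordinates ±v and the same w, so the same even part is subtracted
from ξ̂_n at both. Oddness of η_n then yields the odd-part formula. -/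
theorem eta_vCoord_eq {V I : ℂ → ℂ} (hl : IsLocalCoord V I) {A e : ℕ → ℂ → ℂ}
    (hs : IsLaurentSplitting I (fun k => (stirlingCoeff k : ℂ)) A e) (N : ℕ) :
    ∀ᶠ t in cobounded ℂ,
      eta ((N : ℤ) - 1) (vCoord t) = xiHat ((N : ℤ) - 1) t - e N (wCoord t) ∧
      eta ((N : ℤ) - 1) (-vCoord t) =
        xiHat ((N : ℤ) - 1) (deckInvolution t) - e N (wCoord t) := by
  filter_upwards [hl.tendsto_vCoord.eventually (eta_eq_xiHat_sub hs N),
    (tendsto_neg_vCoord hl).eventually (eta_eq_xiHat_sub hs N), hl.eq_inv_vCoord,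
    hl.deckInvolution_eq, hl.sq_vCoord] with t h1 h2 h3 h4 h5
  rw [neg_sq] at h2
  rw [h5, ← h3] at h1
  rw [h5, ← h4] at h2
  exact ⟨h1, h2⟩

theorem exists_natCast_sub_one {n : ℤ} (hn : -1 ≤ n) : ∃ N : ℕ, n = (N : ℤ) - 1 :=
  ⟨(n + 1).toNat, by omega⟩

theorem eta_vCoord_odd_part {V I : ℂ → ℂ} (hl : IsLocalCoord V I) {n : ℤ} (hn : -1 ≤ n) :
    ∀ᶠ t in cobounded ℂ,
      eta n (vCoord t) = 1 / 2 * (eta n (vCoord t) - eta n (-vCoord t)) ∧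
      eta n (vCoord t) = 1 / 2 * (xiHat n t - xiHat n (deckInvolution t)) := by
  obtain ⟨A, e, hs⟩ := hl.exists_eta
  obtain ⟨N, rfl⟩ := exists_natCast_sub_one hn
  filter_upwards [eta_vCoord_eq hl hs N] with t ⟨h1, h2⟩
  rw [eta_neg] at h2 ⊢
  exact ⟨by ring, by linear_combination (1 / 2 : ℂ) * h1 - (1 / 2 : ℂ) * h2⟩

theorem eta_neg_one_vCoord {V I : ℂ → ℂ} (hl : IsLocalCoord V I) : ∀ᶠ t in cobounded ℂ,
    eta (-1) (vCoord t) = 1 / 2 * ((t - deckInvolution t) / (t * deckInvolution t)) := by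
  have h0 : ∀ᶠ t in cobounded ℂ, t ≠ 0 := eventually_ne_cobounded 0
  filter_upwards [eta_vCoord_odd_part hl le_rfl, h0,
    isDeckTransformation_deckInvolution.1.eventually h0] with t h ht hd
  have e : ∀ t, xiHat (-1) t = (t - 1) / t := fun _ => rfl
  rw [h.2, e, e]
  field_simp
  ring

end

theorem mainTheorem6 :
    -- the Laurent series `η_n` converge near `0`
    (∀ n : ℤ, -1 ≤ n → ∀ᶠ v in 𝓝[≠] (0 : ℂ), Summable (etaTerm n v)) ∧
    -- the Laplace transform, with `v = √(2w)` the principal square root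
    (∀ n : ℕ,
      (∀ w : ℂ, 0 < w.re → IntegrableOn (laplaceIntegrand n w) (Set.Ioi 0)) ∧
      ∃ (c : ℂ) (h : ℂ → ℂ), AnalyticAt ℂ h 0 ∧ h 0 = 0 ∧
        ∀ᶠ w in 𝓝 (0 : ℂ), 0 < w.re →
          ∫ s in Set.Ioi (0 : ℝ), laplaceIntegrand n w s
            = eta (n : ℤ) ((2 * w) ^ (1 / 2 : ℂ)) + c + h w) ∧
    -- the branch of the square root used there is the one of `v(t)`
    (∀ᶠ t in cobounded ℂ, vCoord t ^ 2 / 2 = wCoord t ∧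
      (0 < t.re → 0 < (wCoord t).re → vCoord t = (2 * wCoord t) ^ (1 / 2 : ℂ))) ∧
    -- `η_n` as the odd part of `ξ̂_n`
    (∀ n : ℤ, -1 ≤ n → ∀ᶠ t in cobounded ℂ,
      eta n (vCoord t) = 1 / 2 * (eta n (vCoord t) - eta n (-vCoord t)) ∧
      eta n (vCoord t) = 1 / 2 * (xiHat n t - xiHat n (deckInvolution t))) ∧
    -- the case `n = -1`
    (∀ᶠ t in cobounded ℂ,
      eta (-1) (vCoord t) = 1 / 2 * ((t - deckInvolution t) / (t * deckInvolution t))) ∧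
    -- comparison of `η_n` with `ξ̂_n`
    (∀ n : ℤ, -1 ≤ n → ∃ F : ℂ → ℂ, AnalyticAt ℂ F 0 ∧
      ∀ᶠ t in cobounded ℂ,
        eta n (vCoord t) = xiHat n t + F (wCoord t) ∧
        eta n (-vCoord t) = xiHat n (deckInvolution t) + F (wCoord t)) := by
  obtain ⟨V, I, hl⟩ := exists_isLocalCoord
  obtain ⟨A, e, hs⟩ := hl.exists_eta
  refine ⟨fun n hn => ?_, fun n => ⟨fun w hw => integrableOn_laplaceIntegrand n hw, ?_⟩,
    hl.sq_vCoord.and vCoord_eq_cpow_half, fun n hn => eta_vCoord_odd_part hl hn,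
    eta_neg_one_vCoord hl, fun n hn => ?_⟩
  · obtain ⟨N, rfl⟩ := exists_natCast_sub_one hn
    exact (eta_hasSum hs N).mono fun v hv => hv.summable
  · obtain ⟨h, hh, he⟩ := hs.exists_laplaceTransform_eq hl n
    -- The constant c is the value at 0 of the holomorphic part, split off to normalise h(0) = 0.
    refine ⟨h 0, fun w => h w - h 0, hh.sub analyticAt_const, sub_self _, ?_⟩
    filter_upwards [he, tendsto_cpow_half.eventually
      (eventually_nhdsWithin_iff.1 (eta_eq hs (n + 1)))] with w h1 h2 hw
    have h3 := h2 (two_mul_cpow_half_ne_zero hw)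
    have h4 : (((n + 1 : ℕ) : ℤ) - 1) = n := by push_cast; ring
    rw [h4] at h3
    have h5 := h1 hw
    rw [laplaceTransform] at h5
    rw [h5, h3]
    ring
  · obtain ⟨N, rfl⟩ := exists_natCast_sub_one hn
    refine ⟨fun w => -e N w, (hs.analyticAt N).neg, ?_⟩
    filter_upwards [eta_vCoord_eq hl hs N] with t ⟨h1, h2⟩
    rw [h1, h2]
    exact ⟨sub_eq_add_neg _ _, sub_eq_add_neg _ _⟩
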